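/- Let $q\ge 1$, let $\Xi=\Xi_1\times\cdots\times\Xi_q$ be a product of (semi-)metric spaces $(\Xi_l,\|\cdot-\cdot\|_l)$ with the product $\sigma$-algebra (for example $\Xi=\mathbb R^q$), and let $\{(Y_i,X_i)\}_{i\ge1}$ be a random sequence in $\mathbb R\times\Xi$ with $Y_i=m(X_i)+u_i$, $E(u_i\mid X_i)=0$. Let $P_X$ be the law of $X_i$ (an arbitrary probability measure), fix $x\in\Xi$, and for $h\in(0,\infty)^q$ put $\bar h=\max_l h^l$ and $$C(x,h)=\{z\in\Xi:\ \|z^l-x^l\|_l\le h^l,\ l=1,\dots,q\},\qquad h^{-1}\|x-z\|=\Big(\tfrac{\|x^1-z^1\|_1}{h^1},\dots,\tfrac{\|x^q-z^q\|_q}{h^q}\Big).$$ *Kernel.* $K:\mathbb R^q\to[0,\infty)$ is a probability density, non-increasing in each coordinate on $[0,\infty)^q$; it is either even in each coordinate with support in $[-1,1]^q$, or has support in $[0,1]^q$; and all its mixed partial derivatives of order at most one in each coordinate exist and are continuous in the interior of its support. *Data.* For some $\zeta>0$: the sequence is strictly stationary and strong mixing with coefficients $\alpha(l)<C\,l^{-\kappa}$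 ($l\ge1$), $\kappa>2(2+\zeta)/\zeta$; $\mu_2(z)=E(u_i^2\mid X_i=z)$ is continuous in a neighbourhood of $x$ and $\mu_2(x)>0$; $E|Y_i|^{2+\zeta}<\infty$ and $E(|u_i|^{2+\zeta}\mid X_i=z)$ is bounded for $z$ in a neighbourhood of $x$; for $i\ne j$ the function $(x_1,x_2)\mapsto E(|u_iu_j|\mid X_i=x_1,X_j=x_2)$ is continuous in a neighbourhood of $(x,x)$; and $E(|Y_iY_j|\mid X_i,X_j)\le C<\infty$ for all $i,j$. *Regression function.* For some $\delta>0$ and $M<\infty$, $|m(x)-m(z)|\le M\max_l\|x^l-z^l\|_l^\delta$ for all $z\in\Xi$. *Joint measure.* For some $M<\infty$ and all small $h$, $\sup_{s\ne t}\Pr(X_s\in C(x,h),X_t\in C(x,h))\le M\,P_X(C(x,h))^2$. Assume in addition either (i) $K(1,\dots,1)>0$ (type I kernel), or (ii) for some $0<\varepsilon<1$ and $1<C_\varepsilon<\infty$, $P_X(C(x,h))<C_\varepsilon P_X(C(x,\varepsilon h))$ for all small $h$. Let $h=h_n\in(0,\infty)^q$ with $h_n\to0$ and $nP_X(C(x,h))\to\infty$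 as $n\to\infty$. Let $$\widehat m(x)=\frac{\sum_{i=1}^nK(h^{-1}\|x-X_i\|)Y_i}{\sum_{i=1}^nK(h^{-1}\|x-X_i\|)}$$ (with the value $0$ when the denominator vanishes), and write $EK^s=E[K^s(h^{-1}\|x-X_1\|)]$. Then $\widehat m(x)$ is integrable and, with $\mathrm{bias}(\widehat m(x))=E\,\widehat m(x)-m(x)$, the following hold; in (a) and (c), if $x$ is a mass point of $X$, that is, if $\Pr(X_1=x)>0$, it is assumed in addition that $E(u_iu_j\mathbf 1\{X_i=x,X_j=x\})=0$ for all $i\ne j$ (automatic for i.i.d. data), where $X_i=x$ is read as $\|X_i^l-x^l\|_l=0$ for all $l$. (a) $\displaystyle \frac{\sqrt n\,EK}{\sqrt{\mu_2(x)\,EK^2}}\big(\widehat m(x)-m(x)-\mathrm{bias}(\widehat m(x))\big)\to_d N(0,1)$. (b) $\mathrm{bias}(\widehat m(x))=O(\bar h^\delta)+O\big((nP_X(C(x,h)))^{-1}\big)$, and $\sqrt n\,EK/\sqrt{\mu_2(x)EK^2}$ is of exact order $(nP_X(C(x,h)))^{1/2}$ (bounded above and below by positive constant multiples of it for large $n$).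 (c) If moreover $\bar h^{2\delta}\,nP_X(C(x,h))\to0$, then $\displaystyle \frac{\sqrt n\,EK}{\sqrt{\mu_2(x)\,EK^2}}\big(\widehat m(x)-m(x)\big)\to_d N(0,1)$. -/

import Mathlib

open MeasureTheory ProbabilityTheory Filter Topology Asymptotics

noncomputable section

namespace NW

/-! ### Kernels on `ℝ^q` -/

/-- `g` is sufficiently differentiable: for every index set `I = {j₁ < ⋯ < j_k}` the mixed partial
derivative `∂_{j₁} ⋯ ∂_{j_k} g` (the function `D I`) exists and is continuous on the interior of
the support of `g`. -/
def SufficientlyDifferentiable {q : ℕ} (g : (Fin q → ℝ) → ℝ) : Prop :=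
  ∃ D : Finset (Fin q) → (Fin q → ℝ) → ℝ,
    D ∅ = g ∧
    ∀ I : Finset (Fin q),
      ContinuousOn (D I) (interior (tsupport g)) ∧
      ∀ j : Fin q, (∀ i ∈ I, j < i) → ∀ w ∈ interior (tsupport g),
        HasDerivAt (fun t : ℝ => D I (Function.update w j t)) (D (insert j I) w) (w j)

/-- A standard kernel: a sufficiently differentiable probability density, non-increasing on the
non-negative orthant, and either even in each coordinate with support in `[-1,1]^q`, or with support
in `[0,1]^q`. -/
structure IsKernel {q : ℕ} (K : (Fin q → ℝ) → ℝ) : Prop where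
  measurable : Measurable K
  nonneg : ∀ w, 0 ≤ K w
  integrable : Integrable K
  integral_eq_one : ∫ w, K w = 1
  sufficientlyDifferentiable : SufficientlyDifferentiable K
  antitoneOn : AntitoneOn K {w | ∀ j, 0 ≤ w j}
  support :
    ((∀ w, K (fun j => |w j|) = K w) ∧ Function.support K ⊆ Set.Icc (fun _ => -1) (fun _ => 1)) ∨
      Function.support K ⊆ Set.Icc (fun _ => 0) (fun _ => 1)

/-- The extra requirement on a type I kernel: `K (1, …, 1) > 0`. -/
def IsTypeI {q : ℕ} (K : (Fin q → ℝ) → ℝ) : Prop := 0 < K (fun _ => 1)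

/-! ### Cuboids in a product of (semi-)metric spaces -/

section Cuboid

variable {q : ℕ} {Ξ : Fin q → Type*} [∀ l, PseudoMetricSpace (Ξ l)]

/-- The cuboid `C(x,h)`. -/
def cuboid (x : ∀ l, Ξ l) (h : Fin q → ℝ) : Set (∀ l, Ξ l) :=
  {z | ∀ l, dist (z l) (x l) ≤ h l}

/-- The kernel argument `h⁻¹‖x - z‖`, a vector in `[0,∞)^q`. -/
def scaledDist (x : ∀ l, Ξ l) (h : Fin q → ℝ) (z : ∀ l, Ξ l) : Fin q → ℝ :=
  fun l => (h l)⁻¹ * dist (x l) (z l)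

/-- `m` is Hölder at `x` with exponent `δ`. -/
def HolderAt (m : (∀ l, Ξ l) → ℝ) (x : ∀ l, Ξ l) (δ : ℝ) : Prop :=
  ∃ M : ℝ, ∀ z, |m x - m z| ≤ M * ⨆ l, dist (x l) (z l) ^ δ

variable [∀ l, MeasurableSpace (Ξ l)]

/-- The small-cube (doubling) condition at `x`, for all sufficiently small bandwidth vectors. -/
def SmallCubeDoubling (PX : Measure (∀ l, Ξ l)) (x : ∀ l, Ξ l) : Prop :=
  ∃ ε C H : ℝ, 0 < ε ∧ ε < 1 ∧ 1 < C ∧ 0 < H ∧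
    ∀ h : Fin q → ℝ, (∀ l, 0 < h l ∧ h l ≤ H) →
      PX.real (cuboid x h) < C * PX.real (cuboid x (ε • h))

end Cuboid

/-! ### The data generating process -/

section Sequences

variable {Ω : Type*} [MeasurableSpace Ω] {E : Type*} [MeasurableSpace E]

/-- Strict stationarity of a sequence of random elements. -/
def IsStationary (P : Measure Ω) (V : ℕ → Ω → E) : Prop :=
  ∀ k : ℕ, P.map (fun ω i => V (i + k) ω) = P.map (fun ω i => V i ω)

/-- The σ-algebra generated by `V i`, `i ∈ S`. -/
@[reducible]
def sigmaOf (V : ℕ → Ω → E) (S : Set ℕ) : MeasurableSpace Ω :=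
  ⨆ i ∈ S, MeasurableSpace.comap (V i) inferInstance

/-- The strong mixing coefficient `α(l)`. -/
def strongMixingCoeff (P : Measure Ω) (V : ℕ → Ω → E) (l : ℕ) : ℝ :=
  sSup {r | ∃ (t : ℕ) (A B : Set Ω),
    MeasurableSet[sigmaOf V (Set.Iic t)] A ∧ MeasurableSet[sigmaOf V (Set.Ici (t + l))] B ∧
    r = |P.real (A ∩ B) - P.real A * P.real B|}

end Sequences

section Model

variable {Ω : Type*} [MeasurableSpace Ω] {q : ℕ} {Ξ : Fin q → Type*}
  [∀ l, PseudoMetricSpace (Ξ l)] [∀ l, MeasurableSpace (Ξ l)]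

/-- The regression error `u_i = Y_i - m(X_i)`. -/
def err (Y : ℕ → Ω → ℝ) (X : ℕ → Ω → ∀ l, Ξ l) (m : (∀ l, Ξ l) → ℝ) (i : ℕ) (ω : Ω) : ℝ :=
  Y i ω - m (X i ω)

/-- The assumptions on the data generating process and its moments at the point `x`; the function
`m` is the regression function and `μ₂` the conditional variance of the error. -/
structure DataAssumptions (P : Measure Ω) (Y : ℕ → Ω → ℝ) (X : ℕ → Ω → ∀ l, Ξ l)
    (m μ₂ : (∀ l, Ξ l) → ℝ) (x : ∀ l, Ξ l) (ζ : ℝ) : Prop where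
  measurable_Y : ∀ i, Measurable (Y i)
  measurable_X : ∀ i, Measurable (X i)
  measurable_m : Measurable m
  measurable_μ₂ : Measurable μ₂
  zeta_pos : 0 < ζ
  stationary : IsStationary P (fun i ω => (Y i ω, X i ω))
  mixing : ∃ C κ : ℝ, 2 * (2 + ζ) / ζ < κ ∧
    ∀ l : ℕ, 1 ≤ l → strongMixingCoeff P (fun i ω => (Y i ω, X i ω)) l < C * (l : ℝ) ^ (-κ)
  /-- `E|Y|^{2+ζ} < ∞`. -/
  moment_Y : ∀ i, Integrable (fun ω => |Y i ω| ^ (2 + ζ)) P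
  /-- `E(Y | X) = m(X)`, that is, `E(u | X) = 0`. -/
  condExp_Y : ∀ i,
    P[Y i | MeasurableSpace.comap (X i) inferInstance] =ᵐ[P] fun ω => m (X i ω)
  /-- `E(u² | X) = μ₂(X)`. -/
  condExp_err_sq : ∀ i,
    P[fun ω => err Y X m i ω ^ 2 | MeasurableSpace.comap (X i) inferInstance]
      =ᵐ[P] fun ω => μ₂ (X i ω)
  μ₂_pos : 0 < μ₂ x
  μ₂_continuous : ∃ U ∈ 𝓝 x, ContinuousOn μ₂ U
  /-- `E(|u|^{2+ζ} | X = z)` is bounded for `z` near `x`. -/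
  moment_err : ∃ M : ℝ, ∃ U ∈ 𝓝 x, ∀ i, ∀ᵐ ω ∂P, X i ω ∈ U →
    (P[fun ω' => |err Y X m i ω'| ^ (2 + ζ) | MeasurableSpace.comap (X i) inferInstance]) ω ≤ M
  /-- `E(|u_i u_j| | X_i = x₁, X_j = x₂)` is continuous near `(x,x)`. -/
  joint_err : ∀ i j, i ≠ j → ∃ μ : (∀ l, Ξ l) × (∀ l, Ξ l) → ℝ, Measurable μ ∧
    (P[fun ω => |err Y X m i ω * err Y X m j ω| |
        MeasurableSpace.comap (fun ω => (X i ω, X j ω)) inferInstance]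
      =ᵐ[P] fun ω => μ (X i ω, X j ω)) ∧
    ∃ U ∈ 𝓝 (x, x), ContinuousOn μ U
  /-- `E(|Y_i Y_j| | X_i, X_j) ≤ C` for all `i, j`. -/
  joint_Y : ∃ C : ℝ, ∀ i j, ∀ᵐ ω ∂P,
    (P[fun ω' => |Y i ω' * Y j ω'| |
        MeasurableSpace.comap (fun ω' => (X i ω', X j ω')) inferInstance]) ω ≤ C

/-- The joint measure condition at `x`, for all sufficiently small bandwidth vectors. -/
def JointMeasureBound (P : Measure Ω) (X : ℕ → Ω → ∀ l, Ξ l) (x : ∀ l, Ξ l) : Prop :=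
  ∃ M H : ℝ, 0 < M ∧ 0 < H ∧ ∀ h : Fin q → ℝ, (∀ l, 0 < h l ∧ h l ≤ H) → ∀ s t : ℕ, s ≠ t →
    P.real {ω | X s ω ∈ cuboid x h ∧ X t ω ∈ cuboid x h}
      ≤ M * (P.map (X 0)).real (cuboid x h) ^ 2

/-- No serial correlation of the errors at a mass point: `E(u_i u_j 1{X_i = x, X_j = x}) = 0` for
`i ≠ j`, where `X_i = x` means that all the (semi-)distances `‖X_i^l - x^l‖_l` vanish. It holds
trivially when `P(X_0 = x) = 0`, and it holds for independent observations. -/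
def UncorrelatedAtMassPoint (P : Measure Ω) (Y : ℕ → Ω → ℝ) (X : ℕ → Ω → ∀ l, Ξ l)
    (m : (∀ l, Ξ l) → ℝ) (x : ∀ l, Ξ l) : Prop :=
  ∀ i j : ℕ, i ≠ j →
    ∫ ω in {ω | X i ω ∈ cuboid x 0 ∧ X j ω ∈ cuboid x 0}, err Y X m i ω * err Y X m j ω ∂P = 0

/-! ### The Nadaraya–Watson estimator -/

/-- `B_n(x)`, for the sample `(Y_i, X_i)`, `i < n`. -/
def Bn (K : (Fin q → ℝ) → ℝ) (X : ℕ → Ω → ∀ l, Ξ l) (x : ∀ l, Ξ l) (h : Fin q → ℝ) (n : ℕ)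
    (ω : Ω) : ℝ :=
  (n : ℝ)⁻¹ * ∑ i ∈ Finset.range n, K (scaledDist x h (X i ω))

/-- `A_n(x)`. -/
def An (K : (Fin q → ℝ) → ℝ) (Y : ℕ → Ω → ℝ) (X : ℕ → Ω → ∀ l, Ξ l) (x : ∀ l, Ξ l)
    (h : Fin q → ℝ) (n : ℕ) (ω : Ω) : ℝ :=
  (n : ℝ)⁻¹ * ∑ i ∈ Finset.range n, K (scaledDist x h (X i ω)) * Y i ω

/-- The Nadaraya–Watson estimator `B_n(x)⁻¹ A_n(x)`, equal to `0` if all the weights vanish. -/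
def mhat (K : (Fin q → ℝ) → ℝ) (Y : ℕ → Ω → ℝ) (X : ℕ → Ω → ∀ l, Ξ l) (x : ∀ l, Ξ l)
    (h : Fin q → ℝ) (n : ℕ) (ω : Ω) : ℝ :=
  (Bn K X x h n ω)⁻¹ * An K Y X x h n ω

/-- `E(m̂(x)) - m(x)`. -/
def bias (P : Measure Ω) (K : (Fin q → ℝ) → ℝ) (Y : ℕ → Ω → ℝ) (X : ℕ → Ω → ∀ l, Ξ l)
    (m : (∀ l, Ξ l) → ℝ) (x : ∀ l, Ξ l) (h : Fin q → ℝ) (n : ℕ) : ℝ :=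
  ∫ ω, mhat K Y X x h n ω ∂P - m x

/-- The standardisation `√n E K / √(μ₂(x) E K²)`. -/
def scale (P : Measure Ω) (K : (Fin q → ℝ) → ℝ) (X : ℕ → Ω → ∀ l, Ξ l)
    (μ₂ : (∀ l, Ξ l) → ℝ) (x : ∀ l, Ξ l) (h : Fin q → ℝ) (n : ℕ) : ℝ :=
  √n * (∫ ω, K (scaledDist x h (X 0 ω)) ∂P) /
    √(μ₂ x * ∫ ω, K (scaledDist x h (X 0 ω)) ^ 2 ∂P)

end Model

end NW

end

set_option linter.unusedSectionVars false

noncomputable section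

namespace NW

/-! ### Covariance inequalities under strong mixing -/

section Mixing

variable {Ω : Type*}

/-! Write p for the probability of the cuboid, L = n p, η for the bandwidth power h̄^δ, N for the
kernel-weighted sum of the errors u_i, D for the sum of the weights and d = n EK for its mean. All
three conclusions come from one expansion, `IsKernel.exists_linearisation`: m̂(x) - m(x) = N/d + b_n
+ R_n, where b_n is deterministic with |b_n| ≤ βη and E|R_n| = O(1/L + η/√L). Since N has mean zero,
taking expectations shows that the bias differs from b_n by the same order. Since EK and EK² are
both of order p, the standardisation is of order √L, and the scaled remainder is O(1/√L + η), which
vanishes. So (a) is a central limit theorem for N, (b) is the size of b_n plus that of the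
remainder, and (c) only needs √L η → 0. The remainder must be controlled in mean, not merely in
probability, because the bias is the expectation of a ratio.

Dependence enters through `exists_abs_acov_le`. A function supported where X lies in the cuboid,
with a moment of order 2+ζ of size O(p), has autocovariance at most D p l^(-c) at lag l, with c > 1
and D independent of the function. To see this, truncate at a power of l. The remainder is
controlled by the moment. The bounded part is controlled both by mixing and by the joint measure
condition, which gives O(p²), and the geometric mean of the two bounds keeps one factor p and half
the mixing exponent. The assumed mixing rate is just what makes both contributions summable.
Consequently sums of n such functions have variance O(L), uniformly.

The ratio is linearised separately for its two parts. The error part N/D is compared with N/d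
(`integral_abs_div_sub_div_le`): where D is at least a fixed fraction of d, Cauchy-type bounds give
1/L. The event where D is smaller needs more than Chebyshev, since N/D is unbounded there. Because
the weights are non-negative, D is small only if three separated subsums are all small, and mixing
nearly multiplies their probabilities, giving O(L^(-3) + n^(-κ)) (`exists_measureReal_sum_lt_le`).
This is weighed against a moment bound for N/D that does not involve the denominator. The increments
of m are bounded after division by η, so their weighted average concentrates at rate 1/√L, and
scaling back gives η/√L.

The central limit theorem (`tendstoInDistribution_sum_localized`) is Bernstein's blocking method
with truncation. The covariances at each fixed lag vanish relative to p
(`IsKernel.tendsto_acov_div`): if x is not a mass point, because joint visits are of order p² with p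
→ 0; if it is, by the extra assumption of no serial correlation. Dominated convergence over lags
then makes the variance of the sum asymptotically that of independent terms. Lyapunov's condition
follows from a third moment bound that only uses pairwise visits to the cuboid, so one choice of
block lengths works for every rate at which p decreases. -/

/-- Two finite measures which are `α`-close on a sub-σ-algebra integrate `[0,1]`-valued measurable
functions `α`-closely. -/
lemma abs_integral_sub_integral_le_of_close {m m0 : MeasurableSpace Ω} (hm : m ≤ m0)
    (μ ν : Measure[m0] Ω) [IsFiniteMeasure μ] [IsFiniteMeasure ν] {α : ℝ}
    (h : ∀ A, MeasurableSet[m] A → |μ.real A - ν.real A| ≤ α) {f : Ω → ℝ}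
    (hf : Measurable[m] f) (h0 : ∀ ω, 0 ≤ f ω) (h1 : ∀ ω, f ω ≤ 1) :
    |∫ ω, f ω ∂μ - ∫ ω, f ω ∂ν| ≤ α := by
  have hfm : Measurable[m0] f := hf.mono hm le_rfl
  -- Layer-cake formula: the level sets {t < f} belong to the sub-σ-algebra and only t in (0,1]
  -- contributes, so closeness on sets integrates to closeness of the integrals without loss of
  -- constants.
  have key : ∀ (ρ : Measure[m0] Ω) [IsFiniteMeasure ρ],
      IntegrableOn (fun t => ρ.real {a | t < f a}) (Set.Ioc 0 1) ∧
      ∫ ω, f ω ∂ρ = ∫ t in Set.Ioc (0 : ℝ) 1, ρ.real {a | t < f a} := by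
    intro ρ _
    have hInt : Integrable f ρ := by
      refine Integrable.of_bound hfm.aestronglyMeasurable 1 (ae_of_all _ fun ω => ?_)
      rw [Real.norm_eq_abs, abs_of_nonneg (h0 ω)]; exact h1 ω
    have hanti : Antitone (fun t => ρ.real {a | t < f a}) := fun s t hst =>
      measureReal_mono (fun a (ha : t < f a) => lt_of_le_of_lt hst ha)
    refine ⟨?_, ?_⟩
    · refine Measure.integrableOn_of_bounded (M := ρ.real Set.univ) (by simp)
        hanti.measurable.aestronglyMeasurable (ae_of_all _ fun t => ?_)
      rw [Real.norm_eq_abs, abs_of_nonneg measureReal_nonneg]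
      exact measureReal_mono (Set.subset_univ _)
    · rw [hInt.integral_eq_integral_meas_lt (ae_of_all _ h0)]
      refine setIntegral_eq_of_subset_of_forall_sdiff_eq_zero measurableSet_Ioi
        Set.Ioc_subset_Ioi_self fun t ht => ?_
      have ht1 : 1 < t := by
        rcases ht with ⟨h2, h3⟩
        by_contra h4
        exact h3 ⟨h2, not_lt.1 h4⟩
      have : {a | t < f a} = ∅ := by
        ext a; simp only [Set.mem_ofPred_eq, Set.mem_empty_iff_false, iff_false, not_lt]
        exact (h1 a).trans ht1.le
      simp [this]
  rw [(key μ).2, (key ν).2, ← integral_sub (key μ).1 (key ν).1, ← Real.norm_eq_abs]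
  have := norm_setIntegral_le_of_norm_le_const (μ := (volume : Measure ℝ)) (s := Set.Ioc 0 1)
    (f := fun t => μ.real {a | t < f a} - ν.real {a | t < f a}) (C := α) (by simp)
    (fun t _ => h _ (hf measurableSet_Ioi))
  simpa using this

/-- Two σ-algebras are `α`-mixing. -/
def AlphaMixing {m0 : MeasurableSpace Ω} (P : Measure Ω) (𝒜 ℬ : MeasurableSpace Ω) (α : ℝ) : Prop :=
  ∀ A B, MeasurableSet[𝒜] A → MeasurableSet[ℬ] B → |P.real (A ∩ B) - P.real A * P.real B| ≤ α

variable {𝒜 ℬ : MeasurableSpace Ω} {m0 : MeasurableSpace Ω} {P : Measure Ω}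
  [IsProbabilityMeasure P] {α : ℝ}

/-- Two applications of the layer-cake comparison, one variable at a time. With B fixed, compare the
restriction of P to B with P(B)·P on 𝒜; the result says that the measure with density f and the
multiple (∫ f)·P are close on ℬ, and the comparison is repeated with g. -/
lemma AlphaMixing.cov_unit_le (h : AlphaMixing P 𝒜 ℬ α) (hA : 𝒜 ≤ m0) (hB : ℬ ≤ m0) {f g : Ω → ℝ}
    (hf : Measurable[𝒜] f) (hg : Measurable[ℬ] g) (hf0 : ∀ ω, 0 ≤ f ω) (hf1 : ∀ ω, f ω ≤ 1)
    (hg0 : ∀ ω, 0 ≤ g ω) (hg1 : ∀ ω, g ω ≤ 1) :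
    |∫ ω, f ω * g ω ∂P - (∫ ω, f ω ∂P) * ∫ ω, g ω ∂P| ≤ α := by
  have hfm : Measurable[m0] f := hf.mono hA le_rfl
  have hfi : Integrable f P := by
    refine Integrable.of_bound hfm.aestronglyMeasurable 1 (ae_of_all _ fun ω => ?_)
    rw [Real.norm_eq_abs, abs_of_nonneg (hf0 ω)]; exact hf1 ω
  have step : ∀ B, MeasurableSet[ℬ] B →
      |∫ ω in B, f ω ∂P - (∫ ω, f ω ∂P) * P.real B| ≤ α := by
    intro B hBm
    have : IsFiniteMeasure ((P B) • P) := Measure.smul_finite _ (by simp)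
    have := abs_integral_sub_integral_le_of_close hA (P.restrict B) ((P B) • P) (α := α)
      (fun A hAm => by
        rw [measureReal_restrict_apply (hA _ hAm), measureReal_ennreal_smul_apply]
        have := h A B hAm hBm
        rwa [mul_comm (P.real A)] at this) hf hf0 hf1
    rw [integral_smul_measure, smul_eq_mul] at this
    rwa [mul_comm (∫ ω, f ω ∂P)]
  set c := ∫ ω, f ω ∂P with hc
  have hc0 : 0 ≤ c := integral_nonneg hf0
  have hfin : IsFiniteMeasure (P.withDensity fun ω => ENNReal.ofReal (f ω)) :=
    isFiniteMeasure_withDensity_ofReal hfi.2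
  have e1 : ∫ ω, g ω ∂(P.withDensity fun ω => ENNReal.ofReal (f ω)) = ∫ ω, f ω * g ω ∂P := by
    rw [integral_withDensity_eq_integral_toReal_smul (by fun_prop) (by simp)]
    refine integral_congr_ae (ae_of_all _ fun ω => ?_)
    simp [ENNReal.toReal_ofReal (hf0 ω)]
  have e2 : ∫ ω, g ω ∂((ENNReal.ofReal c) • P) = c * ∫ ω, g ω ∂P := by
    rw [integral_smul_measure, smul_eq_mul, ENNReal.toReal_ofReal hc0]
  have hfin2 : IsFiniteMeasure ((ENNReal.ofReal c) • P) := Measure.smul_finite _ (by simp)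
  rw [← e1, ← e2]
  refine abs_integral_sub_integral_le_of_close hB _ _ (fun B hBm => ?_) hg hg0 hg1
  have e3 : (P.withDensity fun ω => ENNReal.ofReal (f ω)).real B = ∫ ω in B, f ω ∂P := by
    rw [measureReal_def, withDensity_apply _ (hB _ hBm),
      integral_eq_lintegral_of_nonneg_ae (ae_of_all _ hf0) hfm.aestronglyMeasurable]
  rw [e3, measureReal_ennreal_smul_apply, ENNReal.toReal_ofReal hc0]
  exact step B hBm

/-- The covariance inequality for bounded functions of `α`-mixing σ-algebras. -/
lemma AlphaMixing.cov_le (h : AlphaMixing P 𝒜 ℬ α) (hA : 𝒜 ≤ m0) (hB : ℬ ≤ m0) {f g : Ω → ℝ}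
    (hf : Measurable[𝒜] f) (hg : Measurable[ℬ] g) {T : ℝ} (hT : 0 < T)
    (hf1 : ∀ ω, |f ω| ≤ T) (hg1 : ∀ ω, |g ω| ≤ T) :
    |∫ ω, f ω * g ω ∂P - (∫ ω, f ω ∂P) * ∫ ω, g ω ∂P| ≤ 4 * T ^ 2 * α := by
  have hfm : Measurable[m0] f := hf.mono hA le_rfl
  have hgm : Measurable[m0] g := hg.mono hB le_rfl
  have hfi : Integrable f P := Integrable.of_bound hfm.aestronglyMeasurable T (ae_of_all _ hf1)
  have hgi : Integrable g P := Integrable.of_bound hgm.aestronglyMeasurable T (ae_of_all _ hg1)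
  have hfgi : Integrable (fun ω => f ω * g ω) P :=
    Integrable.of_bound (hfm.mul hgm).aestronglyMeasurable (T * T) (ae_of_all _ fun ω => by
      rw [Real.norm_eq_abs, abs_mul]
      exact mul_le_mul (hf1 ω) (hg1 ω) (abs_nonneg _) hT.le)
  -- The affine map y ↦ (y + T)/(2T) sends [-T, T] to [0,1] and divides covariances by 4T².
  have key := h.cov_unit_le hA hB (f := fun ω => (f ω + T) / (2 * T))
    (g := fun ω => (g ω + T) / (2 * T)) ((hf.add_const T).div_const _)
    ((hg.add_const T).div_const _)
    (fun ω => div_nonneg (by linarith [neg_le_of_abs_le (hf1 ω)]) (by linarith))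
    (fun ω => by
      rw [div_le_one (by linarith)]
      linarith [le_of_abs_le (hf1 ω)])
    (fun ω => div_nonneg (by linarith [neg_le_of_abs_le (hg1 ω)]) (by linarith))
    (fun ω => by
      rw [div_le_one (by linarith)]
      linarith [le_of_abs_le (hg1 ω)])
  have e : ∫ ω, (f ω + T) / (2 * T) * ((g ω + T) / (2 * T)) ∂P
      - (∫ ω, (f ω + T) / (2 * T) ∂P) * ∫ ω, (g ω + T) / (2 * T) ∂P
      = (∫ ω, f ω * g ω ∂P - (∫ ω, f ω ∂P) * ∫ ω, g ω ∂P) / (4 * T ^ 2) := by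
    have e1 : ∀ ω, (f ω + T) / (2 * T) * ((g ω + T) / (2 * T))
        = (f ω * g ω + (T * f ω + T * g ω) + T ^ 2) / (4 * T ^ 2) := fun ω => by
      field_simp; ring
    simp_rw [e1]
    rw [integral_div, integral_div, integral_div, integral_add (by fun_prop) (by fun_prop),
      integral_add hfgi (by fun_prop), integral_add (by fun_prop) (by fun_prop),
      integral_add hfi (by fun_prop), integral_add hgi (by fun_prop),
      integral_const_mul, integral_const_mul]
    simp only [integral_const, probReal_univ, smul_eq_mul, one_mul]
    field_simp; ring
  rw [e, abs_div, abs_of_pos (show 0 < 4 * T ^ 2 by positivity), div_le_iff₀ (by positivity)] at key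
  linarith

/-- The covariance inequality for complex functions bounded by one. -/
lemma AlphaMixing.cov_complex_le (h : AlphaMixing P 𝒜 ℬ α) (hA : 𝒜 ≤ m0) (hB : ℬ ≤ m0)
    {f g : Ω → ℂ} (hf : Measurable[𝒜] f) (hg : Measurable[ℬ] g)
    (hf1 : ∀ ω, ‖f ω‖ ≤ 1) (hg1 : ∀ ω, ‖g ω‖ ≤ 1) :
    ‖∫ ω, f ω * g ω ∂P - (∫ ω, f ω ∂P) * ∫ ω, g ω ∂P‖ ≤ 16 * α := by
  have hfm : Measurable[m0] f := hf.mono hA le_rfl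
  have hgm : Measurable[m0] g := hg.mono hB le_rfl
  have hfi : Integrable f P := Integrable.of_bound hfm.aestronglyMeasurable 1 (ae_of_all _ hf1)
  have hgi : Integrable g P := Integrable.of_bound hgm.aestronglyMeasurable 1 (ae_of_all _ hg1)
  have hfgi : Integrable (fun ω => f ω * g ω) P :=
    Integrable.of_bound (hfm.mul hgm).aestronglyMeasurable (1 * 1) (ae_of_all _ fun ω => by
      rw [norm_mul]
      exact mul_le_mul (hf1 ω) (hg1 ω) (norm_nonneg _) zero_le_one)
  have fre : Measurable[𝒜] fun ω => (f ω).re := Complex.measurable_re.comp hf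
  have fim : Measurable[𝒜] fun ω => (f ω).im := Complex.measurable_im.comp hf
  have gre : Measurable[ℬ] fun ω => (g ω).re := Complex.measurable_re.comp hg
  have gim : Measurable[ℬ] fun ω => (g ω).im := Complex.measurable_im.comp hg
  have bfre := fun ω => (Complex.abs_re_le_norm (f ω)).trans (hf1 ω)
  have bfim := fun ω => (Complex.abs_im_le_norm (f ω)).trans (hf1 ω)
  have bgre := fun ω => (Complex.abs_re_le_norm (g ω)).trans (hg1 ω)
  have bgim := fun ω => (Complex.abs_im_le_norm (g ω)).trans (hg1 ω)
  -- Four real covariances, each at most 4α, give the constant 16.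
  have h1 := h.cov_le hA hB fre gre one_pos bfre bgre
  have h2 := h.cov_le hA hB fim gim one_pos bfim bgim
  have h3 := h.cov_le hA hB fre gim one_pos bfre bgim
  have h4 := h.cov_le hA hB fim gre one_pos bfim bgre
  have rei : ∀ {u : Ω → ℂ}, Integrable u P → (∫ ω, u ω ∂P).re = ∫ ω, (u ω).re ∂P :=
    fun hu => (integral_re (𝕜 := ℂ) hu).symm
  have imi : ∀ {u : Ω → ℂ}, Integrable u P → (∫ ω, u ω ∂P).im = ∫ ω, (u ω).im ∂P :=
    fun hu => (integral_im (𝕜 := ℂ) hu).symm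
  have prodi : ∀ {a b : Ω → ℝ}, Measurable[m0] a → Measurable[m0] b → (∀ ω, |a ω| ≤ 1) →
      (∀ ω, |b ω| ≤ 1) → Integrable (fun ω => a ω * b ω) P := fun ha hb ha1 hb1 =>
    Integrable.of_bound (ha.mul hb).aestronglyMeasurable (1 * 1) (ae_of_all _ fun ω => by
      rw [Real.norm_eq_abs, abs_mul]
      exact mul_le_mul (ha1 ω) (hb1 ω) (abs_nonneg _) zero_le_one)
  have mfre := fre.mono hA le_rfl
  have mfim := fim.mono hA le_rfl
  have mgre := gre.mono hB le_rfl
  have mgim := gim.mono hB le_rfl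
  refine (Complex.norm_le_abs_re_add_abs_im _).trans ?_
  rw [Complex.sub_re, Complex.sub_im, Complex.mul_re, Complex.mul_im, rei hfgi, imi hfgi,
    rei hfi, rei hgi, imi hfi, imi hgi]
  simp only [Complex.mul_re, Complex.mul_im]
  rw [integral_sub (prodi mfre mgre bfre bgre) (prodi mfim mgim bfim bgim),
    integral_add (prodi mfre mgim bfre bgim) (prodi mfim mgre bfim bgre)]
  rw [abs_le] at h1 h2 h3 h4
  have r1 : ∀ {z b : ℝ}, -b ≤ z → z ≤ b → |z| ≤ b := fun h h' => abs_le.2 ⟨h, h'⟩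
  have := r1 (z := ((∫ ω, (f ω).re * (g ω).re ∂P) - ∫ ω, (f ω).im * (g ω).im ∂P) -
    ((∫ ω, (f ω).re ∂P) * (∫ ω, (g ω).re ∂P) - (∫ ω, (f ω).im ∂P) * ∫ ω, (g ω).im ∂P))
    (b := 8 * α) (by linarith) (by linarith)
  have := r1 (z := ((∫ ω, (f ω).re * (g ω).im ∂P) + ∫ ω, (f ω).im * (g ω).re ∂P) -
    ((∫ ω, (f ω).re ∂P) * (∫ ω, (g ω).im ∂P) + (∫ ω, (f ω).im ∂P) * ∫ ω, (g ω).re ∂P))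
    (b := 8 * α) (by linarith) (by linarith)
  linarith

end Mixing

/-! ### Stationary mixing sequences -/

section Sequence

variable {Ω : Type*} [MeasurableSpace Ω] {E : Type*} [MeasurableSpace E]

/-- A strictly stationary sequence with polynomially decaying mixing coefficients. -/
structure StationaryMixing (P : Measure Ω) (V : ℕ → Ω → E) (C κ : ℝ) : Prop where
  measurable : ∀ i, Measurable (V i)
  stationary : IsStationary P V
  nonneg : 0 ≤ C
  mixing : ∀ t l : ℕ, 1 ≤ l →
    AlphaMixing P (sigmaOf V (Set.Iic t)) (sigmaOf V (Set.Ici (t + l))) (C * (l : ℝ) ^ (-κ))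

lemma alphaMixing_strongMixingCoeff (P : Measure Ω) [IsProbabilityMeasure P] (V : ℕ → Ω → E)
    (t l : ℕ) :
    AlphaMixing P (sigmaOf V (Set.Iic t)) (sigmaOf V (Set.Ici (t + l)))
      (strongMixingCoeff P V l) := by
  intro A B hA hB
  -- The coefficient is a supremum of reals, so boundedness of the set has to be supplied; 1 is an
  -- upper bound.
  refine le_csSup ⟨1, ?_⟩ ⟨t, A, B, hA, hB, rfl⟩
  rintro r ⟨t, A, B, -, -, rfl⟩
  have h1 : P.real (A ∩ B) ≤ 1 := measureReal_le_one
  have h2 : P.real A * P.real B ≤ 1 :=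
    mul_le_one₀ measureReal_le_one measureReal_nonneg measureReal_le_one
  have h3 : 0 ≤ P.real (A ∩ B) := measureReal_nonneg
  have h4 : 0 ≤ P.real A * P.real B := mul_nonneg measureReal_nonneg measureReal_nonneg
  rw [abs_le]; constructor <;> linarith

variable {P : Measure Ω} {V : ℕ → Ω → E} {C κ : ℝ}

lemma sigmaOf_le (hV : ∀ i, Measurable (V i)) (S : Set ℕ) : sigmaOf V S ≤ ‹MeasurableSpace Ω› :=
  iSup₂_le fun i _ => (hV i).comap_le

lemma measurable_sigmaOf {S : Set ℕ} {i : ℕ} (hi : i ∈ S) : Measurable[sigmaOf V S] (V i) :=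
  Measurable.mono (comap_measurable (V i))
    (le_iSup₂_of_le (f := fun i (_ : i ∈ S) => MeasurableSpace.comap (V i) inferInstance) i hi le_rfl)
    le_rfl

lemma StationaryMixing.map_shift_seq (hV : StationaryMixing P V C κ) {F : Type*}
    [MeasurableSpace F] {φ : (ℕ → E) → F} (hφ : Measurable φ) (k : ℕ) :
    P.map (fun ω => φ fun i => V (i + k) ω) = P.map (fun ω => φ fun i => V i ω) := by
  have h1 : ∀ k, Measurable fun ω i => V (i + k) ω := fun k =>
    measurable_pi_lambda _ fun i => hV.measurable _
  have := congrArg (Measure.map φ) (hV.stationary k)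
  rw [Measure.map_map hφ (h1 k), Measure.map_map hφ (by simpa using h1 0)] at this
  exact this

lemma StationaryMixing.integral_shift_seq (hV : StationaryMixing P V C κ) {F : Type*}
    [NormedAddCommGroup F] [NormedSpace ℝ F] [MeasurableSpace F] [BorelSpace F]
    [SecondCountableTopology F] {φ : (ℕ → E) → F}
    (hφ : Measurable φ) (k : ℕ) :
    ∫ ω, φ (fun i => V (i + k) ω) ∂P = ∫ ω, φ (fun i => V i ω) ∂P := by
  have h1 : ∀ k, Measurable fun ω i => V (i + k) ω := fun k =>
    measurable_pi_lambda _ fun i => hV.measurable _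
  have e := hV.map_shift_seq hφ k
  have a1 := integral_map (μ := P) (f := fun y : F => y) (hφ.comp (h1 k)).aemeasurable
    aestronglyMeasurable_id
  have a2 := integral_map (μ := P) (f := fun y : F => y) (hφ.comp (h1 0)).aemeasurable
    aestronglyMeasurable_id
  simp only [Function.comp_def, add_zero] at a1 a2
  rw [← a1, ← a2, e]

lemma StationaryMixing.integral_comp (hV : StationaryMixing P V C κ) {φ : E → ℝ}
    (hφ : Measurable φ) (i : ℕ) : ∫ ω, φ (V i ω) ∂P = ∫ ω, φ (V 0 ω) ∂P := by
  have := hV.integral_shift_seq (φ := fun s => φ (s 0)) (by fun_prop) i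
  simpa using this

lemma StationaryMixing.map_eq (hV : StationaryMixing P V C κ) (i : ℕ) :
    P.map (V i) = P.map (V 0) := by
  have := hV.map_shift_seq (φ := fun s => s 0) (by fun_prop) i
  simpa using this

lemma StationaryMixing.measureReal_eq (hV : StationaryMixing P V C κ) {A : Set E}
    (hA : MeasurableSet A) (i : ℕ) : P.real {ω | V i ω ∈ A} = P.real {ω | V 0 ω ∈ A} := by
  have := congrArg (fun μ : Measure E => μ.real A) (hV.map_eq i)
  rwa [map_measureReal_apply (hV.measurable _) hA, map_measureReal_apply (hV.measurable _) hA]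
    at this

lemma StationaryMixing.integrable_comp (hV : StationaryMixing P V C κ) {φ : E → ℝ}
    (hφ : Measurable φ) (h : Integrable (fun ω => φ (V 0 ω)) P) (i : ℕ) :
    Integrable (fun ω => φ (V i ω)) P := by
  have h1 := (integrable_map_measure hφ.aestronglyMeasurable (hV.measurable 0).aemeasurable).2 h
  rw [← hV.map_eq i] at h1
  exact (integrable_map_measure hφ.aestronglyMeasurable (hV.measurable i).aemeasurable).1 h1

/-- The autocovariance of the sequence `f (V i)`. -/
def acov (P : Measure Ω) (V : ℕ → Ω → E) (f : E → ℝ) (l : ℕ) : ℝ :=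
  ∫ ω, f (V 0 ω) * f (V l ω) ∂P - (∫ ω, f (V 0 ω) ∂P) ^ 2

lemma StationaryMixing.integral_mul (hV : StationaryMixing P V C κ) {f : E → ℝ}
    (hf : Measurable f) (i l : ℕ) :
    ∫ ω, f (V i ω) * f (V (i + l) ω) ∂P = ∫ ω, f (V 0 ω) * f (V l ω) ∂P := by
  have := hV.integral_shift_seq (φ := fun s => f (s 0) * f (s l)) (by fun_prop) i
  simpa [add_comm] using this

lemma integrable_mul_of_sq {f g : Ω → ℝ} (hf : AEStronglyMeasurable f P)
    (hg : AEStronglyMeasurable g P) (hf2 : Integrable (fun ω => f ω ^ 2) P)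
    (hg2 : Integrable (fun ω => g ω ^ 2) P) : Integrable (fun ω => f ω * g ω) P :=
  MemLp.integrable_mul ((memLp_two_iff_integrable_sq hf).2 hf2)
    ((memLp_two_iff_integrable_sq hg).2 hg2)

lemma integrable_of_integrable_sq [IsFiniteMeasure P] {f : Ω → ℝ} (hf : AEStronglyMeasurable f P)
    (hf2 : Integrable (fun ω => f ω ^ 2) P) : Integrable f P :=
  ((memLp_two_iff_integrable_sq hf).2 hf2).integrable (by norm_num)

lemma StationaryMixing.integral_centered_mul [IsProbabilityMeasure P]
    (hV : StationaryMixing P V C κ) {f : E → ℝ}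
    (hf : Measurable f) (hf2 : Integrable (fun ω => f (V 0 ω) ^ 2) P) (i l : ℕ) :
    ∫ ω, (f (V i ω) - ∫ ω', f (V 0 ω') ∂P) * (f (V (i + l) ω) - ∫ ω', f (V 0 ω') ∂P) ∂P
      = acov P V f l := by
  have hsq := hV.integrable_comp (φ := fun v => f v ^ 2) (by fun_prop) hf2
  have hm := fun j => (hf.comp (hV.measurable j)).aestronglyMeasurable (μ := P)
  have hi : ∀ j, Integrable (fun ω => f (V j ω)) P :=
    fun j => integrable_of_integrable_sq (hm j) (hsq j)
  have hij := integrable_mul_of_sq (hm i) (hm (i + l)) (hsq i) (hsq (i + l))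
  simp only [Function.comp_def] at hij
  set c := ∫ ω', f (V 0 ω') ∂P with hc
  have e : ∀ ω, (f (V i ω) - c) * (f (V (i + l) ω) - c)
      = f (V i ω) * f (V (i + l) ω) - (c * f (V i ω) + c * f (V (i + l) ω)) + c ^ 2 :=
    fun ω => by ring
  have i1 : Integrable (fun ω => c * f (V i ω) + c * f (V (i + l) ω)) P :=
    ((hi _).const_mul c).add ((hi _).const_mul c)
  simp_rw [e]
  rw [integral_add (by exact hij.sub i1) (by fun_prop), integral_sub hij i1,
    integral_add ((hi _).const_mul c) ((hi _).const_mul c), integral_const_mul, integral_const_mul,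
    hV.integral_comp hf i, hV.integral_comp hf (i + l), hV.integral_mul hf, ← hc, acov, ← hc]
  simp; ring

/-- The variance of a sum over any finite set of indices. -/
lemma StationaryMixing.integral_sq_sum_centered [IsProbabilityMeasure P]
    (hV : StationaryMixing P V C κ) {f : E → ℝ}
    (hf : Measurable f) (hf2 : Integrable (fun ω => f (V 0 ω) ^ 2) P)
    (hs : Summable fun l => |acov P V f (l + 1)|) (S : Finset ℕ) :
    Integrable (fun ω => (∑ i ∈ S, (f (V i ω) - ∫ ω', f (V 0 ω') ∂P)) ^ 2) P ∧
    |∫ ω, (∑ i ∈ S, (f (V i ω) - ∫ ω', f (V 0 ω') ∂P)) ^ 2 ∂P - S.card * acov P V f 0|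
      ≤ 2 * S.card * ∑' l, |acov P V f (l + 1)| := by
  set c := ∫ ω', f (V 0 ω') ∂P with hc
  have hsq := hV.integrable_comp (φ := fun v => f v ^ 2) (by fun_prop) hf2
  have hm := fun j => (hf.comp (hV.measurable j)).aestronglyMeasurable (μ := P)
  have hi : ∀ j, Integrable (fun ω => f (V j ω)) P :=
    fun j => integrable_of_integrable_sq (hm j) (hsq j)
  have hij : ∀ i j, Integrable (fun ω => (f (V i ω) - c) * (f (V j ω) - c)) P := by
    intro i j
    have h2 : ∀ j, Integrable (fun ω => (f (V j ω) - c) ^ 2) P := fun j => by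
      have e : (fun ω => (f (V j ω) - c) ^ 2)
        = fun ω => f (V j ω) ^ 2 - 2 * c * f (V j ω) + c ^ 2 := by ext ω; ring
      rw [e]
      exact ((hsq j).sub ((hi j).const_mul _)).add (integrable_const _)
    exact integrable_mul_of_sq ((hm i).sub aestronglyMeasurable_const)
      ((hm j).sub aestronglyMeasurable_const) (h2 i) (h2 j)
  have hexp : (fun ω => (∑ i ∈ S, (f (V i ω) - c)) ^ 2)
      = fun ω => ∑ i ∈ S, ∑ j ∈ S, (f (V i ω) - c) * (f (V j ω) - c) := by
    ext ω; rw [sq, Finset.sum_mul_sum]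
  -- With truncated subtraction `(i - j) + (j - i)` is the distance of i and j.
  have hval : ∀ i j, ∫ ω, (f (V i ω) - c) * (f (V j ω) - c) ∂P
      = acov P V f ((i - j) + (j - i)) := by
    intro i j
    rcases le_total i j with h | h
    · obtain ⟨l, rfl⟩ := Nat.exists_eq_add_of_le h
      rw [hV.integral_centered_mul hf hf2]; congr 1; omega
    · obtain ⟨l, rfl⟩ := Nat.exists_eq_add_of_le h
      simp_rw [mul_comm (f (V (j + l) _) - c)]
      rw [hV.integral_centered_mul hf hf2]; congr 1; omega
  refine ⟨?_, ?_⟩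
  · rw [hexp]
    exact integrable_finsetSum _ fun i _ => integrable_finsetSum _ fun j _ => hij i j
  rw [hexp, integral_finsetSum _ fun i _ => integrable_finsetSum _ fun j _ => hij i j]
  simp_rw [integral_finsetSum S fun j _ => hij _ j, hval]
  -- Row by row: the indices of S below i lie at distinct distances from i, and so do those above i.
  -- Each side is therefore bounded by the full sum over lags, whatever the set S.
  have hone : ∀ i ∈ S, |∑ j ∈ S, acov P V f ((i - j) + (j - i)) - acov P V f 0|
      ≤ 2 * ∑' l, |acov P V f (l + 1)| := by
    intro i hiS
    have e1 : ∑ j ∈ S, acov P V f ((i - j) + (j - i)) - acov P V f 0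
        = ∑ j ∈ S.erase i, acov P V f ((i - j) + (j - i)) := by
      rw [← Finset.add_sum_erase S _ hiS]; simp
    have part : ∀ (T : Finset ℕ) (d : ℕ → ℕ), (∀ j ∈ T, 1 ≤ d j) → Set.InjOn d T →
        ∑ j ∈ T, |acov P V f (d j)| ≤ ∑' l, |acov P V f (l + 1)| := by
      intro T d h1 hinj
      have : ∑ j ∈ T, |acov P V f (d j)|
          = ∑ l ∈ T.image (fun j => d j - 1), |acov P V f (l + 1)| := by
        rw [Finset.sum_image]
        · refine Finset.sum_congr rfl fun j hj => ?_
          rw [Nat.sub_add_cancel (h1 j hj)]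
        · intro a ha b hb hab
          have := h1 a ha; have := h1 b hb
          exact hinj ha hb (by simp only at hab; omega)
      rw [this]
      exact hs.sum_le_tsum _ fun _ _ => abs_nonneg _
    rw [e1]
    refine (Finset.abs_sum_le_sum_abs _ _).trans ?_
    rw [← Finset.sum_filter_add_sum_filter_not (S.erase i) (fun j => j < i)]
    have a1 := part ((S.erase i).filter fun j => j < i) (fun j => (i - j) + (j - i))
      (fun j hj => by simp only [Finset.mem_filter] at hj; omega)
      (fun a ha b hb hab => by
        simp only [Finset.coe_filter, Set.mem_ofPred_eq] at ha hb hab; omega)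
    have a2 := part ((S.erase i).filter fun j => ¬ j < i) (fun j => (i - j) + (j - i))
      (fun j hj => by simp only [Finset.mem_filter, Finset.mem_erase] at hj; omega)
      (fun a ha b hb hab => by
        simp only [Finset.coe_filter, Set.mem_ofPred_eq] at ha hb hab; omega)
    linarith
  have e2 : ∑ i ∈ S, ∑ j ∈ S, acov P V f ((i - j) + (j - i)) - S.card * acov P V f 0
      = ∑ i ∈ S, (∑ j ∈ S, acov P V f ((i - j) + (j - i)) - acov P V f 0) := by
    rw [Finset.sum_sub_distrib]; simp
  rw [e2]
  refine (Finset.abs_sum_le_sum_abs _ _).trans ((Finset.sum_le_sum hone).trans ?_)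
  rw [Finset.sum_const, nsmul_eq_mul]; linarith

end Sequence

/-! ### Truncation -/

/-- Truncation of a function at level `T`. -/
def trunc {E : Type*} (T : ℝ) (f : E → ℝ) (v : E) : ℝ := if |f v| ≤ T then f v else 0

section Truncation

variable {E : Type*} {T ζ : ℝ}

lemma abs_trunc_le (hT : 0 ≤ T) (f : E → ℝ) (v : E) : |trunc T f v| ≤ T := by
  unfold trunc; split_ifs with h
  · exact h
  · simpa using hT

lemma abs_trunc_le_abs (T : ℝ) (f : E → ℝ) (v : E) : |trunc T f v| ≤ |f v| := by
  unfold trunc; split_ifs with h <;> simp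

lemma abs_sub_trunc_le_abs (T : ℝ) (f : E → ℝ) (v : E) : |f v - trunc T f v| ≤ |f v| := by
  unfold trunc; split_ifs with h <;> simp

lemma measurable_trunc [MeasurableSpace E] (T : ℝ) {f : E → ℝ} (hf : Measurable f) :
    Measurable (trunc T f) :=
  Measurable.ite (measurableSet_le hf.abs measurable_const) hf measurable_const

lemma sq_le_rpow_of_lt (hT : 0 < T) (hζ : 0 < ζ) {c : ℝ} (hc : T < c) :
    c ^ 2 ≤ T ^ (-ζ) * c ^ (2 + ζ) := by
  have hc0 : 0 < c := hT.trans hc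
  rw [Real.rpow_add hc0, Real.rpow_neg hT.le, Real.rpow_two]
  have h1 : T ^ ζ ≤ c ^ ζ := Real.rpow_le_rpow hT.le hc.le hζ.le
  have h2 : 0 < T ^ ζ := Real.rpow_pos_of_pos hT _
  rw [inv_mul_eq_div, le_div_iff₀ h2]
  exact mul_le_mul_of_nonneg_left h1 (by positivity)

/-- The product changes only if the larger of the two values exceeds T, and then it is at most the
square of that value, which T^(-ζ) times its power 2+ζ dominates. -/
lemma abs_mul_sub_trunc_mul_le (hT : 0 < T) (hζ : 0 < ζ) (f : E → ℝ) (v w : E) :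
    |f v * f w - trunc T f v * trunc T f w|
      ≤ T ^ (-ζ) * (|f v| ^ (2 + ζ) + |f w| ^ (2 + ζ)) := by
  have hTp : 0 < T ^ (-ζ) := Real.rpow_pos_of_pos hT _
  have n1 : 0 ≤ |f v| ^ (2 + ζ) := Real.rpow_nonneg (abs_nonneg _) _
  have n2 : 0 ≤ |f w| ^ (2 + ζ) := Real.rpow_nonneg (abs_nonneg _) _
  have main : T < max |f v| |f w| →
      |f v * f w| ≤ T ^ (-ζ) * (|f v| ^ (2 + ζ) + |f w| ^ (2 + ζ)) := by
    intro h
    have h1 := sq_le_rpow_of_lt hT hζ h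
    have h2 : |f v * f w| ≤ max |f v| |f w| ^ 2 := by
      rw [abs_mul, sq]
      exact mul_le_mul (le_max_left _ _) (le_max_right _ _) (abs_nonneg _)
        ((abs_nonneg _).trans (le_max_left _ _))
    have h3 : max |f v| |f w| ^ (2 + ζ) ≤ |f v| ^ (2 + ζ) + |f w| ^ (2 + ζ) := by
      rcases max_choice |f v| |f w| with h | h <;> rw [h] <;> linarith
    exact h2.trans (h1.trans (mul_le_mul_of_nonneg_left h3 hTp.le))
  unfold trunc
  by_cases hv : |f v| ≤ T
  · by_cases hw : |f w| ≤ T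
    · simp only [hv, hw, if_true, sub_self, abs_zero]; positivity
    · simp only [hw, if_false, mul_zero, sub_zero]
      exact main (lt_max_of_lt_right (not_le.1 hw))
  · simp only [hv, if_false, zero_mul, sub_zero]
    exact main (lt_max_of_lt_left (not_le.1 hv))

lemma sq_sub_trunc_le (hT : 0 < T) (hζ : 0 < ζ) (f : E → ℝ) (v : E) :
    (f v - trunc T f v) ^ 2 ≤ T ^ (-ζ) * |f v| ^ (2 + ζ) := by
  unfold trunc
  split_ifs with h
  · have : 0 ≤ |f v| ^ (2 + ζ) := Real.rpow_nonneg (abs_nonneg _) _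
    have hTp : 0 < T ^ (-ζ) := Real.rpow_pos_of_pos hT _
    simp only [sub_self, ne_eq, OfNat.ofNat_ne_zero, not_false_eq_true, zero_pow]; positivity
  · rw [sub_zero, ← sq_abs]
    exact sq_le_rpow_of_lt hT hζ (not_le.1 h)

lemma abs_sub_trunc_le (hT : 1 ≤ T) (hζ : 0 < ζ) (f : E → ℝ) (v : E) :
    |f v - trunc T f v| ≤ T ^ (-ζ) * |f v| ^ (2 + ζ) := by
  refine le_trans ?_ (sq_sub_trunc_le (by linarith) hζ f v)
  unfold trunc
  split_ifs with h
  · simp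
  · rw [sub_zero, ← sq_abs]
    nlinarith [not_le.1 h]

lemma sq_le_one_add_rpow (hζ : 0 < ζ) (a : ℝ) : a ^ 2 ≤ 1 + |a| ^ (2 + ζ) := by
  have h0 : 0 ≤ |a| ^ (2 + ζ) := Real.rpow_nonneg (abs_nonneg _) _
  rw [← sq_abs]
  rcases le_or_gt |a| 1 with h | h
  · nlinarith [abs_nonneg a]
  · have := sq_le_rpow_of_lt one_pos hζ h
    simp at this; rw [← sq_abs] at this; linarith

lemma abs_le_one_add_rpow (hζ : 0 < ζ) (a : ℝ) : |a| ≤ 1 + |a| ^ (2 + ζ) := by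
  have h0 : 0 ≤ |a| ^ (2 + ζ) := Real.rpow_nonneg (abs_nonneg _) _
  rcases le_or_gt |a| 1 with h | h
  · linarith
  · have := sq_le_rpow_of_lt one_pos hζ h
    simp at this; rw [← sq_abs] at this; nlinarith

end Truncation

/-! ### Localized functions of a stationary mixing sequence -/

section Localized

variable {Ω : Type*} [MeasurableSpace Ω] {E : Type*} [MeasurableSpace E]

/-- `f` vanishes off `A`, a set that is visited by the sequence at two different times with
probability `O(p ^ 2)`, where `p` is the probability of `A`, and `f` has a moment of order `2 + ζ`
of size `O(p)`. -/
structure Localized (P : Measure Ω) (V : ℕ → Ω → E) (ζ M B : ℝ) (A : Set E) (f : E → ℝ) :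
    Prop where
  measurableSet : MeasurableSet A
  measurable : Measurable f
  zeta_pos : 0 < ζ
  M_nonneg : 0 ≤ M
  B_nonneg : 0 ≤ B
  eq_zero : ∀ v, v ∉ A → f v = 0
  joint : ∀ s t : ℕ, s ≠ t → P.real {ω | V s ω ∈ A ∧ V t ω ∈ A} ≤ M * P.real {ω | V 0 ω ∈ A} ^ 2
  integrable_rpow : Integrable (fun ω => |f (V 0 ω)| ^ (2 + ζ)) P
  integral_rpow_le : ∫ ω, |f (V 0 ω)| ^ (2 + ζ) ∂P ≤ B * P.real {ω | V 0 ω ∈ A}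

variable {P : Measure Ω} [IsProbabilityMeasure P] {V : ℕ → Ω → E} {C κ ζ M B : ℝ} {A : Set E}
  {f : E → ℝ}

/-- Domination preserves the constants M and B, so truncations and truncation remainders obey the
same uniform bounds as the original function. -/
lemma Localized.mono (hV : ∀ i, Measurable (V i)) (hf : Localized P V ζ M B A f) {g : E → ℝ}
    (hg : Measurable g) (hgf : ∀ v, |g v| ≤ |f v|) : Localized P V ζ M B A g := by
  have hle : ∀ ω, |g (V 0 ω)| ^ (2 + ζ) ≤ |f (V 0 ω)| ^ (2 + ζ) := fun ω =>
    Real.rpow_le_rpow (abs_nonneg _) (hgf _) (by linarith [hf.zeta_pos])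
  have hi : Integrable (fun ω => |g (V 0 ω)| ^ (2 + ζ)) P := by
    refine hf.integrable_rpow.mono' ?_ (ae_of_all _ fun ω => ?_)
    · exact (((hg.comp (hV 0)).abs).pow_const _).aestronglyMeasurable
    · rw [Real.norm_eq_abs, abs_of_nonneg (Real.rpow_nonneg (abs_nonneg _) _)]
      exact hle ω
  refine ⟨hf.measurableSet, hg, hf.zeta_pos, hf.M_nonneg, hf.B_nonneg, fun v hv => ?_, hf.joint,
    hi, (integral_mono hi hf.integrable_rpow hle).trans hf.integral_rpow_le⟩
  have := hgf v
  rw [hf.eq_zero v hv, abs_zero] at this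
  exact abs_eq_zero.1 (le_antisymm this (abs_nonneg _))

lemma Localized.trunc (hV : ∀ i, Measurable (V i)) (hf : Localized P V ζ M B A f) (T : ℝ) :
    Localized P V ζ M B A (trunc T f) :=
  hf.mono hV (measurable_trunc T hf.measurable) (abs_trunc_le_abs T f)

lemma Localized.sub_trunc (hV : ∀ i, Measurable (V i)) (hf : Localized P V ζ M B A f) (T : ℝ) :
    Localized P V ζ M B A (fun v => f v - NW.trunc T f v) :=
  hf.mono hV (hf.measurable.sub (measurable_trunc T hf.measurable)) (abs_sub_trunc_le_abs T f)

lemma integrable_indicator_comp (hV : ∀ i, Measurable (V i)) (hA : MeasurableSet A) (i : ℕ) :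
    Integrable (fun ω => A.indicator (fun _ => (1 : ℝ)) (V i ω)) P ∧
      ∫ ω, A.indicator (fun _ => (1 : ℝ)) (V i ω) ∂P = P.real {ω | V i ω ∈ A} := by
  have e : (fun ω => A.indicator (fun _ => (1 : ℝ)) (V i ω))
      = (V i ⁻¹' A).indicator (fun _ => (1 : ℝ)) := by
    ext ω; rfl
  rw [e]
  refine ⟨(integrable_const _).indicator (hV i hA), ?_⟩
  rw [integral_indicator (hV i hA)]
  simp only [integral_const, MeasurableSet.univ, measureReal_restrict_apply, Set.univ_inter,
    smul_eq_mul, mul_one]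
  rfl

lemma Localized.integral_sq_le (hV : ∀ i, Measurable (V i)) (hf : Localized P V ζ M B A f) :
    Integrable (fun ω => f (V 0 ω) ^ 2) P ∧
      ∫ ω, f (V 0 ω) ^ 2 ∂P ≤ (1 + B) * P.real {ω | V 0 ω ∈ A} := by
  have hI := integrable_indicator_comp (P := P) hV hf.measurableSet 0
  have hle : ∀ ω, f (V 0 ω) ^ 2 ≤ A.indicator (fun _ => (1 : ℝ)) (V 0 ω) +
      |f (V 0 ω)| ^ (2 + ζ) := by
    intro ω
    by_cases h : V 0 ω ∈ A
    · rw [Set.indicator_of_mem h]; exact sq_le_one_add_rpow hf.zeta_pos _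
    · rw [hf.eq_zero _ h, Set.indicator_of_notMem h]
      have : (0 : ℝ) ≤ |0| ^ (2 + ζ) := Real.rpow_nonneg (abs_nonneg _) _
      simpa using this
  have hi : Integrable (fun ω => f (V 0 ω) ^ 2) P := by
    refine (hI.1.add hf.integrable_rpow).mono' ?_ (ae_of_all _ fun ω => ?_)
    · exact ((hf.measurable.comp (hV 0)).pow_const 2).aestronglyMeasurable
    · rw [Real.norm_eq_abs, abs_of_nonneg (sq_nonneg _)]; exact hle ω
  refine ⟨hi, (integral_mono hi (hI.1.add hf.integrable_rpow) hle).trans ?_⟩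
  simp only [Pi.add_apply]
  rw [integral_add hI.1 hf.integrable_rpow, hI.2]
  linarith [hf.integral_rpow_le]

lemma Localized.integral_abs_le (hV : ∀ i, Measurable (V i)) (hf : Localized P V ζ M B A f) :
    Integrable (fun ω => f (V 0 ω)) P ∧
      ∫ ω, |f (V 0 ω)| ∂P ≤ (1 + B) * P.real {ω | V 0 ω ∈ A} := by
  have hI := integrable_indicator_comp (P := P) hV hf.measurableSet 0
  have hle : ∀ ω, |f (V 0 ω)| ≤ A.indicator (fun _ => (1 : ℝ)) (V 0 ω) +
      |f (V 0 ω)| ^ (2 + ζ) := by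
    intro ω
    by_cases h : V 0 ω ∈ A
    · rw [Set.indicator_of_mem h]; exact abs_le_one_add_rpow hf.zeta_pos _
    · rw [hf.eq_zero _ h, Set.indicator_of_notMem h]
      have : (0 : ℝ) ≤ |0| ^ (2 + ζ) := Real.rpow_nonneg (abs_nonneg _) _
      simpa using this
  have hi : Integrable (fun ω => f (V 0 ω)) P :=
    integrable_of_integrable_sq (hf.measurable.comp (hV 0)).aestronglyMeasurable
      (hf.integral_sq_le hV).1
  refine ⟨hi, (integral_mono hi.abs (hI.1.add hf.integrable_rpow) hle).trans ?_⟩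
  simp only [Pi.add_apply]
  rw [integral_add hI.1 hf.integrable_rpow, hI.2]
  linarith [hf.integral_rpow_le]

lemma Localized.abs_integral_le (hV : ∀ i, Measurable (V i)) (hf : Localized P V ζ M B A f) :
    |∫ ω, f (V 0 ω) ∂P| ≤ (1 + B) * P.real {ω | V 0 ω ∈ A} :=
  (abs_integral_le_integral_abs).trans (hf.integral_abs_le hV).2

lemma Localized.integrable_mul (hV : StationaryMixing P V C κ) (hf : Localized P V ζ M B A f)
    (i j : ℕ) : Integrable (fun ω => f (V i ω) * f (V j ω)) P := by
  have hsq := hV.integrable_comp (φ := fun v => f v ^ 2) (hf.measurable.pow_const 2)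
    (hf.integral_sq_le hV.measurable).1
  exact integrable_mul_of_sq (hf.measurable.comp (hV.measurable i)).aestronglyMeasurable
    (hf.measurable.comp (hV.measurable j)).aestronglyMeasurable (hsq i) (hsq j)

lemma Localized.abs_integral_mul_sub_trunc_le (hV : StationaryMixing P V C κ)
    (hf : Localized P V ζ M B A f) {T : ℝ} (hT : 0 < T) (l : ℕ) :
    |∫ ω, f (V 0 ω) * f (V l ω) ∂P - ∫ ω, NW.trunc T f (V 0 ω) * NW.trunc T f (V l ω) ∂P|
      ≤ 2 * B * T ^ (-ζ) * P.real {ω | V 0 ω ∈ A} := by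
  have hr := hV.integrable_comp (φ := fun v => |f v| ^ (2 + ζ)) (hf.measurable.abs.pow_const _)
    hf.integrable_rpow
  have er := hV.integral_comp (φ := fun v => |f v| ^ (2 + ζ)) (hf.measurable.abs.pow_const _)
  have h1 := hf.integrable_mul hV 0 l
  have h2 := (hf.trunc hV.measurable T).integrable_mul hV 0 l
  rw [← integral_sub h1 h2]
  refine (abs_integral_le_integral_abs).trans ?_
  refine (integral_mono (h1.sub h2).abs (((hr 0).add (hr l)).const_mul (T ^ (-ζ)))
    fun ω => abs_mul_sub_trunc_mul_le hT hf.zeta_pos f _ _).trans ?_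
  simp only [Pi.add_apply]
  rw [integral_const_mul, integral_add (hr 0) (hr l), er l]
  have := mul_le_mul_of_nonneg_left hf.integral_rpow_le (Real.rpow_nonneg hT.le (-ζ))
  linarith

lemma Localized.abs_integral_sub_trunc_le (hV : ∀ i, Measurable (V i))
    (hf : Localized P V ζ M B A f) {T : ℝ} (hT : 1 ≤ T) :
    |∫ ω, f (V 0 ω) ∂P - ∫ ω, NW.trunc T f (V 0 ω) ∂P|
      ≤ B * T ^ (-ζ) * P.real {ω | V 0 ω ∈ A} := by
  have h1 := (hf.integral_abs_le hV).1
  have h2 := ((hf.trunc hV T).integral_abs_le hV).1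
  rw [← integral_sub h1 h2]
  refine (abs_integral_le_integral_abs).trans ?_
  refine (integral_mono (h1.sub h2).abs (hf.integrable_rpow.const_mul (T ^ (-ζ)))
    fun ω => abs_sub_trunc_le hT hf.zeta_pos f _).trans ?_
  rw [integral_const_mul]
  have := mul_le_mul_of_nonneg_left hf.integral_rpow_le
    (Real.rpow_nonneg (show (0:ℝ) ≤ T by linarith) (-ζ))
  linarith

lemma Localized.integral_sq_sub_trunc_le (hV : ∀ i, Measurable (V i))
    (hf : Localized P V ζ M B A f) {T : ℝ} (hT : 0 < T) :
    ∫ ω, (f (V 0 ω) - NW.trunc T f (V 0 ω)) ^ 2 ∂P ≤ B * T ^ (-ζ) * P.real {ω | V 0 ω ∈ A} := by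
  have h1 := ((hf.sub_trunc hV T).integral_sq_le hV).1
  refine (integral_mono h1 (hf.integrable_rpow.const_mul (T ^ (-ζ)))
    fun ω => sq_sub_trunc_le hT hf.zeta_pos f _).trans ?_
  rw [integral_const_mul]
  have := mul_le_mul_of_nonneg_left hf.integral_rpow_le (Real.rpow_nonneg hT.le (-ζ))
  linarith

lemma Localized.abs_acov_sub_trunc_le (hV : StationaryMixing P V C κ)
    (hf : Localized P V ζ M B A f) {T : ℝ} (hT : 1 ≤ T) (l : ℕ) :
    |acov P V f l - acov P V (NW.trunc T f) l|
      ≤ (2 * B + 2 * B * (1 + B)) * T ^ (-ζ) * P.real {ω | V 0 ω ∈ A} := by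
  have h1 := hf.abs_integral_mul_sub_trunc_le hV (T := T) (by linarith) l
  have h2 := hf.abs_integral_sub_trunc_le hV.measurable hT
  have h3 := hf.abs_integral_le hV.measurable
  have h4 := (hf.trunc hV.measurable T).abs_integral_le hV.measurable
  have hp0 : 0 ≤ P.real {ω | V 0 ω ∈ A} := measureReal_nonneg
  have hp1 : P.real {ω | V 0 ω ∈ A} ≤ 1 := measureReal_le_one
  have hB := hf.B_nonneg
  have hTz : 0 ≤ T ^ (-ζ) := Real.rpow_nonneg (by linarith) _
  unfold acov
  set p := P.real {ω | V 0 ω ∈ A}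
  set a := ∫ ω, f (V 0 ω) ∂P
  set b := ∫ ω, NW.trunc T f (V 0 ω) ∂P
  set τ := T ^ (-ζ)
  -- The squared means differ by (a - b)(a + b); one factor carries p and the other only needs p ≤
  -- 1.
  have e : ∀ x y : ℝ, x - a ^ 2 - (y - b ^ 2) = (x - y) - (a - b) * (a + b) := fun x y => by ring
  rw [e]
  refine (abs_sub _ _).trans ?_
  rw [abs_mul]
  have h5 : |a - b| * |a + b| ≤ (B * τ * p) * (2 * (1 + B)) := by
    refine mul_le_mul h2 ((abs_add_le _ _).trans ?_) (abs_nonneg _) (by positivity)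
    have : (1 + B) * p ≤ 1 + B := mul_le_of_le_one_right (by linarith) hp1
    linarith
  nlinarith

/-- The geometric mean of two bounds: mixing gives 4T²C l^(-κ), and the joint visit probability
gives T²(M+1)p². Halving the exponent of l is the price of a factor p. -/
lemma Localized.abs_acov_le_of_bounded (hV : StationaryMixing P V C κ)
    (hf : Localized P V ζ M B A f) {T : ℝ} (hT : 0 < T) (hfT : ∀ v, |f v| ≤ T) {l : ℕ}
    (hl : 1 ≤ l) :
    |acov P V f l| ≤ 2 * √(C * (M + 1)) * T ^ 2 * (l : ℝ) ^ (-(κ / 2)) *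
      P.real {ω | V 0 ω ∈ A} := by
  set p := P.real {ω | V 0 ω ∈ A} with hp
  have hp0 : 0 ≤ p := measureReal_nonneg
  have hl0 : (0 : ℝ) < l := by exact_mod_cast hl
  have hmean := hV.integral_comp hf.measurable l
  have hmix := (hV.mixing 0 l hl).cov_le (sigmaOf_le hV.measurable _)
    (sigmaOf_le hV.measurable _) (f := fun ω => f (V 0 ω)) (g := fun ω => f (V l ω))
    (hf.measurable.comp (measurable_sigmaOf (by simp)))
    (hf.measurable.comp (measurable_sigmaOf (by simp))) hT (fun _ => hfT _) (fun _ => hfT _)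
  rw [hmean, ← sq] at hmix
  have hbdd : |acov P V f l| ≤ T ^ 2 * ((M + 1) * p ^ 2) := by
    have hA2 : MeasurableSet {ω | V 0 ω ∈ A ∧ V l ω ∈ A} :=
      (hV.measurable 0 hf.measurableSet).inter (hV.measurable l hf.measurableSet)
    have i1 : |∫ ω, f (V 0 ω) * f (V l ω) ∂P| ≤ T ^ 2 * (M * p ^ 2) := by
      refine (abs_integral_le_integral_abs).trans ?_
      have i2 : Integrable ({ω | V 0 ω ∈ A ∧ V l ω ∈ A}.indicator fun _ => T ^ 2) P :=
        (integrable_const _).indicator hA2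
      refine (integral_mono (hf.integrable_mul hV 0 l).abs i2 fun ω => ?_).trans ?_
      · by_cases h : ω ∈ {ω | V 0 ω ∈ A ∧ V l ω ∈ A}
        · rw [Set.indicator_of_mem h]
          simp only [abs_mul, sq]
          exact mul_le_mul (hfT _) (hfT _) (abs_nonneg _) hT.le
        · rw [Set.indicator_of_notMem h]
          simp only [Set.mem_ofPred_eq, not_and_or] at h
          rcases h with h | h <;> simp [hf.eq_zero _ h]
      · rw [integral_indicator hA2]
        simp only [integral_const, MeasurableSet.univ, measureReal_restrict_apply,
          Set.univ_inter, smul_eq_mul]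
        rw [mul_comm]
        exact mul_le_mul_of_nonneg_left (hf.joint 0 l (by omega)) (sq_nonneg _)
    have i3 : |∫ ω, f (V 0 ω) ∂P| ≤ T * p := by
      refine (abs_integral_le_integral_abs).trans ?_
      have hI := integrable_indicator_comp (P := P) hV.measurable hf.measurableSet 0
      refine (integral_mono (hf.integral_abs_le hV.measurable).1.abs (hI.1.const_mul T)
        fun ω => ?_).trans ?_
      · by_cases h : V 0 ω ∈ A
        · simpa [Set.indicator_of_mem h] using hfT _
        · simp [hf.eq_zero _ h, Set.indicator_of_notMem h]
      · rw [integral_const_mul, hI.2]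
    have i4 : (∫ ω, f (V 0 ω) ∂P) ^ 2 ≤ T ^ 2 * p ^ 2 := by
      rw [← sq_abs, ← mul_pow]
      exact pow_le_pow_left₀ (abs_nonneg _) i3 2
    unfold acov
    refine (abs_sub _ _).trans ?_
    rw [abs_of_nonneg (sq_nonneg (∫ ω, f (V 0 ω) ∂P))]
    linarith
  have hsq : |acov P V f l| ^ 2 ≤ (2 * √(C * (M + 1)) * T ^ 2 * (l : ℝ) ^ (-(κ / 2)) * p) ^ 2 := by
    have e1 : ((l : ℝ) ^ (-(κ / 2))) ^ 2 = (l : ℝ) ^ (-κ) := by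
      rw [← Real.rpow_natCast, ← Real.rpow_mul hl0.le]; congr 1; push_cast; ring
    have e2 : √(C * (M + 1)) ^ 2 = C * (M + 1) :=
      Real.sq_sqrt (mul_nonneg hV.nonneg (by linarith [hf.M_nonneg]))
    have e3 : (2 * √(C * (M + 1)) * T ^ 2 * (l : ℝ) ^ (-(κ / 2)) * p) ^ 2
        = (4 * T ^ 2 * (C * (l : ℝ) ^ (-κ))) * (T ^ 2 * ((M + 1) * p ^ 2)) := by
      rw [← e1]
      calc _ = 4 * (√(C * (M + 1)) ^ 2) * T ^ 4 * ((l : ℝ) ^ (-(κ / 2))) ^ 2 * p ^ 2 := by ring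
        _ = _ := by rw [e2]; ring
    rw [e3, sq]
    exact mul_le_mul hmix hbdd (abs_nonneg _) ((abs_nonneg _).trans hmix)
  exact (sq_le_sq₀ (abs_nonneg _) (by positivity)).1 hsq

/-- The key covariance estimate: the autocovariances of localized functions are summable,
uniformly relative to the probability of the set. -/
theorem exists_abs_acov_le (P : Measure Ω) [IsProbabilityMeasure P] (V : ℕ → Ω → E)
    {C κ ζ : ℝ} (M B : ℝ) (hζ : 0 < ζ) (hκ : 2 + 4 / ζ < κ) (hV : StationaryMixing P V C κ) :
    ∃ D c : ℝ, 0 ≤ D ∧ 1 < c ∧ ∀ (A : Set E) (f : E → ℝ), Localized P V ζ M B A f →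
      ∀ l : ℕ, 1 ≤ l → |acov P V f l| ≤ D * P.real {ω | V 0 ω ∈ A} * (l : ℝ) ^ (-c) := by
  -- Truncation at l^s leaves l^(-sζ) from the remainder and l^(2s - κ/2) from the bounded part.
  -- Both exponents lie below -1 when 1/ζ < s < (κ-2)/4, an interval that is non-empty exactly when
  -- κ > 2 + 4/ζ.
  obtain ⟨s, hs1, hs2⟩ : ∃ s, 1 / ζ < s ∧ s < (κ - 2) / 4 := exists_between (by
    have : 4 / ζ = 4 * (1 / ζ) := by ring
    linarith)
  have hs0 : 0 < s := (by positivity : 0 < 1 / ζ).trans hs1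
  have h1 : 1 < s * ζ := by rwa [div_lt_iff₀ hζ] at hs1
  set c := min (s * ζ) (κ / 2 - 2 * s) with hc
  refine ⟨|2 * B + 2 * B * (1 + B)| + 2 * √(C * (M + 1)), c, by positivity,
    lt_min h1 (by linarith), ?_⟩
  intro A f hf l hl
  have hp0 : 0 ≤ P.real {ω | V 0 ω ∈ A} := measureReal_nonneg
  have hl1 : (1 : ℝ) ≤ l := by exact_mod_cast hl
  have hl0 : (0 : ℝ) < l := by linarith
  have hT : (1 : ℝ) ≤ (l : ℝ) ^ s := Real.one_le_rpow hl1 hs0.le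
  have a1 := hf.abs_acov_sub_trunc_le hV hT l
  have a2 := (hf.trunc hV.measurable ((l : ℝ) ^ s)).abs_acov_le_of_bounded hV
    (T := (l : ℝ) ^ s) (by linarith) (abs_trunc_le (by linarith) f) hl
  have e1 : ((l : ℝ) ^ s) ^ (-ζ) ≤ (l : ℝ) ^ (-c) := by
    rw [← Real.rpow_mul hl0.le]
    exact Real.rpow_le_rpow_of_exponent_le hl1 (by
      have := min_le_left (s * ζ) (κ / 2 - 2 * s); rw [hc]; linarith)
  have e2 : ((l : ℝ) ^ s) ^ 2 * (l : ℝ) ^ (-(κ / 2)) ≤ (l : ℝ) ^ (-c) := by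
    rw [← Real.rpow_natCast ((l : ℝ) ^ s), ← Real.rpow_mul hl0.le, ← Real.rpow_add hl0]
    exact Real.rpow_le_rpow_of_exponent_le hl1 (by
      have := min_le_right (s * ζ) (κ / 2 - 2 * s); rw [hc]; push_cast; linarith)
  have a3 : |acov P V f l| ≤ |acov P V f l - acov P V (NW.trunc ((l : ℝ) ^ s) f) l| +
      |acov P V (NW.trunc ((l : ℝ) ^ s) f) l| := by
    have := abs_add_le (acov P V f l - acov P V (NW.trunc ((l : ℝ) ^ s) f) l)
      (acov P V (NW.trunc ((l : ℝ) ^ s) f) l)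
    simpa using this
  set p := P.real {ω | V 0 ω ∈ A}
  have b1 : (2 * B + 2 * B * (1 + B)) * ((l : ℝ) ^ s) ^ (-ζ) * p
      ≤ |2 * B + 2 * B * (1 + B)| * (l : ℝ) ^ (-c) * p := by
    gcongr
    exact le_abs_self _
  have b2 : 2 * √(C * (M + 1)) * ((l : ℝ) ^ s) ^ 2 * (l : ℝ) ^ (-(κ / 2)) * p
      ≤ 2 * √(C * (M + 1)) * (l : ℝ) ^ (-c) * p := by
    rw [mul_assoc (2 * √(C * (M + 1)))]
    gcongr
  nlinarith

lemma acov_zero_nonneg (hV : StationaryMixing P V C κ)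
    (hf : Localized P V ζ M B A f) :
    0 ≤ acov P V f 0 := by
  rw [← hV.integral_centered_mul hf.measurable (hf.integral_sq_le hV.measurable).1 0 0]
  exact integral_nonneg fun ω => mul_self_nonneg _

lemma acov_zero_le (P : Measure Ω) (V : ℕ → Ω → E) (f : E → ℝ) :
    acov P V f 0 ≤ ∫ ω, f (V 0 ω) ^ 2 ∂P := by
  unfold acov
  simp_rw [← sq]
  linarith [sq_nonneg (∫ ω, f (V 0 ω) ∂P)]

/-- There is no decay in the lag here; this serves for truncation remainders, whose second moment is
already small compared with p. -/
lemma Localized.abs_acov_le_two_mul (hV : StationaryMixing P V C κ)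
    (hf : Localized P V ζ M B A f) (l : ℕ) :
    |acov P V f l| ≤ 2 * ∫ ω, f (V 0 ω) ^ 2 ∂P := by
  have hsq := hV.integrable_comp (φ := fun v => f v ^ 2) (hf.measurable.pow_const 2)
    (hf.integral_sq_le hV.measurable).1
  have esq := hV.integral_comp (φ := fun v => f v ^ 2) (hf.measurable.pow_const 2)
  have h0 := acov_zero_nonneg hV hf
  have h1 : |∫ ω, f (V 0 ω) * f (V l ω) ∂P| ≤ ∫ ω, f (V 0 ω) ^ 2 ∂P := by
    refine (abs_integral_le_integral_abs).trans ?_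
    refine (integral_mono (hf.integrable_mul hV 0 l).abs
      (((hsq 0).add (hsq l)).const_mul (1 / 2)) fun ω => ?_).trans ?_
    · simp only [Pi.add_apply, abs_mul]
      nlinarith [sq_nonneg (|f (V 0 ω)| - |f (V l ω)|), sq_abs (f (V 0 ω)), sq_abs (f (V l ω))]
    · simp only [Pi.add_apply]
      rw [integral_const_mul, integral_add (hsq 0) (hsq l), esq l]; linarith
  have h2 : (∫ ω, f (V 0 ω) ∂P) ^ 2 ≤ ∫ ω, f (V 0 ω) ^ 2 ∂P := by
    unfold acov at h0; simp_rw [← sq] at h0; linarith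
  unfold acov
  refine (abs_sub _ _).trans ?_
  rw [abs_of_nonneg (sq_nonneg (∫ ω, f (V 0 ω) ∂P))]
  linarith

lemma summable_rpow_neg_succ {c : ℝ} (hc : 1 < c) :
    Summable fun l : ℕ => ((l + 1 : ℕ) : ℝ) ^ (-c) :=
  (summable_nat_add_iff 1).2 (Real.summable_nat_rpow.2 (by linarith))

/-- A uniform variance bound for sums of localized functions. -/
theorem exists_integral_sq_sum_le (P : Measure Ω) [IsProbabilityMeasure P] (V : ℕ → Ω → E)
    {C κ ζ : ℝ} (M B : ℝ) (hB : 0 ≤ B) (hζ : 0 < ζ) (hκ : 2 + 4 / ζ < κ)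
    (hV : StationaryMixing P V C κ) :
    ∃ D : ℝ, 0 < D ∧ ∀ (A : Set E) (f : E → ℝ), Localized P V ζ M B A f → ∀ S : Finset ℕ,
      Integrable (fun ω => (∑ i ∈ S, (f (V i ω) - ∫ ω', f (V 0 ω') ∂P)) ^ 2) P ∧
      ∫ ω, (∑ i ∈ S, (f (V i ω) - ∫ ω', f (V 0 ω') ∂P)) ^ 2 ∂P
        ≤ D * S.card * P.real {ω | V 0 ω ∈ A} := by
  obtain ⟨D, c, hD, hc, hbd⟩ := exists_abs_acov_le P V M B hζ hκ hV
  have hsum := summable_rpow_neg_succ hc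
  refine ⟨1 + B + 2 * (D * ∑' l : ℕ, ((l + 1 : ℕ) : ℝ) ^ (-c)), ?_, fun A f hf S => ?_⟩
  · have : 0 ≤ ∑' l : ℕ, ((l + 1 : ℕ) : ℝ) ^ (-c) :=
      tsum_nonneg fun l => Real.rpow_nonneg (Nat.cast_nonneg _) _
    positivity
  have hb : ∀ l : ℕ, |acov P V f (l + 1)| ≤
      D * P.real {ω | V 0 ω ∈ A} * ((l + 1 : ℕ) : ℝ) ^ (-c) :=
    fun l => hbd A f hf (l + 1) (by omega)
  have hs : Summable fun l => |acov P V f (l + 1)| :=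
    Summable.of_nonneg_of_le (fun _ => abs_nonneg _) hb (hsum.mul_left _)
  obtain ⟨h1, h2⟩ := hV.integral_sq_sum_centered hf.measurable
    (hf.integral_sq_le hV.measurable).1 hs S
  refine ⟨h1, ?_⟩
  have h3 : ∑' l, |acov P V f (l + 1)| ≤
      D * P.real {ω | V 0 ω ∈ A} * ∑' l : ℕ, ((l + 1 : ℕ) : ℝ) ^ (-c) := by
    rw [← tsum_mul_left]
    exact hs.tsum_le_tsum hb (hsum.mul_left _)
  have h4 : acov P V f 0 ≤ (1 + B) * P.real {ω | V 0 ω ∈ A} :=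
    (acov_zero_le P V f).trans (hf.integral_sq_le hV.measurable).2
  have h5 := (abs_le.1 h2).2
  have hS : (0 : ℝ) ≤ S.card := Nat.cast_nonneg _
  have h6 := mul_le_mul_of_nonneg_left h3 hS
  have h7 := mul_le_mul_of_nonneg_left h4 hS
  nlinarith

end Localized

/-! ### Block sizes -/

lemma tendsto_natCast_rpow_neg {e : ℝ} (he : e < 0) :
    Tendsto (fun n : ℕ => (n : ℝ) ^ e) atTop (𝓝 0) := by
  have := (tendsto_rpow_neg_atTop (y := -e) (by linarith)).comp tendsto_natCast_atTop_atTop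
  simpa [Function.comp_def] using this

/-- Sizes of the big blocks, of the gaps, and the number of blocks in Bernstein's method. -/
lemma exists_block_sizes {κ : ℝ} (hκ : 2 < κ) :
    ∃ a b k : ℕ → ℕ, (∀ n, k n * (a n + b n) ≤ n) ∧ (∀ n, 1 ≤ b n) ∧
      Tendsto (fun n => (a n : ℝ) ^ 3 / n) atTop (𝓝 0) ∧
      Tendsto (fun n => (k n : ℝ) * (b n : ℝ) ^ (-κ)) atTop (𝓝 0) ∧
      Tendsto (fun n => (k n : ℝ) * a n / n) atTop (𝓝 1) ∧
      Tendsto (fun n => (k n : ℝ)) atTop atTop := by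
  -- Blocks of length about n^θ with gaps of about n^θ'. The cube condition needs θ < 1/3,
  -- negligible gaps need θ' < θ, and the mixing error is of order n^(1 - θ - κθ'). The value of c
  -- makes this last exponent equal to -(κ-2)/6, and c < 1/12 keeps θ' positive.
  set c : ℝ := (κ - 2) / (6 * (1 + 2 * κ)) with hc
  have hc0 : 0 < c := div_pos (by linarith) (by linarith)
  have hc1 : c < 1 / 12 := by rw [hc, div_lt_div_iff₀ (by linarith) (by norm_num)]; linarith
  have hc2 : c * (1 + 2 * κ) = (κ - 2) / 6 := by rw [hc]; field_simp
  set θ : ℝ := 1 / 3 - c with hθ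
  set θ' : ℝ := 1 / 3 - 2 * c with hθ'
  set a : ℕ → ℕ := fun n => ⌊(n : ℝ) ^ θ⌋₊ with ha
  set b : ℕ → ℕ := fun n => ⌊(n : ℝ) ^ θ'⌋₊ + 1 with hb
  set k : ℕ → ℕ := fun n => n / (a n + b n) with hk
  have hpos : ∀ (n : ℕ) (e : ℝ), 0 ≤ (n : ℝ) ^ e := fun n e => Real.rpow_nonneg (Nat.cast_nonneg _) _
  have a_le : ∀ n, (a n : ℝ) ≤ (n : ℝ) ^ θ := fun n => Nat.floor_le (hpos n θ)
  have a_gt : ∀ n : ℕ, (n : ℝ) ^ θ < a n + 1 := fun n => Nat.lt_floor_add_one _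
  have b_ge : ∀ n : ℕ, (n : ℝ) ^ θ' ≤ b n := fun n => by
    rw [hb]; push_cast; exact (Nat.lt_floor_add_one _).le
  have b_le : ∀ n, (b n : ℝ) ≤ (n : ℝ) ^ θ' + 1 := fun n => by
    rw [hb]; push_cast; linarith [Nat.floor_le (hpos n θ')]
  have k_le : ∀ n, k n * (a n + b n) ≤ n := fun n => Nat.div_mul_le_self _ _
  have k_le' : ∀ n, (k n : ℝ) * (a n + b n) ≤ n := fun n => by exact_mod_cast k_le n
  have k_gt : ∀ n : ℕ, (n : ℝ) ≤ (k n + 1) * (a n + b n) := fun n => by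
    have : n < (k n + 1) * (a n + b n) := by
      rw [mul_comm]; exact Nat.lt_mul_div_succ n (by simp [hb])
    exact_mod_cast this.le
  have hone : ∀ᶠ n : ℕ in atTop, (1 : ℝ) ≤ n := by
    filter_upwards [eventually_ge_atTop 1] with n hn; exact_mod_cast hn
  have hbig : ∀ᶠ n : ℕ in atTop, (2 : ℝ) ≤ (n : ℝ) ^ θ := by
    have : Tendsto (fun n : ℕ => (n : ℝ) ^ θ) atTop atTop :=
      (tendsto_rpow_atTop (by rw [hθ]; linarith)).comp tendsto_natCast_atTop_atTop
    exact this.eventually_ge_atTop 2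
  have b_le2 : ∀ᶠ n : ℕ in atTop, (b n : ℝ) ≤ 2 * (n : ℝ) ^ θ' := by
    filter_upwards [hone] with n hn
    have := Real.one_le_rpow hn (show 0 ≤ θ' by rw [hθ']; linarith)
    linarith [b_le n]
  have a_ge2 : ∀ᶠ n : ℕ in atTop, (n : ℝ) ^ θ / 2 ≤ a n := by
    filter_upwards [hbig] with n hn; linarith [a_gt n]
  refine ⟨a, b, k, k_le, fun n => by simp [hb], ?_, ?_, ?_, ?_⟩
  · refine squeeze_zero' (Eventually.of_forall fun n => by positivity) ?_
      (tendsto_natCast_rpow_neg (e := 3 * θ - 1) (by rw [hθ]; linarith))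
    filter_upwards [hone] with n hn
    have hn0 : (0 : ℝ) < n := by linarith
    rw [Real.rpow_sub hn0, Real.rpow_one, mul_comm 3 θ, Real.rpow_mul hn0.le]
    gcongr
    have : ((n : ℝ) ^ θ) ^ (3 : ℝ) = ((n : ℝ) ^ θ) ^ 3 := by norm_cast
    rw [this]
    exact pow_le_pow_left₀ (Nat.cast_nonneg _) (a_le n) 3
  · have h0 : Tendsto (fun n : ℕ => 2 * (n : ℝ) ^ (1 - θ - κ * θ')) atTop (𝓝 (2 * 0)) :=
      (tendsto_natCast_rpow_neg (by rw [hθ, hθ']; nlinarith)).const_mul 2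
    rw [mul_zero] at h0
    refine squeeze_zero' (Eventually.of_forall fun n => by positivity) ?_ h0
    filter_upwards [hone, a_ge2] with n hn ha2
    have hn0 : (0 : ℝ) < n := by linarith
    have h1 : (k n : ℝ) ≤ 2 * (n : ℝ) ^ (1 - θ) := by
      have h2 : (k n : ℝ) * ((n : ℝ) ^ θ / 2) ≤ n := by
        refine le_trans ?_ (k_le' n)
        gcongr
        linarith [(Nat.cast_nonneg (b n) : (0 : ℝ) ≤ b n)]
      rw [Real.rpow_sub hn0, Real.rpow_one, mul_div_assoc', le_div_iff₀ (Real.rpow_pos_of_pos hn0 _)]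
      linarith
    have h3 : (b n : ℝ) ^ (-κ) ≤ (n : ℝ) ^ (-(κ * θ')) := by
      have := Real.rpow_le_rpow_of_nonpos (Real.rpow_pos_of_pos hn0 θ') (b_ge n)
        (show -κ ≤ 0 by linarith)
      refine this.trans (le_of_eq ?_)
      rw [← Real.rpow_mul hn0.le]; congr 1; ring
    calc (k n : ℝ) * (b n : ℝ) ^ (-κ) ≤ (2 * (n : ℝ) ^ (1 - θ)) * (n : ℝ) ^ (-(κ * θ')) := by
          gcongr
      _ = 2 * (n : ℝ) ^ (1 - θ - κ * θ') := by
          rw [mul_assoc, ← Real.rpow_add hn0]; congr 2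
  · have h0 : Tendsto (fun n : ℕ => 1 - (3 * (n : ℝ) ^ (θ - 1) + 4 * (n : ℝ) ^ (θ' - θ))) atTop
        (𝓝 (1 - (3 * 0 + 4 * 0))) :=
      tendsto_const_nhds.sub (((tendsto_natCast_rpow_neg (by rw [hθ]; linarith)).const_mul 3).add
        ((tendsto_natCast_rpow_neg (by rw [hθ, hθ']; linarith)).const_mul 4))
    simp only [mul_zero, add_zero, sub_zero] at h0
    refine tendsto_of_tendsto_of_tendsto_of_le_of_le' h0 tendsto_const_nhds ?_ ?_
    · filter_upwards [hone, a_ge2, b_le2] with n hn ha2 hb2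
      have hn0 : (0 : ℝ) < n := by linarith
      have hle : (n : ℝ) ^ θ' ≤ (n : ℝ) ^ θ :=
        Real.rpow_le_rpow_of_exponent_le hn (by rw [hθ, hθ']; linarith)
      have hp : 0 < (n : ℝ) ^ θ := Real.rpow_pos_of_pos hn0 _
      have hp' : 0 < (n : ℝ) ^ θ' := Real.rpow_pos_of_pos hn0 _
      have e1 : (n : ℝ) ^ (θ - 1) = (n : ℝ) ^ θ / n := by rw [Real.rpow_sub hn0, Real.rpow_one]
      have e2 : (n : ℝ) ^ (θ' - θ) = (n : ℝ) ^ θ' / (n : ℝ) ^ θ := by rw [Real.rpow_sub hn0]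
      have h1 : (a n + b n : ℝ) ≤ 3 * (n : ℝ) ^ θ := by linarith [a_le n]
      have h2 : (k n : ℝ) * b n ≤ 4 * ((n : ℝ) ^ θ' / (n : ℝ) ^ θ) * n := by
        have h3 : (k n : ℝ) * ((n : ℝ) ^ θ / 2) ≤ n := by
          refine le_trans ?_ (k_le' n)
          gcongr
          linarith [(Nat.cast_nonneg (b n) : (0 : ℝ) ≤ b n)]
        have h4 : (k n : ℝ) ≤ 2 * n / (n : ℝ) ^ θ := by
          rw [le_div_iff₀ hp]; linarith
        calc (k n : ℝ) * b n ≤ (2 * n / (n : ℝ) ^ θ) * (2 * (n : ℝ) ^ θ') := by gcongr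
          _ = _ := by ring
      rw [le_div_iff₀ hn0, e1, e2]
      have h5 := k_gt n
      have : (1 - (3 * ((n : ℝ) ^ θ / n) + 4 * ((n : ℝ) ^ θ' / (n : ℝ) ^ θ))) * n
          = n - 3 * (n : ℝ) ^ θ - 4 * ((n : ℝ) ^ θ' / (n : ℝ) ^ θ) * n := by
        field_simp; ring
      rw [this]
      nlinarith
    · filter_upwards [hone] with n hn
      rw [div_le_one (by linarith)]
      have := k_le' n
      nlinarith [(Nat.cast_nonneg (k n) : (0 : ℝ) ≤ k n), (Nat.cast_nonneg (b n) : (0 : ℝ) ≤ b n)]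
  · have h0 : Tendsto (fun n : ℕ => (n : ℝ) ^ (1 - θ) / 3 + (-1)) atTop atTop :=
      tendsto_atTop_add_const_right _ _ (((tendsto_rpow_atTop (by rw [hθ]; linarith)).comp
        tendsto_natCast_atTop_atTop).atTop_div_const (by norm_num))
    refine tendsto_atTop_mono' _ ?_ h0
    filter_upwards [hone, b_le2] with n hn hb2
    have hn0 : (0 : ℝ) < n := by linarith
    have hle : (n : ℝ) ^ θ' ≤ (n : ℝ) ^ θ :=
      Real.rpow_le_rpow_of_exponent_le hn (by rw [hθ, hθ']; linarith)
    have hp : 0 < (n : ℝ) ^ θ := Real.rpow_pos_of_pos hn0 _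
    have h1 : (a n + b n : ℝ) ≤ 3 * (n : ℝ) ^ θ := by linarith [a_le n]
    have h2 : (n : ℝ) ≤ (k n + 1) * (3 * (n : ℝ) ^ θ) := (k_gt n).trans (by gcongr)
    have h3 : (n : ℝ) ^ (1 - θ) / 3 ≤ k n + 1 := by
      rw [Real.rpow_sub hn0, Real.rpow_one, div_div, div_le_iff₀ (by positivity)]
      linarith
    linarith

/-! ### Characteristic functions of sums of weakly dependent blocks -/

lemma norm_pow_sub_pow_le_of_le_one {z w : ℂ} (hz : ‖z‖ ≤ 1) (hw : ‖w‖ ≤ 1) (k : ℕ) :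
    ‖z ^ k - w ^ k‖ ≤ k * ‖z - w‖ := by
  induction k with
  | zero => simp
  | succ k ih =>
    have e : z ^ (k + 1) - w ^ (k + 1) = z ^ k * (z - w) + (z ^ k - w ^ k) * w := by ring
    rw [e]
    refine (norm_add_le _ _).trans ?_
    rw [norm_mul, norm_mul, norm_pow]
    have h1 : ‖z‖ ^ k ≤ 1 := pow_le_one₀ (norm_nonneg _) hz
    have h2 : ‖z ^ k - w ^ k‖ * ‖w‖ ≤ k * ‖z - w‖ :=
      (mul_le_of_le_one_right (norm_nonneg _) hw).trans ih
    have h3 : ‖z‖ ^ k * ‖z - w‖ ≤ ‖z - w‖ := mul_le_of_le_one_left (norm_nonneg _) h1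
    push_cast; linarith

/-- Taylor's remainder for |x| ≤ 1; beyond that every term on the left is dominated by |x|³. Being
global, the bound can be integrated directly against the third moment. -/
lemma norm_exp_mul_I_sub_le (x : ℝ) :
    ‖Complex.exp (x * Complex.I) - (1 + x * Complex.I - (x : ℂ) ^ 2 / 2)‖ ≤ 4 * |x| ^ 3 := by
  rcases le_or_gt |x| 1 with h | h
  · have hx : ‖(x : ℂ) * Complex.I‖ ≤ 1 := by simpa using h
    have := Complex.exp_bound hx (n := 3) (by norm_num)
    have e : ∑ m ∈ Finset.range 3, ((x : ℂ) * Complex.I) ^ m / (m.factorial : ℂ)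
        = 1 + x * Complex.I - (x : ℂ) ^ 2 / 2 := by
      simp only [Finset.sum_range_succ, Finset.sum_range_zero, Nat.factorial]
      rw [mul_pow _ _ 2, Complex.I_sq]; push_cast; ring
    rw [e] at this
    refine this.trans ?_
    rw [norm_mul, Complex.norm_real, Complex.norm_I, mul_one, Real.norm_eq_abs]
    have : 0 ≤ |x| ^ 3 := by positivity
    norm_num [Nat.factorial]
    linarith
  · have h1 : ‖Complex.exp (x * Complex.I)‖ = 1 := Complex.norm_exp_ofReal_mul_I x
    have h2 : ‖(1 + x * Complex.I - (x : ℂ) ^ 2 / 2)‖ ≤ 1 + |x| + |x| ^ 2 / 2 := by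
      refine (norm_sub_le _ _).trans (add_le_add ((norm_add_le _ _).trans ?_) ?_)
      · simp
      · simp
    refine (norm_sub_le _ _).trans ?_
    rw [h1]
    have h3 : |x| ≤ |x| ^ 3 := by nlinarith [sq_nonneg (|x|), mul_pos (show 0 < |x| by linarith) (show 0 < |x| by linarith)]
    have h4 : |x| ^ 2 ≤ |x| ^ 3 := by nlinarith [sq_nonneg (|x|)]
    linarith

section CharFun

variable {Ω : Type*} [MeasurableSpace Ω] {P : Measure Ω} [IsProbabilityMeasure P]

lemma integrable_cexp {U : Ω → ℝ} (hU : Measurable U) :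
    Integrable (fun ω => Complex.exp (U ω * Complex.I)) P :=
  Integrable.of_bound (by fun_prop) 1 (ae_of_all _ fun ω => by
    rw [Complex.norm_exp_ofReal_mul_I])

lemma norm_integral_cexp_sub_le {U : Ω → ℝ} (hU : Measurable U) (h1 : ∫ ω, U ω ∂P = 0)
    (hi2 : Integrable (fun ω => U ω ^ 2) P) (hi3 : Integrable (fun ω => |U ω| ^ 3) P) :
    ‖∫ ω, Complex.exp (U ω * Complex.I) ∂P - (1 - ((∫ ω, U ω ^ 2 ∂P : ℝ) : ℂ) / 2)‖
      ≤ 4 * ∫ ω, |U ω| ^ 3 ∂P := by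
  have hi1 : Integrable U P := integrable_of_integrable_sq hU.aestronglyMeasurable hi2
  have c1 : Integrable (fun ω => (U ω : ℂ) * Complex.I) P := hi1.ofReal.mul_const _
  have c2 : Integrable (fun ω => (U ω : ℂ) ^ 2 / 2) P := by
    have := (hi2.ofReal (𝕜 := ℂ)).div_const 2
    simpa using this
  have e : (1 : ℂ) - ((∫ ω, U ω ^ 2 ∂P : ℝ) : ℂ) / 2
      = ∫ ω, (1 + (U ω : ℂ) * Complex.I - (U ω : ℂ) ^ 2 / 2) ∂P := by
    have s1 : Integrable (fun ω => (1 : ℂ) + (U ω : ℂ) * Complex.I) P :=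
      (integrable_const _).add c1
    rw [integral_sub s1 c2, integral_add (integrable_const _) c1, integral_mul_const,
      integral_complex_ofReal, h1, integral_div]
    have : ∫ ω, (U ω : ℂ) ^ 2 ∂P = ((∫ ω, U ω ^ 2 ∂P : ℝ) : ℂ) := by
      rw [← integral_complex_ofReal]; simp
    rw [this]; simp
  rw [e, ← integral_sub (integrable_cexp hU) (by exact ((integrable_const _).add c1).sub c2)]
  refine (norm_integral_le_integral_norm _).trans ?_
  rw [← integral_const_mul]
  exact integral_mono_of_nonneg (ae_of_all _ fun ω => norm_nonneg _) (hi3.const_mul 4)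
    (ae_of_all _ fun ω => norm_exp_mul_I_sub_le (U ω))

/-- Lyapunov's condition implies the Gaussian limit for powers of characteristic functions. -/
lemma tendsto_pow_integral_cexp {U : ℕ → Ω → ℝ} {k : ℕ → ℕ} (hU : ∀ n, Measurable (U n))
    (hk : Tendsto (fun n => (k n : ℝ)) atTop atTop)
    (h1 : ∀ᶠ n in atTop, ∫ ω, U n ω ∂P = 0)
    (hi2 : ∀ᶠ n in atTop, Integrable (fun ω => U n ω ^ 2) P)
    (hi3 : ∀ᶠ n in atTop, Integrable (fun ω => |U n ω| ^ 3) P)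
    (h2 : Tendsto (fun n => (k n : ℝ) * ∫ ω, U n ω ^ 2 ∂P) atTop (𝓝 1))
    (h3 : Tendsto (fun n => (k n : ℝ) * ∫ ω, |U n ω| ^ 3 ∂P) atTop (𝓝 0)) (t : ℝ) :
    Tendsto (fun n => (∫ ω, Complex.exp ((t * U n ω : ℝ) * Complex.I) ∂P) ^ k n) atTop
      (𝓝 (Complex.exp (-(t ^ 2 / 2)))) := by
  set y : ℕ → ℝ := fun n => t ^ 2 * (∫ ω, U n ω ^ 2 ∂P) / 2 with hy
  have hy0 : ∀ n, 0 ≤ y n := fun n => by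
    have : 0 ≤ ∫ ω, U n ω ^ 2 ∂P := integral_nonneg fun ω => sq_nonneg _
    positivity
  have hky : Tendsto (fun n => (k n : ℝ) * y n) atTop (𝓝 (t ^ 2 / 2)) := by
    have := h2.const_mul (t ^ 2 / 2)
    rw [mul_one] at this
    refine this.congr fun n => ?_
    rw [hy]; ring
  have hkinv : Tendsto (fun n => ((k n : ℝ))⁻¹) atTop (𝓝 0) := tendsto_inv_atTop_zero.comp hk
  have hkpos : ∀ᶠ n in atTop, (0 : ℝ) < k n := hk.eventually_gt_atTop 0
  have hylim : Tendsto y atTop (𝓝 0) := by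
    have := hky.mul hkinv
    rw [mul_zero] at this
    refine this.congr' ?_
    filter_upwards [hkpos] with n hn
    field_simp
  have hlim : Tendsto (fun n => (((Real.exp (-(y n))) : ℂ)) ^ k n) atTop
      (𝓝 (Complex.exp (-(t ^ 2 / 2)))) := by
    have h : Tendsto (fun n => Complex.exp (((-((k n : ℝ) * y n) : ℝ)) : ℂ)) atTop
        (𝓝 (Complex.exp ((-(t ^ 2 / 2) : ℝ) : ℂ))) :=
      (Complex.continuous_exp.tendsto _).comp
        ((Complex.continuous_ofReal.tendsto _).comp hky.neg)
    have e : Complex.exp ((-(t ^ 2 / 2) : ℝ) : ℂ) = Complex.exp (-(t ^ 2 / 2)) := by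
      push_cast; rfl
    rw [e] at h
    refine h.congr fun n => ?_
    rw [Complex.ofReal_exp, ← Complex.exp_nat_mul]
    congr 1; push_cast; ring
  -- Both bases lie in the unit disc, so their powers differ by at most k times the difference of
  -- the bases. That difference is a Taylor error of order E|U|³ plus y² from replacing 1 - y by
  -- exp(-y), and both vanish after multiplication by k.
  have hdiff : Tendsto (fun n => (∫ ω, Complex.exp ((t * U n ω : ℝ) * Complex.I) ∂P) ^ k n
      - (((Real.exp (-(y n))) : ℂ)) ^ k n) atTop (𝓝 0) := by
    have hb : Tendsto (fun n => 4 * |t| ^ 3 * ((k n : ℝ) * ∫ ω, |U n ω| ^ 3 ∂P)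
        + ((k n : ℝ) * y n) * y n) atTop (𝓝 (4 * |t| ^ 3 * 0 + t ^ 2 / 2 * 0)) :=
      (h3.const_mul _).add (hky.mul hylim)
    rw [mul_zero, mul_zero, add_zero] at hb
    refine squeeze_zero_norm' ?_ hb
    filter_upwards [h1, hi2, hi3, hylim.eventually_le_const one_pos] with n h1 hi2 hi3 hy1
    have n1 : ‖∫ ω, Complex.exp ((t * U n ω : ℝ) * Complex.I) ∂P‖ ≤ 1 := by
      refine (norm_integral_le_integral_norm _).trans ?_
      simp_rw [Complex.norm_exp_ofReal_mul_I]
      simp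
    have n2 : ‖((Real.exp (-(y n))) : ℂ)‖ ≤ 1 := by
      rw [Complex.norm_real, Real.norm_eq_abs, Real.abs_exp, Real.exp_le_one_iff]
      linarith [hy0 n]
    refine (norm_pow_sub_pow_le_of_le_one n1 n2 _).trans ?_
    have e3 : ∀ ω, |t * U n ω| ^ 3 = |t| ^ 3 * |U n ω| ^ 3 := fun ω => by rw [abs_mul, mul_pow]
    have a1 := norm_integral_cexp_sub_le (P := P) (U := fun ω => t * U n ω) ((hU n).const_mul t)
      (by rw [integral_const_mul, h1, mul_zero])
      (by simp_rw [mul_pow]; exact hi2.const_mul _)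
      (by simp_rw [e3]; exact hi3.const_mul _)
    have e2 : (∫ ω, (t * U n ω) ^ 2 ∂P) / 2 = y n := by
      simp_rw [mul_pow]; rw [integral_const_mul]
    simp_rw [e3] at a1
    rw [integral_const_mul] at a1
    have a2 : ‖(1 - ((∫ ω, (t * U n ω) ^ 2 ∂P : ℝ) : ℂ) / 2) - ((Real.exp (-(y n))) : ℂ)‖
        ≤ y n ^ 2 := by
      have : (1 - ((∫ ω, (t * U n ω) ^ 2 ∂P : ℝ) : ℂ) / 2) - ((Real.exp (-(y n))) : ℂ)
          = ((-(Real.exp (-(y n)) - 1 - (-(y n))) : ℝ) : ℂ) := by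
        rw [← e2]; push_cast; ring
      rw [this, Complex.norm_real, norm_neg, Real.norm_eq_abs]
      have := Real.abs_exp_sub_one_sub_id_le (x := -(y n)) (by
        rw [abs_neg, abs_of_nonneg (hy0 n)]; exact hy1)
      rwa [neg_sq] at this
    have a3 := norm_sub_le_norm_sub_add_norm_sub
      (∫ ω, Complex.exp ((t * U n ω : ℝ) * Complex.I) ∂P)
      (1 - ((∫ ω, (t * U n ω) ^ 2 ∂P : ℝ) : ℂ) / 2) ((Real.exp (-(y n))) : ℂ)
    have a4 := a3.trans (add_le_add a1 a2)
    have hk0 : (0 : ℝ) ≤ k n := Nat.cast_nonneg _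
    calc _ ≤ (k n : ℝ) * (4 * (|t| ^ 3 * ∫ ω, |U n ω| ^ 3 ∂P) + y n ^ 2) :=
          mul_le_mul_of_nonneg_left a4 hk0
      _ = _ := by ring
  have := hdiff.add hlim
  rw [zero_add] at this
  refine this.congr fun n => ?_
  ring

variable {E : Type*} [MeasurableSpace E] {V : ℕ → Ω → E} {C κ : ℝ}

lemma measurable_block {m : MeasurableSpace Ω} {g : E → ℝ} (hg : Measurable g) {s a : ℕ}
    (h : ∀ i < a, Measurable[m] (V (s + i))) :
    Measurable[m] fun ω => ∑ i ∈ Finset.range a, g (V (s + i) ω) :=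
  Finset.measurable_sum _ fun i hi => hg.comp (h i (Finset.mem_range.1 hi))

/-- Factorisation of the characteristic function of a sum of separated blocks. -/
lemma StationaryMixing.norm_integral_prod_sub_pow_le (hV : StationaryMixing P V C κ) {g : E → ℝ}
    (hg : Measurable g) (a : ℕ) {b : ℕ} (hb : 1 ≤ b) (t : ℝ) (k : ℕ) :
    ‖∫ ω, ∏ j ∈ Finset.range k,
        Complex.exp ((t * ∑ i ∈ Finset.range a, g (V (j * (a + b) + i) ω) : ℝ) * Complex.I) ∂P
      - (∫ ω, Complex.exp ((t * ∑ i ∈ Finset.range a, g (V i ω) : ℝ) * Complex.I) ∂P) ^ k‖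
      ≤ k * (16 * (C * (b : ℝ) ^ (-κ))) := by
  set φ : ℕ → Ω → ℂ := fun j ω =>
    Complex.exp ((t * ∑ i ∈ Finset.range a, g (V (j * (a + b) + i) ω) : ℝ) * Complex.I) with hφ
  set z := ∫ ω, Complex.exp ((t * ∑ i ∈ Finset.range a, g (V i ω) : ℝ) * Complex.I) ∂P with hz
  have hInt : ∀ j, ∫ ω, φ j ω ∂P = z := by
    intro j
    have := hV.integral_shift_seq (φ := fun s : ℕ → E =>
      Complex.exp ((t * ∑ i ∈ Finset.range a, g (s i) : ℝ) * Complex.I)) (by fun_prop)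
      (j * (a + b))
    rw [hz, ← this]
    simp only [hφ, add_comm]
  have hnorm : ∀ j ω, ‖φ j ω‖ = 1 := fun j ω => Complex.norm_exp_ofReal_mul_I _
  have hmeas : ∀ (m : MeasurableSpace Ω) (j : ℕ),
      (∀ i < a, Measurable[m] (V (j * (a + b) + i))) → Measurable[m] (φ j) := by
    intro m j h
    have h1 := measurable_block hg h
    have h2 : Measurable fun y : ℝ => Complex.exp ((t * y : ℝ) * Complex.I) := by fun_prop
    exact h2.comp h1
  have hz1 : ‖z‖ ≤ 1 := by
    rw [← hInt 0]
    refine (norm_integral_le_integral_norm _).trans ?_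
    simp_rw [hnorm]; simp
  have hα : 0 ≤ C * (b : ℝ) ^ (-κ) := mul_nonneg hV.nonneg (by positivity)
  induction k with
  | zero => simp
  | succ k ih =>
    simp_rw [Finset.prod_range_succ]
    have hstep : ‖∫ ω, (∏ j ∈ Finset.range k, φ j ω) * φ k ω ∂P
        - (∫ ω, ∏ j ∈ Finset.range k, φ j ω ∂P) * ∫ ω, φ k ω ∂P‖
        ≤ 16 * (C * (b : ℝ) ^ (-κ)) := by
      -- The first block has no past, and for it the covariance is zero.
      rcases Nat.eq_zero_or_pos k with rfl | hk
      · simp only [Finset.range_zero, Finset.prod_empty, one_mul, integral_const, probReal_univ,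
          one_smul, sub_self, norm_zero]
        positivity
      · have hkb : b ≤ k * (a + b) := by nlinarith
        -- Block k starts at time k(a+b), and all earlier blocks end before k(a+b) - b, so exactly
        -- one gap separates past and future.
        have hmix := hV.mixing (k * (a + b) - b) b hb
        rw [Nat.sub_add_cancel hkb] at hmix
        refine hmix.cov_complex_le (sigmaOf_le hV.measurable _) (sigmaOf_le hV.measurable _)
          ?_ ?_ ?_ ?_
        · refine Finset.measurable_prod _ fun j hj => hmeas _ j fun i hi => measurable_sigmaOf ?_
          have hj' : j + 1 ≤ k := Finset.mem_range.1 hj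
          have : (j + 1) * (a + b) ≤ k * (a + b) := Nat.mul_le_mul_right _ hj'
          rw [add_mul, one_mul] at this
          simp only [Set.mem_Iic]; omega
        · exact hmeas _ k fun i hi => measurable_sigmaOf (by simp)
        · intro ω
          rw [norm_prod]
          simp [hnorm]
        · intro ω; rw [hnorm]
    rw [hInt] at hstep
    have e : ∫ ω, (∏ j ∈ Finset.range k, φ j ω) * φ k ω ∂P - z ^ (k + 1)
        = (∫ ω, (∏ j ∈ Finset.range k, φ j ω) * φ k ω ∂P
          - (∫ ω, ∏ j ∈ Finset.range k, φ j ω ∂P) * z)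
          + (∫ ω, ∏ j ∈ Finset.range k, φ j ω ∂P - z ^ k) * z := by ring
    rw [e]
    refine (norm_add_le _ _).trans ?_
    rw [norm_mul]
    have := (mul_le_of_le_one_right (norm_nonneg
      (∫ ω, ∏ j ∈ Finset.range k, φ j ω ∂P - z ^ k)) hz1).trans ih
    push_cast; linarith

end CharFun

/-! ### Convergence in measure from convergence of moments -/

section InMeasure

variable {Ω : Type*} [MeasurableSpace Ω] {P : Measure Ω} [IsProbabilityMeasure P]

lemma tendstoInMeasure_of_integral_abs {Z : ℕ → Ω → ℝ}
    (hi : ∀ᶠ n in atTop, Integrable (Z n) P)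
    (h : Tendsto (fun n => ∫ ω, |Z n ω| ∂P) atTop (𝓝 0)) :
    TendstoInMeasure P Z atTop 0 := by
  rw [tendstoInMeasure_iff_measureReal_norm]
  intro ε hε
  have h2 : Tendsto (fun n => ε⁻¹ * ∫ ω, |Z n ω| ∂P) atTop (𝓝 0) := by
    simpa using h.const_mul ε⁻¹
  refine squeeze_zero' (Eventually.of_forall fun n => measureReal_nonneg) ?_ h2
  filter_upwards [hi] with n hn
  have := mul_meas_ge_le_integral_of_nonneg (ae_of_all _ fun ω => abs_nonneg (Z n ω)) hn.abs ε
  simp only [Pi.zero_apply, sub_zero, Real.norm_eq_abs]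
  rw [inv_mul_eq_div, le_div_iff₀ hε, mul_comm]
  exact this

lemma tendstoInMeasure_of_integral_sq {Z : ℕ → Ω → ℝ}
    (hi : ∀ᶠ n in atTop, Integrable (fun ω => Z n ω ^ 2) P)
    (h : Tendsto (fun n => ∫ ω, Z n ω ^ 2 ∂P) atTop (𝓝 0)) :
    TendstoInMeasure P Z atTop 0 := by
  have h1 : TendstoInMeasure P (fun n ω => Z n ω ^ 2) atTop 0 :=
    tendstoInMeasure_of_integral_abs hi (by simpa only [abs_pow, sq_abs] using h)
  rw [tendstoInMeasure_iff_measureReal_norm] at h1 ⊢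
  intro ε hε
  refine (h1 (ε ^ 2) (by positivity)).congr fun n => ?_
  congr 1; ext ω
  simp only [Pi.zero_apply, sub_zero, Real.norm_eq_abs, Set.mem_ofPred_eq, abs_pow]
  rw [sq_le_sq₀ hε.le (abs_nonneg _)]

end InMeasure

section CLT

variable {Ω : Type*} [MeasurableSpace Ω] {P : Measure Ω} [IsProbabilityMeasure P]
  {E : Type*} [MeasurableSpace E] {V : ℕ → Ω → E} {C κ ζ M B : ℝ}

/-! ### Third moments of block sums -/

/-- Only pairs of visits are controlled by assumption, not triples. With H visits and Q ordered
pairs of distinct visits, H³ = H + Q(H+1) and H ≤ a, so the third moment reduces to pairs at the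
cost of one factor a. -/
lemma StationaryMixing.integral_hits_cube_le (hV : StationaryMixing P V C κ) {A : Set E}
    (hA : MeasurableSet A) (hM : 0 ≤ M)
    (hj : ∀ s t : ℕ, s ≠ t →
      P.real {ω | V s ω ∈ A ∧ V t ω ∈ A} ≤ M * P.real {ω | V 0 ω ∈ A} ^ 2) (a : ℕ) :
    Integrable (fun ω => (∑ i ∈ Finset.range a, A.indicator (fun _ => (1 : ℝ)) (V i ω)) ^ 3) P ∧
    ∫ ω, (∑ i ∈ Finset.range a, A.indicator (fun _ => (1 : ℝ)) (V i ω)) ^ 3 ∂P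
      ≤ a * P.real {ω | V 0 ω ∈ A} + 2 * M * a ^ 3 * P.real {ω | V 0 ω ∈ A} ^ 2 := by
  set p := P.real {ω | V 0 ω ∈ A} with hp
  set I : ℕ → Ω → ℝ := fun i ω => A.indicator (fun _ => (1 : ℝ)) (V i ω) with hI
  have hI01 : ∀ i ω, I i ω = 0 ∨ I i ω = 1 := fun i ω => by
    by_cases h : V i ω ∈ A
    · right; simp [hI, h]
    · left; simp [hI, h]
  have hI0 : ∀ i ω, 0 ≤ I i ω := fun i ω => by rcases hI01 i ω with h | h <;> simp [h]
  have hI1 : ∀ i ω, I i ω ≤ 1 := fun i ω => by rcases hI01 i ω with h | h <;> simp [h]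
  have hIm : ∀ i, Measurable (I i) := fun i =>
    (measurable_const.indicator hA).comp (hV.measurable i)
  set H : Ω → ℝ := fun ω => ∑ i ∈ Finset.range a, I i ω with hH
  set Q : Ω → ℝ := fun ω => ∑ i ∈ Finset.range a, ∑ j ∈ (Finset.range a).erase i, I i ω * I j ω
    with hQ
  have hHm : Measurable H := Finset.measurable_sum _ fun i _ => hIm i
  have hH0 : ∀ ω, 0 ≤ H ω := fun ω => Finset.sum_nonneg fun i _ => hI0 i ω
  have hHa : ∀ ω, H ω ≤ a := fun ω => by
    refine (Finset.sum_le_sum fun i _ => hI1 i ω).trans ?_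
    simp
  have hQ0 : ∀ ω, 0 ≤ Q ω := fun ω =>
    Finset.sum_nonneg fun i _ => Finset.sum_nonneg fun j _ => mul_nonneg (hI0 i ω) (hI0 j ω)
  have hQH : ∀ ω, H ω ^ 2 = H ω + Q ω := by
    intro ω
    rw [sq, hH, Finset.sum_mul_sum, hQ, ← Finset.sum_add_distrib]
    refine Finset.sum_congr rfl fun i hi => ?_
    rw [← Finset.add_sum_erase _ _ hi]
    congr 1
    rcases hI01 i ω with h | h <;> simp [h]
  have hcube : ∀ ω, H ω ^ 3 ≤ H ω + (a + 1) * Q ω := by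
    intro ω
    have : H ω ^ 3 = H ω + Q ω * (H ω + 1) := by
      calc H ω ^ 3 = H ω * H ω ^ 2 := by ring
        _ = H ω ^ 2 + H ω * Q ω := by rw [hQH]; nlinarith [hQH ω]
        _ = _ := by rw [hQH]; ring
    rw [this]
    nlinarith [hQ0 ω, hHa ω]
  have hIint : ∀ i, Integrable (I i) P ∧ ∫ ω, I i ω ∂P = p := fun i => by
    have := integrable_indicator_comp (P := P) hV.measurable hA i
    exact ⟨this.1, this.2.trans (hV.measureReal_eq hA i)⟩
  have hIIint : ∀ i j, Integrable (fun ω => I i ω * I j ω) P := fun i j =>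
    Integrable.of_bound ((hIm i).mul (hIm j)).aestronglyMeasurable 1 (ae_of_all _ fun ω => by
      rw [Real.norm_eq_abs, abs_of_nonneg (mul_nonneg (hI0 i ω) (hI0 j ω))]
      exact mul_le_one₀ (hI1 i ω) (hI0 j ω) (hI1 j ω))
  have hIIval : ∀ i j, i ≠ j → ∫ ω, I i ω * I j ω ∂P ≤ M * p ^ 2 := by
    intro i j hij
    have hm : MeasurableSet {ω | V i ω ∈ A ∧ V j ω ∈ A} :=
      (hV.measurable i hA).inter (hV.measurable j hA)
    have e : (fun ω => I i ω * I j ω)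
        = {ω | V i ω ∈ A ∧ V j ω ∈ A}.indicator fun _ => (1 : ℝ) := by
      ext ω
      by_cases h1 : V i ω ∈ A <;> by_cases h2 : V j ω ∈ A <;> simp [hI, h1, h2]
    rw [e, integral_indicator hm]
    simpa using hj i j hij
  have hHint : Integrable H P := integrable_finsetSum _ fun i _ => (hIint i).1
  have hQint : Integrable Q P :=
    integrable_finsetSum _ fun i _ => integrable_finsetSum _ fun j _ => hIIint i j
  have hH3 : Integrable (fun ω => H ω ^ 3) P :=
    Integrable.of_bound (hHm.pow_const 3).aestronglyMeasurable ((a : ℝ) ^ 3)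
      (ae_of_all _ fun ω => by
        rw [Real.norm_eq_abs, abs_of_nonneg (pow_nonneg (hH0 ω) 3)]
        exact pow_le_pow_left₀ (hH0 ω) (hHa ω) 3)
  refine ⟨hH3, ?_⟩
  refine (integral_mono hH3 (hHint.add (hQint.const_mul (a + 1 : ℝ))) hcube).trans ?_
  simp only [Pi.add_apply]
  rw [integral_add hHint (hQint.const_mul _), integral_const_mul]
  have e1 : ∫ ω, H ω ∂P = a * p := by
    rw [hH, integral_finsetSum _ fun i _ => (hIint i).1]
    simp [hIint]
  have e2 : ∫ ω, Q ω ∂P ≤ a * (a * (M * p ^ 2)) := by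
    rw [hQ, integral_finsetSum _ fun i _ => integrable_finsetSum _ fun j _ => hIIint i j]
    have : ∀ i ∈ Finset.range a,
        ∫ ω, ∑ j ∈ (Finset.range a).erase i, I i ω * I j ω ∂P ≤ a * (M * p ^ 2) := by
      intro i hi
      rw [integral_finsetSum _ fun j _ => hIIint i j]
      refine (Finset.sum_le_sum fun j hj => hIIval i j (Finset.ne_of_mem_erase hj).symm).trans ?_
      rw [Finset.sum_const, nsmul_eq_mul]
      gcongr
      · have := Finset.card_le_card (Finset.erase_subset i (Finset.range a))
        simpa using this
    refine (Finset.sum_le_sum this).trans ?_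
    simp
  rw [e1]
  have h3 : ((a : ℝ) + 1) * ∫ ω, Q ω ∂P ≤ (a + 1) * (a * (a * (M * p ^ 2))) := by gcongr
  have h4 : ((a : ℝ) + 1) * (a * (a * (M * p ^ 2))) ≤ 2 * M * a ^ 3 * p ^ 2 := by
    rcases Nat.eq_zero_or_pos a with h | h
    · simp [h]
    · have : (1 : ℝ) ≤ a := by exact_mod_cast h
      have h5 : 0 ≤ (a : ℝ) ^ 2 * (M * p ^ 2) := by positivity
      nlinarith
  linarith

/-- Two bounds are available: the trivial |G| ≤ 2aτ times the variance, giving a·(ap), and the count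
of visits, giving ap(1 + a²p). Since min(a, a²p) ≤ √(a³p), their combination is good enough for
Lyapunov's condition whenever a³ = o(n), at any rate of p. -/
lemma Localized.integral_abs_cube_le (hV : StationaryMixing P V C κ) {A : Set E} {f : E → ℝ}
    (hf : Localized P V ζ M B A f) {τ D : ℝ} (hτ : 1 ≤ τ) (hD : 0 ≤ D) (hfτ : ∀ v, |f v| ≤ τ)
    (a : ℕ)
    (hi2 : Integrable (fun ω => (∑ i ∈ Finset.range a, (f (V i ω) - ∫ ω', f (V 0 ω') ∂P)) ^ 2) P)
    (h2 : ∫ ω, (∑ i ∈ Finset.range a, (f (V i ω) - ∫ ω', f (V 0 ω') ∂P)) ^ 2 ∂P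
      ≤ D * a * P.real {ω | V 0 ω ∈ A}) :
    Integrable (fun ω => |∑ i ∈ Finset.range a, (f (V i ω) - ∫ ω', f (V 0 ω') ∂P)| ^ 3) P ∧
    ∫ ω, |∑ i ∈ Finset.range a, (f (V i ω) - ∫ ω', f (V 0 ω') ∂P)| ^ 3 ∂P
      ≤ (2 * D + 8 * (M + 1)) * τ ^ 3 * (a * P.real {ω | V 0 ω ∈ A}) *
        (1 + √((a : ℝ) ^ 3 * P.real {ω | V 0 ω ∈ A})) := by
  set p := P.real {ω | V 0 ω ∈ A} with hp
  have hp0 : 0 ≤ p := measureReal_nonneg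
  have hp1 : p ≤ 1 := measureReal_le_one
  set c := ∫ ω', f (V 0 ω') ∂P with hc
  set G : Ω → ℝ := fun ω => ∑ i ∈ Finset.range a, (f (V i ω) - c) with hG
  have hM := hf.M_nonneg
  have hGm : Measurable G :=
    Finset.measurable_sum _ fun i _ => (hf.measurable.comp (hV.measurable i)).sub_const c
  have hI := integrable_indicator_comp (P := P) hV.measurable hf.measurableSet 0
  have hfA : ∀ v, |f v| ≤ τ * A.indicator (fun _ => (1 : ℝ)) v := fun v => by
    by_cases h : v ∈ A
    · simpa [Set.indicator_of_mem h] using hfτ v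
    · simp [hf.eq_zero v h, Set.indicator_of_notMem h]
  have hcτ : |c| ≤ τ * p := by
    refine (abs_integral_le_integral_abs).trans ?_
    refine (integral_mono (hf.integral_abs_le hV.measurable).1.abs (hI.1.const_mul τ)
      fun ω => hfA _).trans ?_
    rw [integral_const_mul, hI.2]
  set H : Ω → ℝ := fun ω => ∑ i ∈ Finset.range a, A.indicator (fun _ => (1 : ℝ)) (V i ω) with hH
  obtain ⟨hH3, hH3le⟩ := hV.integral_hits_cube_le hf.measurableSet hM hf.joint a
  have hH0 : ∀ ω, 0 ≤ H ω := fun ω =>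
    Finset.sum_nonneg fun i _ => Set.indicator_nonneg (fun _ _ => zero_le_one) _
  have hHa : ∀ ω, H ω ≤ a := fun ω => by
    have h1 : ∀ i ∈ Finset.range a, A.indicator (fun _ => (1 : ℝ)) (V i ω) ≤ 1 := fun i _ =>
      Set.indicator_le_self' (f := fun _ => (1 : ℝ)) (fun _ _ => zero_le_one) _
    refine (Finset.sum_le_sum h1).trans ?_
    simp
  have hGH : ∀ ω, |G ω| ≤ τ * (H ω + a * p) := by
    intro ω
    refine (Finset.abs_sum_le_sum_abs _ _).trans ?_
    have : ∀ i ∈ Finset.range a, |f (V i ω) - c|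
        ≤ τ * A.indicator (fun _ => (1 : ℝ)) (V i ω) + τ * p := fun i _ =>
      (abs_sub _ _).trans (add_le_add (hfA _) hcτ)
    refine (Finset.sum_le_sum this).trans (le_of_eq ?_)
    rw [Finset.sum_add_distrib, ← Finset.mul_sum]
    simp only [Finset.sum_const, Finset.card_range, nsmul_eq_mul, hH]; ring
  have hGa : ∀ ω, |G ω| ≤ 2 * a * τ := fun ω => by
    refine (hGH ω).trans ?_
    have h1 : (a : ℝ) * p ≤ a := mul_le_of_le_one_right (Nat.cast_nonneg _) hp1
    nlinarith [hHa ω]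
  have hi3 : Integrable (fun ω => |G ω| ^ 3) P :=
    Integrable.of_bound (hGm.abs.pow_const 3).aestronglyMeasurable ((2 * a * τ) ^ 3)
      (ae_of_all _ fun ω => by
        rw [Real.norm_eq_abs, abs_of_nonneg (by positivity)]
        exact pow_le_pow_left₀ (abs_nonneg _) (hGa ω) 3)
  refine ⟨hi3, ?_⟩
  have ha0 : (0 : ℝ) ≤ a := Nat.cast_nonneg _
  have first : ∫ ω, |G ω| ^ 3 ∂P ≤ 2 * a * τ * (D * a * p) := by
    refine (integral_mono hi3 (hi2.const_mul (2 * a * τ)) fun ω => ?_).trans ?_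
    · calc |G ω| ^ 3 = |G ω| * G ω ^ 2 := by rw [pow_succ', sq_abs]
        _ ≤ 2 * a * τ * G ω ^ 2 := mul_le_mul_of_nonneg_right (hGa ω) (sq_nonneg _)
    · rw [integral_const_mul]
      exact mul_le_mul_of_nonneg_left h2 (by positivity)
  have second : ∫ ω, |G ω| ^ 3 ∂P ≤ 8 * (M + 1) * τ ^ 3 * (a * p) * (1 + a ^ 2 * p) := by
    have hle : ∀ ω, |G ω| ^ 3 ≤ 4 * τ ^ 3 * (H ω ^ 3 + (a * p) ^ 3) := fun ω => by
      refine (pow_le_pow_left₀ (abs_nonneg _) (hGH ω) 3).trans ?_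
      rw [mul_pow, mul_comm 4, mul_assoc]
      refine mul_le_mul_of_nonneg_left ?_ (by positivity)
      have x0 := hH0 ω
      have y0 : 0 ≤ (a : ℝ) * p := by positivity
      -- (x+y)³ ≤ 4(x³+y³) for non-negative x and y: the difference is 3(x+y)(x-y)².
      nlinarith [mul_nonneg (add_nonneg x0 y0) (sq_nonneg (H ω - a * p))]
    have hi : Integrable (fun ω => 4 * τ ^ 3 * (H ω ^ 3 + (a * p) ^ 3)) P :=
      (hH3.add (integrable_const _)).const_mul _
    refine (integral_mono hi3 hi hle).trans ?_
    rw [integral_const_mul, integral_add hH3 (integrable_const _)]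
    simp only [integral_const, probReal_univ, smul_eq_mul, one_mul]
    have h3 : (a * p) ^ 3 ≤ a ^ 3 * p ^ 2 := by
      rw [mul_pow]
      exact mul_le_mul_of_nonneg_left (pow_le_pow_of_le_one hp0 hp1 (by norm_num)) (by positivity)
    have h4 : 4 * τ ^ 3 * ((∫ ω, H ω ^ 3 ∂P) + (a * p) ^ 3)
        ≤ 4 * τ ^ 3 * ((a * p + 2 * M * a ^ 3 * p ^ 2) + a ^ 3 * p ^ 2) := by
      gcongr
    refine h4.trans ?_
    have h5 : 0 ≤ τ ^ 3 * (a * p) := by positivity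
    have h6 : 0 ≤ τ ^ 3 * (a ^ 3 * p ^ 2) := by positivity
    have h7 : 0 ≤ M * (τ ^ 3 * (a * p)) := by positivity
    nlinarith
  have hτ3 : τ ≤ τ ^ 3 := by nlinarith [sq_nonneg τ, mul_self_nonneg (τ - 1)]
  have hsq : √((a : ℝ) ^ 3 * p) ^ 2 = a ^ 3 * p := Real.sq_sqrt (by positivity)
  have hs0 : 0 ≤ √((a : ℝ) ^ 3 * p) := Real.sqrt_nonneg _
  set s := √((a : ℝ) ^ 3 * p) with hs
  -- The smaller of a and a²p lies below their geometric mean √(a³p); each case uses the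
  -- corresponding bound.
  rcases le_total (a : ℝ) (a ^ 2 * p) with h | h
  · have h1 : (a : ℝ) ≤ s := by
      rw [hs]; refine Real.le_sqrt_of_sq_le ?_
      nlinarith
    have h3 : 2 * a * τ * (D * a * p) ≤ 2 * s * τ ^ 3 * (D * a * p) := by gcongr
    refine first.trans (h3.trans ?_)
    have h4 : 0 ≤ τ ^ 3 * (a * p) := by positivity
    have h5 : 0 ≤ D * (τ ^ 3 * (a * p)) := by positivity
    have h6 : 0 ≤ (M + 1) * (τ ^ 3 * (a * p)) * (1 + s) := by positivity
    nlinarith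
  · have h1 : (a : ℝ) ^ 2 * p ≤ s := by
      rw [hs]; refine Real.le_sqrt_of_sq_le ?_
      have : (a : ℝ) ^ 3 * p = a * (a ^ 2 * p) := by ring
      rw [this, sq]
      exact mul_le_mul_of_nonneg_right h (by positivity)
    refine second.trans ?_
    have h4 : 0 ≤ τ ^ 3 * (a * p) := by positivity
    have h3 : 8 * (M + 1) * τ ^ 3 * (a * p) * (1 + a ^ 2 * p)
        ≤ 8 * (M + 1) * τ ^ 3 * (a * p) * (1 + s) := by gcongr
    have h5 : 0 ≤ D * (τ ^ 3 * (a * p)) * (1 + s) := by positivity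
    nlinarith

/-! ### Negligible autocovariances -/

/-- Dominated convergence over the lags: after division by p, the uniform covariance bound supplies
the summable majorant D l^(-c), so convergence at each fixed lag is enough. -/
lemma tendsto_tsum_acov_div (hζ : 0 < ζ) (hκ : 2 + 4 / ζ < κ)
    (hV : StationaryMixing P V C κ) {A : ℕ → Set E} {g : ℕ → E → ℝ}
    (hloc : ∀ᶠ n in atTop, Localized P V ζ M B (A n) (g n))
    (hcov : ∀ l : ℕ, 1 ≤ l →
      Tendsto (fun n => acov P V (g n) l / P.real {ω | V 0 ω ∈ A n}) atTop (𝓝 0)) :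
    (∀ᶠ n in atTop, Summable fun l => |acov P V (g n) (l + 1)|) ∧
    Tendsto (fun n => (∑' l, |acov P V (g n) (l + 1)|) / P.real {ω | V 0 ω ∈ A n}) atTop
      (𝓝 0) := by
  obtain ⟨D, c, hD, hc, hbd⟩ := exists_abs_acov_le P V M B hζ hκ hV
  have hsum := summable_rpow_neg_succ hc
  constructor
  · filter_upwards [hloc] with n hn
    exact Summable.of_nonneg_of_le (fun _ => abs_nonneg _)
      (fun l => hbd (A n) (g n) hn (l + 1) (by omega)) (hsum.mul_left _)
  · have := tendsto_tsum_of_dominated_convergence (𝓕 := atTop)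
      (f := fun n l => |acov P V (g n) (l + 1)| / P.real {ω | V 0 ω ∈ A n}) (g := fun _ => 0)
      (bound := fun l : ℕ => D * ((l + 1 : ℕ) : ℝ) ^ (-c)) (hsum.mul_left D)
      (fun l => by
        have h1 := (hcov (l + 1) (by omega)).abs
        rw [abs_zero] at h1
        refine h1.congr fun n => ?_
        rw [abs_div, abs_of_nonneg (measureReal_nonneg (μ := P))])
      (by
        filter_upwards [hloc] with n hn l
        have hp : 0 ≤ P.real {ω | V 0 ω ∈ A n} := measureReal_nonneg
        rw [Real.norm_eq_abs, abs_div, abs_abs, abs_of_nonneg hp]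
        refine div_le_of_le_mul₀ hp (by positivity) ?_
        have := hbd (A n) (g n) hn (l + 1) (by omega)
        linarith)
    simp only [tsum_zero, tsum_div_const] at this
    exact this

end CLT

/-! ### Bernstein blocks and the central limit theorem for localized arrays -/

section CLT

variable {Ω : Type*} [MeasurableSpace Ω] {P : Measure Ω} [IsProbabilityMeasure P]
  {E : Type*} [MeasurableSpace E] {V : ℕ → Ω → E} {C κ ζ M B : ℝ}

/-- The indices covered by `k` blocks of length `a` separated by gaps of length `b`. -/
def blockIndices (a b k : ℕ) : Finset ℕ :=
  (Finset.range k ×ˢ Finset.range a).image fun x => x.1 * (a + b) + x.2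

lemma injOn_blockIndices (a b k : ℕ) :
    Set.InjOn (fun x : ℕ × ℕ => x.1 * (a + b) + x.2) (Finset.range k ×ˢ Finset.range a : Finset _) := by
  rintro ⟨i, j⟩ h ⟨i', j'⟩ h' e
  simp only [Finset.coe_product, Finset.coe_range, Set.mem_prod, Set.mem_Iio] at h h' e
  have h0 : 0 < a + b := by omega
  have e1 := congrArg (· / (a + b)) e
  rw [add_comm, Nat.add_mul_div_right _ _ h0, add_comm (i' * _), Nat.add_mul_div_right _ _ h0,
    Nat.div_eq_of_lt (by omega), Nat.div_eq_of_lt (by omega)] at e1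
  have : i = i' := by omega
  subst this
  simp only [Prod.mk.injEq, true_and]; omega

lemma sum_blockIndices (a b k : ℕ) (φ : ℕ → ℝ) :
    ∑ i ∈ blockIndices a b k, φ i
      = ∑ j ∈ Finset.range k, ∑ i ∈ Finset.range a, φ (j * (a + b) + i) := by
  rw [blockIndices, Finset.sum_image (injOn_blockIndices a b k), Finset.sum_product]

lemma card_blockIndices (a b k : ℕ) : (blockIndices a b k).card = k * a := by
  rw [blockIndices, Finset.card_image_of_injOn (injOn_blockIndices a b k)]; simp

lemma blockIndices_subset {a b k n : ℕ} (h : k * (a + b) ≤ n) :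
    blockIndices a b k ⊆ Finset.range n := by
  intro i hi
  simp only [blockIndices, Finset.mem_image, Finset.mem_product, Finset.mem_range] at hi ⊢
  obtain ⟨⟨j, l⟩, ⟨hj, hl⟩, rfl⟩ := hi
  have : (j + 1) * (a + b) ≤ k * (a + b) := Nat.mul_le_mul_right _ hj
  rw [add_mul, one_mul] at this
  simp only at hl ⊢; omega

set_option maxHeartbeats 1000000 in
/-- **Central limit theorem** for triangular arrays of localized functions of a stationary mixing
sequence. -/
theorem tendstoInDistribution_sum_localized (hζ : 0 < ζ) (hκ : 2 + 4 / ζ < κ)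
    (hM : 0 ≤ M) (hB : 0 ≤ B)
    (hV : StationaryMixing P V C κ) {A : ℕ → Set E} {f : ℕ → E → ℝ} {c₀ : ℝ} (hc₀ : 0 < c₀)
    (hmeas : ∀ n, Measurable (f n))
    (hloc : ∀ᶠ n in atTop, Localized P V ζ M B (A n) (f n))
    (hmean : ∀ᶠ n in atTop, ∫ ω, f n (V 0 ω) ∂P = 0)
    (hvar : ∀ᶠ n in atTop, c₀ * P.real {ω | V 0 ω ∈ A n} ≤ ∫ ω, f n (V 0 ω) ^ 2 ∂P)
    (hL : Tendsto (fun n : ℕ => (n : ℝ) * P.real {ω | V 0 ω ∈ A n}) atTop atTop)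
    (hcov : ∀ l : ℕ, 1 ≤ l →
      Tendsto (fun n => acov P V (f n) l / P.real {ω | V 0 ω ∈ A n}) atTop (𝓝 0)) :
    TendstoInDistribution
      (fun (n : ℕ) ω => (√(n * ∫ ω', f n (V 0 ω') ^ 2 ∂P))⁻¹ *
        ∑ i ∈ Finset.range n, f n (V i ω))
      atTop id (fun _ => P) (gaussianReal 0 1) := by
  have hκ2 : 2 < κ := by have : 0 < 4 / ζ := by positivity
                         linarith
  obtain ⟨D, hD, hDbd⟩ := exists_integral_sq_sum_le P V M B hB hζ hκ hV
  obtain ⟨a, b, k, hkn, hb1, ha3, hkb, hka, hk⟩ := exists_block_sizes hκ2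
  set p : ℕ → ℝ := fun n => P.real {ω | V 0 ω ∈ A n} with hp
  set v : ℕ → ℝ := fun n => ∫ ω', f n (V 0 ω') ^ 2 ∂P with hv
  -- These two terms are what remains in Lyapunov's ratio of the blocks, up to a square root and the
  -- truncation level.
  set ε : ℕ → ℝ := fun n => (a n : ℝ) ^ 3 / n + ((n : ℝ) * p n)⁻¹ with hε
  have hε0 : Tendsto ε atTop (𝓝 0) := by
    have := ha3.add (tendsto_inv_atTop_zero.comp hL)
    rwa [add_zero] at this
  have hLpos : ∀ᶠ n : ℕ in atTop, 0 < (n : ℝ) * p n := hL.eventually_gt_atTop 0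
  have hεpos : ∀ᶠ n in atTop, 0 < ε n := by
    filter_upwards [hLpos] with n hn
    have : 0 < ((n : ℝ) * p n)⁻¹ := inv_pos.2 hn
    positivity
  -- The truncation level must tend to infinity while τ³√ε → 0; the exponent -1/12 makes the latter
  -- ε^(1/4).
  set τ : ℕ → ℝ := fun n => (ε n) ^ (-(1 / 12) : ℝ) with hτ
  have hτ1 : ∀ᶠ n in atTop, 1 ≤ τ n := by
    filter_upwards [hεpos, hε0.eventually_le_const one_pos] with n h1 h2
    exact Real.one_le_rpow_of_pos_of_le_one_of_nonpos h1 h2 (by norm_num)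
  have hpow0 : ∀ e : ℝ, 0 < e → Tendsto (fun n => (ε n) ^ e) atTop (𝓝 0) := fun e he => by
    have := hε0.rpow_const (p := e) (Or.inr he.le)
    rwa [Real.zero_rpow he.ne'] at this
  have hτζ : Tendsto (fun n => (τ n) ^ (-ζ)) atTop (𝓝 0) := by
    refine (hpow0 (ζ / 12) (by positivity)).congr' ?_
    filter_upwards [hεpos] with n hn
    rw [hτ, ← Real.rpow_mul hn.le]; congr 1; ring
  have hτ3 : Tendsto (fun n => (τ n) ^ 3 * √(ε n)) atTop (𝓝 0) := by
    refine (hpow0 (1 / 4) (by positivity)).congr' ?_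
    filter_upwards [hεpos] with n hn
    rw [hτ, Real.sqrt_eq_rpow, ← Real.rpow_natCast, ← Real.rpow_mul hn.le, ← Real.rpow_add hn]
    congr 1; norm_num
  set T : ℕ → E → ℝ := fun n => trunc (τ n) (f n) with hT
  have hTm : ∀ n, Measurable (T n) := fun n => measurable_trunc _ (hmeas n)
  have hlocT : ∀ᶠ n in atTop, Localized P V ζ M B (A n) (T n) := by
    filter_upwards [hloc] with n hn using hn.trunc hV.measurable _
  have hlocR : ∀ᶠ n in atTop, Localized P V ζ M B (A n) (fun w => f n w - T n w) := by
    filter_upwards [hloc] with n hn using hn.sub_trunc hV.measurable _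
  have hppos : ∀ᶠ n in atTop, 0 < p n := by
    filter_upwards [hLpos] with n hn
    exact pos_of_mul_pos_right hn (Nat.cast_nonneg _)
  have hvpos : ∀ᶠ n in atTop, 0 < v n := by
    filter_upwards [hvar, hppos] with n h1 h2
    exact lt_of_lt_of_le (mul_pos hc₀ h2) h1
  have hnpos : ∀ᶠ n : ℕ in atTop, (0 : ℝ) < n := by
    filter_upwards [eventually_gt_atTop 0] with n hn; exact_mod_cast hn
  set CB := 2 * B + 2 * B * (1 + B) with hCB
  -- autocovariances of the truncated and of the remaining part
  have hTsub : ∀ l : ℕ, Tendsto (fun n => (acov P V (f n) l - acov P V (T n) l) / p n) atTop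
      (𝓝 0) := by
    intro l
    have h0 : Tendsto (fun n => CB * (τ n) ^ (-ζ)) atTop (𝓝 0) := by
      simpa using hτζ.const_mul CB
    refine squeeze_zero_norm' ?_ h0
    filter_upwards [hloc, hτ1, hppos] with n h1 h2 h3
    rw [Real.norm_eq_abs, abs_div, abs_of_pos h3, div_le_iff₀ h3]
    exact h1.abs_acov_sub_trunc_le hV h2 l
  have hcovT : ∀ l : ℕ, 1 ≤ l → Tendsto (fun n => acov P V (T n) l / p n) atTop (𝓝 0) := by
    intro l hl
    have := (hcov l hl).sub (hTsub l)
    rw [sub_zero] at this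
    refine this.congr fun n => ?_
    rw [← sub_div]; congr 1; ring
  have hR2 : Tendsto (fun n => (∫ ω, (f n (V 0 ω) - T n (V 0 ω)) ^ 2 ∂P) / p n) atTop (𝓝 0) := by
    have h0 : Tendsto (fun n => B * (τ n) ^ (-ζ)) atTop (𝓝 0) := by
      simpa using hτζ.const_mul B
    refine squeeze_zero' ?_ ?_ h0
    · filter_upwards [hppos] with n h3
      exact div_nonneg (integral_nonneg fun ω => sq_nonneg _) h3.le
    · filter_upwards [hloc, hτ1, hppos] with n h1 h2 h3
      rw [div_le_iff₀ h3]
      exact h1.integral_sq_sub_trunc_le hV.measurable (by linarith)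
  have hcovR : ∀ l : ℕ, 1 ≤ l →
      Tendsto (fun n => acov P V (fun w => f n w - T n w) l / p n) atTop (𝓝 0) := by
    intro l hl
    have h0 := hR2.const_mul 2
    rw [mul_zero] at h0
    refine squeeze_zero_norm' ?_ h0
    filter_upwards [hlocR, hppos] with n h1 h3
    rw [Real.norm_eq_abs, abs_div, abs_of_pos h3, mul_div_assoc']
    gcongr
    exact h1.abs_acov_le_two_mul hV l
  obtain ⟨hsumT, htsT⟩ := tendsto_tsum_acov_div hζ hκ hV hlocT hcovT
  obtain ⟨hsumR, htsR⟩ := tendsto_tsum_acov_div hζ hκ hV hlocR hcovR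
  set cT : ℕ → ℝ := fun n => ∫ ω', T n (V 0 ω') ∂P with hcT
  set s : ℕ → ℝ := fun n => √(n * v n) with hs
  have hs2 : ∀ᶠ n in atTop, s n ^ 2 = n * v n := by
    filter_upwards [hvpos] with n hn
    exact Real.sq_sqrt (by positivity)
  have hspos : ∀ᶠ n in atTop, 0 < s n := by
    filter_upwards [hvpos, hnpos] with n hn hn'
    exact Real.sqrt_pos.2 (by positivity)
  set g : ℕ → E → ℝ := fun n w => (s n)⁻¹ * (T n w - cT n) with hg
  have hgm : ∀ n, Measurable (g n) := fun n => ((hTm n).sub_const _).const_mul _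
  set U : ℕ → Ω → ℝ := fun n ω => ∑ i ∈ Finset.range (a n), g n (V i ω) with hU
  have hUm : ∀ n, Measurable (U n) := fun n =>
    Finset.measurable_sum _ fun i _ => (hgm n).comp (hV.measurable i)
  have hUeq : ∀ n ω, U n ω
      = (s n)⁻¹ * ∑ i ∈ Finset.range (a n), (T n (V i ω) - cT n) := fun n ω => by
    rw [Finset.mul_sum]
  -- second moments of the blocks
  have hUsq : ∀ᶠ n in atTop, Integrable (fun ω => U n ω ^ 2) P := by
    filter_upwards [hlocT] with n h1
    simp_rw [hUeq, mul_pow]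
    exact (hDbd _ _ h1 _).1.const_mul _
  have hratio : Tendsto (fun n => acov P V (T n) 0 / v n) atTop (𝓝 1) := by
    have h1 : Tendsto (fun n => (acov P V (f n) 0 - acov P V (T n) 0) / v n) atTop (𝓝 0) := by
      have h0 := (hTsub 0).abs.const_mul c₀⁻¹
      rw [abs_zero, mul_zero] at h0
      refine squeeze_zero_norm' ?_ h0
      filter_upwards [hvar, hppos] with n h1 h3
      rw [Real.norm_eq_abs, abs_div, abs_div, abs_of_pos h3,
        abs_of_pos (lt_of_lt_of_le (mul_pos hc₀ h3) h1), inv_mul_eq_div, div_div]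
      refine div_le_div_of_nonneg_left (abs_nonneg _) (by positivity) ?_
      rw [mul_comm]; exact h1
    have h2 := tendsto_const_nhds (x := (1 : ℝ)).sub h1
    rw [sub_zero] at h2
    refine h2.congr' ?_
    filter_upwards [hmean, hvpos] with n h3 h4
    have e : acov P V (f n) 0 = v n := by
      unfold acov; rw [h3]; simp [hv, sq]
    rw [e]; field_simp; ring
  -- The diagonal of the block covariance gives (ka/n) times a variance ratio, and both factors tend
  -- to 1. The off-diagonal part is bounded by the sum of covariances over lags divided by p, which
  -- vanishes.
  have hEU2 : Tendsto (fun n => (k n : ℝ) * ∫ ω, U n ω ^ 2 ∂P) atTop (𝓝 1) := by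
    have hmain : Tendsto (fun n => ((k n : ℝ) * a n / n) * (acov P V (T n) 0 / v n)) atTop
        (𝓝 (1 * 1)) := hka.mul hratio
    have herr : Tendsto (fun n => (k n : ℝ) * (∫ ω, U n ω ^ 2 ∂P)
        - ((k n : ℝ) * a n / n) * (acov P V (T n) 0 / v n)) atTop (𝓝 0) := by
      have h0 : Tendsto (fun n => ((k n : ℝ) * a n / n) *
          (2 * c₀⁻¹ * ((∑' l, |acov P V (T n) (l + 1)|) / p n))) atTop
          (𝓝 (1 * (2 * c₀⁻¹ * 0))) := hka.mul (htsT.const_mul _)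
      rw [mul_zero, mul_zero] at h0
      refine squeeze_zero_norm' ?_ h0
      filter_upwards [hlocT, hsumT, hvar, hppos, hs2, hnpos, hvpos] with n h1 h2 h3 h4 h5 h6 h7
      have hb := (hV.integral_sq_sum_centered h1.measurable
        (h1.integral_sq_le hV.measurable).1 h2 (Finset.range (a n))).2
      rw [Finset.card_range] at hb
      have eU : ∫ ω, U n ω ^ 2 ∂P
          = ((n : ℝ) * v n)⁻¹ * ∫ ω, (∑ i ∈ Finset.range (a n), (T n (V i ω) - cT n)) ^ 2 ∂P := by
        simp_rw [hUeq, mul_pow]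
        rw [integral_const_mul, inv_pow, h5]
      set X := ∫ ω, (∑ i ∈ Finset.range (a n), (T n (V i ω) - cT n)) ^ 2 ∂P
      set Θ := ∑' l, |acov P V (T n) (l + 1)|
      have hΘ : 0 ≤ Θ := tsum_nonneg fun _ => abs_nonneg _
      have e2 : (k n : ℝ) * (((n : ℝ) * v n)⁻¹ * X)
          - ((k n : ℝ) * a n / n) * (acov P V (T n) 0 / v n)
          = (k n : ℝ) / n / v n * (X - a n * acov P V (T n) 0) := by
        field_simp
      rw [eU, e2, Real.norm_eq_abs, abs_mul, abs_of_nonneg (by positivity)]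
      calc (k n : ℝ) / n / v n * |X - a n * acov P V (T n) 0|
          ≤ (k n : ℝ) / n / v n * (2 * a n * Θ) := by gcongr
        _ ≤ (k n : ℝ) / n / (c₀ * p n) * (2 * a n * Θ) := by gcongr
        _ = _ := by field_simp
    have := herr.add hmain
    simp only [zero_add, mul_one] at this
    refine this.congr fun n => ?_
    ring
  -- third moments of the blocks
  have hU3 : ∀ᶠ n in atTop, Integrable (fun ω => |U n ω| ^ 3) P ∧
      (k n : ℝ) * ∫ ω, |U n ω| ^ 3 ∂P
        ≤ (2 * D + 8 * (M + 1)) * (√c₀)⁻¹ ^ 3 * 2 * ((τ n) ^ 3 * √(ε n)) := by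
    filter_upwards [hlocT, hτ1, hspos, hnpos, hppos, hvar, hLpos, hεpos]
      with n h1 h2 h3 h4 h5 h6 h7 h8
    obtain ⟨b1, b2⟩ := hDbd _ _ h1 (Finset.range (a n))
    rw [Finset.card_range] at b2
    obtain ⟨c1, c2⟩ := h1.integral_abs_cube_le hV h2 hD.le (abs_trunc_le (by linarith) _) (a n) b1 b2
    have eU : ∀ ω, |U n ω| ^ 3
        = (s n)⁻¹ ^ 3 * |∑ i ∈ Finset.range (a n), (T n (V i ω) - cT n)| ^ 3 := fun ω => by
      rw [hUeq, abs_mul, mul_pow, abs_of_pos (inv_pos.2 h3)]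
    simp_rw [eU]
    refine ⟨c1.const_mul _, ?_⟩
    rw [integral_const_mul]
    set L := (n : ℝ) * p n with hLdef
    have hsL : (s n)⁻¹ ≤ (√c₀)⁻¹ * (√L)⁻¹ := by
      rw [← mul_inv, ← Real.sqrt_mul hc₀.le]
      refine inv_anti₀ (Real.sqrt_pos.2 (by positivity)) (Real.sqrt_le_sqrt ?_)
      rw [hLdef]
      have := mul_le_mul_of_nonneg_left h6 h4.le
      linarith
    have hkaL : (k n : ℝ) * (a n * p n) ≤ L := by
      have : (k n : ℝ) * (a n + b n) ≤ n := by exact_mod_cast hkn n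
      have h9 : (k n : ℝ) * a n ≤ n := by
        nlinarith [(Nat.cast_nonneg (k n) : (0 : ℝ) ≤ k n),
          (Nat.cast_nonneg (b n) : (0 : ℝ) ≤ b n)]
      rw [hLdef, ← mul_assoc]; gcongr
    have hLs : √L ^ 2 = L := Real.sq_sqrt h7.le
    have hLsp : 0 < √L := Real.sqrt_pos.2 h7
    -- After the factor k·a·p ≤ L is used, L^(-3/2) leaves L^(-1/2)(1 + √(a³p)). Its two terms are
    -- the square roots of 1/L and a³/n, and p has cancelled from the second.
    have hfin : (√L)⁻¹ * (1 + √((a n : ℝ) ^ 3 * p n)) ≤ 2 * √(ε n) := by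
      have i1 : (√L)⁻¹ ≤ √(ε n) := by
        rw [← Real.sqrt_inv]
        refine Real.sqrt_le_sqrt ?_
        have : 0 ≤ (a n : ℝ) ^ 3 / n := by positivity
        simp only [hε]; linarith
      have i2 : (√L)⁻¹ * √((a n : ℝ) ^ 3 * p n) ≤ √(ε n) := by
        rw [← Real.sqrt_inv, ← Real.sqrt_mul (by positivity)]
        refine Real.sqrt_le_sqrt ?_
        have e : L⁻¹ * ((a n : ℝ) ^ 3 * p n) = (a n : ℝ) ^ 3 / n := by
          rw [hLdef]; field_simp
        have : 0 ≤ L⁻¹ := by positivity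
        rw [e]; simp only [hε]; linarith
      linarith
    set Cc := 2 * D + 8 * (M + 1)
    have hCc : 0 ≤ Cc := by positivity
    have hτ0 : 0 ≤ τ n := by linarith
    calc (k n : ℝ) * ((s n)⁻¹ ^ 3 *
          ∫ ω, |∑ i ∈ Finset.range (a n), (T n (V i ω) - cT n)| ^ 3 ∂P)
        ≤ (k n : ℝ) * (((√c₀)⁻¹ * (√L)⁻¹) ^ 3 *
          (Cc * τ n ^ 3 * (a n * p n) * (1 + √((a n : ℝ) ^ 3 * p n)))) := by
          gcongr
      _ = Cc * (√c₀)⁻¹ ^ 3 * τ n ^ 3 * ((k n : ℝ) * (a n * p n)) * (√L)⁻¹ ^ 2 *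
          ((√L)⁻¹ * (1 + √((a n : ℝ) ^ 3 * p n))) := by ring
      _ ≤ Cc * (√c₀)⁻¹ ^ 3 * τ n ^ 3 * L * (√L)⁻¹ ^ 2 * (2 * √(ε n)) := by
          gcongr
      _ = Cc * (√c₀)⁻¹ ^ 3 * τ n ^ 3 * (L * (√L ^ 2)⁻¹) * (2 * √(ε n)) := by
          rw [inv_pow]; ring
      _ = _ := by rw [hLs, mul_inv_cancel₀ h7.ne']; ring
  have hEU3 : Tendsto (fun n => (k n : ℝ) * ∫ ω, |U n ω| ^ 3 ∂P) atTop (𝓝 0) := by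
    have h0 := hτ3.const_mul ((2 * D + 8 * (M + 1)) * (√c₀)⁻¹ ^ 3 * 2)
    rw [mul_zero] at h0
    refine squeeze_zero' (Eventually.of_forall fun n => ?_) (hU3.mono fun n h => h.2) h0
    exact mul_nonneg (Nat.cast_nonneg _) (integral_nonneg fun ω => by positivity)
  have hEU1 : ∀ᶠ n in atTop, ∫ ω, U n ω ∂P = 0 := by
    filter_upwards [hlocT] with n h1
    have hi := (h1.integral_abs_le hV.measurable).1
    have hij := hV.integrable_comp (hTm n) hi
    simp_rw [hUeq]
    rw [integral_const_mul, integral_finsetSum _ fun i _ => by exact (hij i).sub (integrable_const _)]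
    have : ∀ i, ∫ ω, (T n (V i ω) - cT n) ∂P = 0 := fun i => by
      rw [integral_sub (hij i) (integrable_const _), hV.integral_comp (hTm n) i]; simp [hcT]
    simp [this]
  -- the sum over the blocks
  set W : ℕ → Ω → ℝ := fun n ω => ∑ j ∈ Finset.range (k n), ∑ i ∈ Finset.range (a n),
    g n (V (j * (a n + b n) + i) ω) with hW
  have hWm : ∀ n, Measurable (W n) := fun n => Finset.measurable_sum _ fun j _ =>
    Finset.measurable_sum _ fun i _ => (hgm n).comp (hV.measurable _)
  have hWlim : TendstoInDistribution W atTop id (fun _ => P) (gaussianReal 0 1) := by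
    refine ⟨fun n => (hWm n).aemeasurable, aemeasurable_id, ?_⟩
    refine ProbabilityMeasure.tendsto_iff_tendsto_charFun.2 fun t => ?_
    have hpowlim := tendsto_pow_integral_cexp (P := P) hUm hk hEU1 hUsq (hU3.mono fun n h => h.1)
      hEU2 hEU3 t
    have hdiff : Tendsto (fun n => ∫ ω, Complex.exp ((t * W n ω : ℝ) * Complex.I) ∂P
        - (∫ ω, Complex.exp ((t * U n ω : ℝ) * Complex.I) ∂P) ^ k n) atTop (𝓝 0) := by
      have h0 := hkb.const_mul (16 * C)
      rw [mul_zero] at h0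
      refine squeeze_zero_norm (fun n => ?_) h0
      have := hV.norm_integral_prod_sub_pow_le (hgm n) (a n) (hb1 n) t (k n)
      refine le_trans (le_of_eq ?_) (this.trans (le_of_eq (by ring)))
      congr 3
      ext ω
      rw [← Complex.exp_sum, ← Finset.sum_mul, ← Complex.ofReal_sum, ← Finset.mul_sum]
    have hlim := hdiff.add hpowlim
    rw [zero_add] at hlim
    have e0 : charFun ((gaussianReal 0 1).map id) t = Complex.exp (-(t ^ 2 / 2)) := by
      rw [Measure.map_id, charFun_gaussianReal]; simp
    simp only [ProbabilityMeasure.coe_mk]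
    rw [e0]
    refine hlim.congr fun n => ?_
    rw [charFun_apply_real, integral_map (hWm n).aemeasurable (by fun_prop)]
    simp only [sub_add_cancel]
    push_cast; rfl
  -- the remainder
  refine tendstoInDistribution_of_tendstoInMeasure_sub _ _ hWlim ?_ fun n =>
    ((Finset.measurable_sum _ fun i _ =>
      (hmeas n).comp (hV.measurable i)).const_mul _).aemeasurable
  set R : ℕ → Finset ℕ := fun n => Finset.range n \ blockIndices (a n) (b n) (k n) with hR
  set cR : ℕ → ℝ := fun n => ∫ ω, (f n (V 0 ω) - T n (V 0 ω)) ∂P with hcR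
  -- What separates the full sum from the block sum: the truncation remainders at all times, and the
  -- truncated terms outside the blocks. The two centrings cancel because the untruncated function
  -- has mean zero.
  have hZ : ∀ᶠ n in atTop, ∀ ω,
      (s n)⁻¹ * (∑ i ∈ Finset.range n, f n (V i ω)) - W n ω
      = (s n)⁻¹ * (∑ i ∈ Finset.range n, ((f n (V i ω) - T n (V i ω)) - cR n)
        + ∑ i ∈ R n, (T n (V i ω) - cT n)) := by
    filter_upwards [hmean, hloc, hlocT] with n h1 h2 h3 ω
    have e1 : cR n = - cT n := by
      simp only [hcR, hcT]
      rw [integral_sub (h2.integral_abs_le hV.measurable).1 (h3.integral_abs_le hV.measurable).1, h1]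
      ring
    have e2 : W n ω = (s n)⁻¹ * ∑ i ∈ blockIndices (a n) (b n) (k n), (T n (V i ω) - cT n) := by
      rw [Finset.mul_sum, sum_blockIndices]
    have e3 : ∑ i ∈ R n, (T n (V i ω) - cT n) = ∑ i ∈ Finset.range n, (T n (V i ω) - cT n)
        - ∑ i ∈ blockIndices (a n) (b n) (k n), (T n (V i ω) - cT n) := by
      rw [hR, eq_sub_iff_add_eq, Finset.sum_sdiff (blockIndices_subset (hkn n))]
    have e4 : ∑ i ∈ Finset.range n, ((f n (V i ω) - T n (V i ω)) - cR n)
        + ∑ i ∈ Finset.range n, (T n (V i ω) - cT n) = ∑ i ∈ Finset.range n, f n (V i ω) := by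
      rw [← Finset.sum_add_distrib]
      refine Finset.sum_congr rfl fun i _ => ?_
      rw [e1]; ring
    rw [e2, e3, ← mul_sub, ← e4]; ring
  -- The remainder sum has variance at most n times its second moment plus twice its summed
  -- covariances, all o(np). The terms in the gaps number n - ka = o(n), and for these the uniform
  -- variance bound over arbitrary index sets suffices.
  have hbound : ∀ᶠ n in atTop,
      Integrable (fun ω => ((s n)⁻¹ * (∑ i ∈ Finset.range n, f n (V i ω)) - W n ω) ^ 2) P ∧
      ∫ ω, ((s n)⁻¹ * (∑ i ∈ Finset.range n, f n (V i ω)) - W n ω) ^ 2 ∂P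
        ≤ 2 * c₀⁻¹ * ((∫ ω, (f n (V 0 ω) - T n (V 0 ω)) ^ 2 ∂P) / p n
            + 2 * ((∑' l, |acov P V (fun w => f n w - T n w) (l + 1)|) / p n)
            + D * (1 - (k n : ℝ) * a n / n)) := by
    filter_upwards [hZ, hlocT, hlocR, hsumR, hvar, hppos, hs2, hnpos, hvpos]
      with n h1 h2 h3 h4 h5 h6 h7 h8 h9
    simp_rw [h1]
    obtain ⟨x1, x2⟩ := hDbd _ _ h2 (R n)
    obtain ⟨y1, y2⟩ := hV.integral_sq_sum_centered h3.measurable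
        (h3.integral_sq_le hV.measurable).1 h4 (Finset.range n)
    set X : Ω → ℝ := fun ω => ∑ i ∈ R n, (T n (V i ω) - cT n) with hX
    set Y : Ω → ℝ := fun ω => ∑ i ∈ Finset.range n, ((f n (V i ω) - T n (V i ω)) - cR n) with hY
    have hXm : Measurable X := Finset.measurable_sum _ fun i _ =>
      ((hTm n).comp (hV.measurable i)).sub_const _
    have hYm : Measurable Y := Finset.measurable_sum _ fun i _ =>
      (((hmeas n).comp (hV.measurable i)).sub ((hTm n).comp (hV.measurable i))).sub_const _
    have hi : Integrable (fun ω => (s n)⁻¹ ^ 2 * (2 * Y ω ^ 2 + 2 * X ω ^ 2)) P :=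
      ((y1.const_mul 2).add (x1.const_mul 2)).const_mul _
    have hle : ∀ ω, ((s n)⁻¹ * (Y ω + X ω)) ^ 2 ≤ (s n)⁻¹ ^ 2 * (2 * Y ω ^ 2 + 2 * X ω ^ 2) :=
      fun ω => by
        rw [mul_pow]
        refine mul_le_mul_of_nonneg_left ?_ (sq_nonneg _)
        nlinarith [sq_nonneg (Y ω - X ω)]
    have hInt : Integrable (fun ω => ((s n)⁻¹ * (Y ω + X ω)) ^ 2) P :=
      hi.mono' (((hYm.add hXm).const_mul _).pow_const 2).aestronglyMeasurable
        (ae_of_all _ fun ω => by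
          rw [Real.norm_eq_abs, abs_of_nonneg (sq_nonneg _)]; exact hle ω)
    refine ⟨hInt, (integral_mono hInt hi hle).trans ?_⟩
    rw [integral_const_mul, integral_add (y1.const_mul 2) (x1.const_mul 2), integral_const_mul,
      integral_const_mul, inv_pow, h7]
    have hcard : ((R n).card : ℝ) = n - k n * a n := by
      rw [hR, Finset.card_sdiff_of_subset (blockIndices_subset (hkn n)), card_blockIndices,
        Finset.card_range, Nat.cast_sub]
      · push_cast; ring
      · have := Finset.card_le_card (blockIndices_subset (hkn n))
        rwa [card_blockIndices, Finset.card_range] at this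
    rw [hcard] at x2
    rw [Finset.card_range] at y2
    have y3 := (abs_le.1 y2).2
    have y4 := acov_zero_le P V (fun w => f n w - T n w)
    set Θ := ∑' l, |acov P V (fun w => f n w - T n w) (l + 1)|
    set J := ∫ ω, (f n (V 0 ω) - T n (V 0 ω)) ^ 2 ∂P
    have y5 : ∫ ω, Y ω ^ 2 ∂P ≤ n * (J + 2 * Θ) := by
      have := mul_le_mul_of_nonneg_left y4 h8.le
      linarith
    have hJ : 0 ≤ J := integral_nonneg fun ω => sq_nonneg _
    have hΘ : 0 ≤ Θ := tsum_nonneg fun _ => abs_nonneg _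
    have hR0 : 0 ≤ (n : ℝ) - k n * a n := by rw [← hcard]; exact Nat.cast_nonneg _
    calc ((n : ℝ) * v n)⁻¹ * (2 * (∫ ω, Y ω ^ 2 ∂P) + 2 * ∫ ω, X ω ^ 2 ∂P)
        ≤ ((n : ℝ) * v n)⁻¹ * (2 * (n * (J + 2 * Θ)) + 2 * (D * (n - k n * a n) * p n)) := by
          gcongr
      _ ≤ ((n : ℝ) * (c₀ * p n))⁻¹ *
          (2 * (n * (J + 2 * Θ)) + 2 * (D * (n - k n * a n) * p n)) := by
          have : 0 ≤ 2 * (n * (J + 2 * Θ)) + 2 * (D * (n - k n * a n) * p n) := by positivity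
          gcongr
      _ = _ := by field_simp
  have hlim0 : Tendsto (fun n => 2 * c₀⁻¹ * ((∫ ω, (f n (V 0 ω) - T n (V 0 ω)) ^ 2 ∂P) / p n
            + 2 * ((∑' l, |acov P V (fun w => f n w - T n w) (l + 1)|) / p n)
            + D * (1 - (k n : ℝ) * a n / n))) atTop (𝓝 (2 * c₀⁻¹ * (0 + 2 * 0 + D * (1 - 1)))) :=
    ((hR2.add (htsR.const_mul 2)).add ((tendsto_const_nhds.sub hka).const_mul D)).const_mul _
  simp only [sub_self, mul_zero, add_zero] at hlim0
  refine tendstoInMeasure_of_integral_sq (hbound.mono fun n h => h.1) ?_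
  exact squeeze_zero' (Eventually.of_forall fun n => integral_nonneg fun ω => sq_nonneg _)
    (hbound.mono fun n h => h.2) hlim0

end CLT

/-! ### Linearisation of a ratio -/

section Ratio

variable {Ω : Type*} [MeasurableSpace Ω] {P : Measure Ω} [IsProbabilityMeasure P]

/-- A ratio `N / D` with a concentrated denominator is close in mean to `N / d`. -/
lemma integral_abs_div_sub_div_le {N D : Ω → ℝ} {d L a b c c₁ π ρ : ℝ}
    (hDm : Measurable D) (hL : 0 < L)
    (hc : 0 < c) (hd : c * L ≤ d) (hc₁ : 0 < c₁)
    (hNm : Measurable N) (hND : Integrable (fun ω => N ω / D ω) P)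
    (hN2i : Integrable (fun ω => N ω ^ 2) P) (hN2 : ∫ ω, N ω ^ 2 ∂P ≤ a * L)
    (hD2i : Integrable (fun ω => (D ω - d) ^ 2) P) (hD2 : ∫ ω, (D ω - d) ^ 2 ∂P ≤ b * L)
    (hbad : P.real {ω | D ω < c₁ * d} ≤ π / L)
    (hrest : ∫ ω in {ω | D ω < c₁ * d}, |N ω / D ω| ∂P ≤ ρ / L) :
    Integrable (fun ω => N ω / D ω - N ω / d) P ∧
    ∫ ω, |N ω / D ω - N ω / d| ∂P
      ≤ ((a + b) / (2 * c₁ * c ^ 2) + ρ + (a + π) / (2 * c)) / L := by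
  have hd0 : 0 < d := lt_of_lt_of_le (by positivity) hd
  have hbm : MeasurableSet {ω | D ω < c₁ * d} := measurableSet_lt hDm measurable_const
  set bad := {ω | D ω < c₁ * d} with hbad'
  have hN1i : Integrable N P := integrable_of_integrable_sq hNm.aestronglyMeasurable hN2i
  have hInt : Integrable (fun ω => N ω / D ω - N ω / d) P := hND.sub (hN1i.div_const d)
  have hIb : Integrable (bad.indicator fun _ => (1 : ℝ)) P := (integrable_const _).indicator hbm
  -- Off the bad event N(d - D)/(Dd) is split by 2|uv| ≤ u² + v², with squares of mean O(L) over d²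
  -- of order L². On the bad event |N| is split with weight L, so that N²/L and L times the
  -- indicator both have bounded mean before division by d.
  have hpt : ∀ ω, |N ω / D ω - N ω / d| ≤
      (1 / (2 * c₁ * d ^ 2)) * (N ω ^ 2 + (D ω - d) ^ 2)
        + bad.indicator (fun ω => |N ω / D ω|) ω
        + (1 / (2 * d)) * ((1 / L) * N ω ^ 2 + L * bad.indicator (fun _ => (1 : ℝ)) ω) := by
    intro ω
    by_cases h : ω ∈ bad
    · rw [Set.indicator_of_mem h, Set.indicator_of_mem h]
      have h1 : |N ω / D ω - N ω / d| ≤ |N ω / D ω| + |N ω| / d := by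
        refine (abs_sub _ _).trans ?_
        rw [abs_div (N ω) d, abs_of_pos hd0]
      have h2 : |N ω| / d ≤ (1 / (2 * d)) * ((1 / L) * N ω ^ 2 + L * 1) := by
        have h3 : 2 * |N ω| ≤ (1 / L) * N ω ^ 2 + L * 1 := by
          rw [one_div, inv_mul_eq_div, mul_one, ← sub_le_iff_le_add, le_div_iff₀ hL, ← sq_abs]
          nlinarith [sq_nonneg (|N ω| - L)]
        calc |N ω| / d = (1 / (2 * d)) * (2 * |N ω|) := by field_simp
          _ ≤ _ := by gcongr
      have h4 : 0 ≤ (1 / (2 * c₁ * d ^ 2)) * (N ω ^ 2 + (D ω - d) ^ 2) := by positivity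
      linarith
    · rw [Set.indicator_of_notMem h, Set.indicator_of_notMem h]
      have h1 : c₁ * d ≤ D ω := not_lt.1 h
      have hD : 0 < D ω := lt_of_lt_of_le (by positivity) h1
      have e : N ω / D ω - N ω / d = N ω * (d - D ω) / (D ω * d) := by field_simp
      have h2 : |N ω / D ω - N ω / d| ≤ (1 / (2 * c₁ * d ^ 2)) * (N ω ^ 2 + (D ω - d) ^ 2) := by
        rw [e, abs_div, abs_of_pos (mul_pos hD hd0), one_div, inv_mul_eq_div]
        have h3 : |N ω * (d - D ω)| ≤ (N ω ^ 2 + (D ω - d) ^ 2) / 2 := by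
          rw [abs_le]; constructor <;> nlinarith [sq_nonneg (N ω - (d - D ω)), sq_nonneg (N ω + (d - D ω))]
        calc |N ω * (d - D ω)| / (D ω * d) ≤ ((N ω ^ 2 + (D ω - d) ^ 2) / 2) / (c₁ * d * d) := by
              gcongr
          _ = _ := by field_simp
      have h4 : 0 ≤ (1 / (2 * d)) * ((1 / L) * N ω ^ 2 + L * 0) := by positivity
      linarith
  have i1 : Integrable (fun ω => (1 / (2 * c₁ * d ^ 2)) * (N ω ^ 2 + (D ω - d) ^ 2)) P :=
    (hN2i.add hD2i).const_mul _
  have i2 : Integrable (bad.indicator (fun ω => |N ω / D ω|)) P := hND.abs.indicator hbm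
  have i3' : Integrable (fun ω => (1 / L) * N ω ^ 2 + L * bad.indicator (fun _ => (1 : ℝ)) ω) P :=
    (hN2i.const_mul _).add (hIb.const_mul _)
  have i3 : Integrable (fun ω => (1 / (2 * d)) *
      ((1 / L) * N ω ^ 2 + L * bad.indicator (fun _ => (1 : ℝ)) ω)) P := i3'.const_mul _
  refine ⟨hInt, (integral_mono hInt.abs ((i1.add i2).add i3) hpt).trans ?_⟩
  simp only [Pi.add_apply]
  rw [integral_add (by exact i1.add i2) i3, integral_add i1 i2, integral_const_mul,
    integral_const_mul, integral_add hN2i hD2i, integral_add (hN2i.const_mul _) (hIb.const_mul _),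
    integral_const_mul, integral_const_mul, integral_indicator hbm, integral_indicator hbm]
  simp only [integral_const, MeasurableSet.univ, measureReal_restrict_apply, Set.univ_inter,
    smul_eq_mul, mul_one]
  have ha : 0 ≤ a * L := (integral_nonneg fun ω => sq_nonneg _).trans hN2
  have hb : 0 ≤ b * L := (integral_nonneg fun ω => sq_nonneg _).trans hD2
  have hπ : 0 ≤ π / L := measureReal_nonneg.trans hbad
  have ha' : 0 ≤ a := nonneg_of_mul_nonneg_left ha hL
  have hb' : 0 ≤ b := nonneg_of_mul_nonneg_left hb hL
  have hπ' : 0 ≤ π := by have := mul_nonneg hπ hL.le; rwa [div_mul_cancel₀ _ hL.ne'] at this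
  have t1 : (1 / (2 * c₁ * d ^ 2)) * ((∫ ω, N ω ^ 2 ∂P) + ∫ ω, (D ω - d) ^ 2 ∂P)
      ≤ (a + b) / (2 * c₁ * c ^ 2) / L := by
    calc _ ≤ (1 / (2 * c₁ * (c * L) ^ 2)) * (a * L + b * L) := by gcongr
      _ = _ := by field_simp
  have t3 : (1 / (2 * d)) * ((1 / L) * (∫ ω, N ω ^ 2 ∂P) + L * P.real bad)
      ≤ (a + π) / (2 * c) / L := by
    calc _ ≤ (1 / (2 * (c * L))) * ((1 / L) * (a * L) + L * (π / L)) := by gcongr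
      _ = _ := by field_simp
  have : ((a + b) / (2 * c₁ * c ^ 2) + ρ + (a + π) / (2 * c)) / L
      = (a + b) / (2 * c₁ * c ^ 2) / L + ρ / L + (a + π) / (2 * c) / L := by ring
  rw [this]
  linarith

/-- A ratio `G / D` of concentrated sums, bounded by a constant, is close in mean to the ratio of
the expectations. -/
lemma integral_abs_div_sub_ratio_le {G D : Ω → ℝ} {d e L a b c c₁ π β : ℝ}
    (hD0 : ∀ ω, 0 ≤ D ω) (hDm : Measurable D) (hL : 1 ≤ L)
    (hc : 0 < c) (hd : c * L ≤ d) (hc₁ : 0 < c₁) (hβ : 0 ≤ β)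
    (hGm : Measurable G) (hGD : ∀ ω, |G ω| ≤ β * D ω) (he : |e| ≤ β * d)
    (hG2i : Integrable (fun ω => (G ω - e) ^ 2) P) (hG2 : ∫ ω, (G ω - e) ^ 2 ∂P ≤ a * L)
    (hD2i : Integrable (fun ω => (D ω - d) ^ 2) P) (hD2 : ∫ ω, (D ω - d) ^ 2 ∂P ≤ b * L)
    (hbad : P.real {ω | D ω < c₁ * d} ≤ π / L) :
    Integrable (fun ω => G ω / D ω - e / d) P ∧
    ∫ ω, |G ω / D ω - e / d| ∂P
      ≤ (((a + 1) + β * (b + 1)) / (2 * c₁ * c) + 2 * β * π) / √L := by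
  have hL0 : 0 < L := by linarith
  have hd0 : 0 < d := lt_of_lt_of_le (by positivity) hd
  have hs0 : 0 < √L := Real.sqrt_pos.2 hL0
  have hs2 : √L * √L = L := Real.mul_self_sqrt hL0.le
  have hbm : MeasurableSet {ω | D ω < c₁ * d} := measurableSet_lt hDm measurable_const
  set bad := {ω | D ω < c₁ * d} with hbad'
  have hIb : Integrable (bad.indicator fun _ => (1 : ℝ)) P := (integrable_const _).indicator hbm
  have hratio : ∀ ω, |G ω / D ω| ≤ β := fun ω => by
    rw [abs_div, abs_of_nonneg (hD0 ω)]
    exact div_le_of_le_mul₀ (hD0 ω) hβ (hGD ω)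
  have hed : |e / d| ≤ β := by rw [abs_div, abs_of_pos hd0, div_le_iff₀ hd0]; exact he
  have hInt : Integrable (fun ω => G ω / D ω - e / d) P :=
    (Integrable.of_bound (hGm.div hDm).aestronglyMeasurable β (ae_of_all _ hratio)).sub
      (integrable_const _)
  -- Weight √L balances the two terms when y² has mean of order L; both are then of order √L.
  have habs : ∀ y : ℝ, |y| ≤ (1 / 2) * ((1 / √L) * y ^ 2 + √L) := fun y => by
    have h3 : 2 * |y| ≤ (1 / √L) * y ^ 2 + √L := by
      rw [one_div, inv_mul_eq_div, ← sub_le_iff_le_add, le_div_iff₀ hs0, ← sq_abs]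
      nlinarith [sq_nonneg (|y| - √L)]
    linarith
  have hpt : ∀ ω, |G ω / D ω - e / d| ≤
      (1 / (2 * c₁ * d)) * (((1 / √L) * (G ω - e) ^ 2 + √L)
        + β * ((1 / √L) * (D ω - d) ^ 2 + √L))
        + 2 * β * bad.indicator (fun _ => (1 : ℝ)) ω := by
    intro ω
    have h0 : 0 ≤ (1 / (2 * c₁ * d)) * (((1 / √L) * (G ω - e) ^ 2 + √L)
        + β * ((1 / √L) * (D ω - d) ^ 2 + √L)) := by positivity
    by_cases h : ω ∈ bad
    · rw [Set.indicator_of_mem h]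
      have := (abs_sub (G ω / D ω) (e / d)).trans (add_le_add (hratio ω) hed)
      linarith
    · rw [Set.indicator_of_notMem h]
      have h1 : c₁ * d ≤ D ω := not_lt.1 h
      have hD : 0 < D ω := lt_of_lt_of_le (by positivity) h1
      -- A linear expression in the two centred sums over D, whose coefficient e/d is bounded by β.
      -- Boundedness of both ratios makes the bad event cost only its probability.
      have e1 : G ω / D ω - e / d = ((G ω - e) - (e / d) * (D ω - d)) / D ω := by field_simp; ring
      rw [e1, abs_div, abs_of_pos hD]
      have h2 : |(G ω - e) - (e / d) * (D ω - d)|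
          ≤ (1 / 2) * (((1 / √L) * (G ω - e) ^ 2 + √L) + β * ((1 / √L) * (D ω - d) ^ 2 + √L)) := by
        refine (abs_sub _ _).trans ?_
        rw [abs_mul]
        have h3 := habs (G ω - e)
        have h4 := mul_le_mul hed (habs (D ω - d)) (abs_nonneg _) hβ
        linarith
      calc |(G ω - e) - (e / d) * (D ω - d)| / D ω
          ≤ ((1 / 2) * (((1 / √L) * (G ω - e) ^ 2 + √L)
            + β * ((1 / √L) * (D ω - d) ^ 2 + √L))) / (c₁ * d) := by gcongr
        _ = _ := by field_simp; ring
  have j1 : Integrable (fun ω => (1 / √L) * (G ω - e) ^ 2 + √L) P :=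
    (hG2i.const_mul _).add (integrable_const _)
  have j2 : Integrable (fun ω => β * ((1 / √L) * (D ω - d) ^ 2 + √L)) P :=
    ((hD2i.const_mul _).add (integrable_const _)).const_mul _
  have j3 : Integrable (fun ω => (1 / (2 * c₁ * d)) * (((1 / √L) * (G ω - e) ^ 2 + √L)
        + β * ((1 / √L) * (D ω - d) ^ 2 + √L))) P := (j1.add j2).const_mul _
  have j4 : Integrable (fun ω => 2 * β * bad.indicator (fun _ => (1 : ℝ)) ω) P :=
    hIb.const_mul _
  refine ⟨hInt, (integral_mono hInt.abs (j3.add j4) hpt).trans ?_⟩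
  simp only [Pi.add_apply]
  rw [integral_add j3 j4, integral_const_mul, integral_add j1 j2, integral_const_mul,
    integral_const_mul, integral_add (hG2i.const_mul _) (integrable_const _),
    integral_add (hD2i.const_mul _) (integrable_const _), integral_const_mul, integral_const_mul,
    integral_indicator hbm]
  simp only [integral_const, MeasurableSet.univ, measureReal_restrict_apply, Set.univ_inter,
    smul_eq_mul, mul_one, probReal_univ, one_mul]
  have ha : 0 ≤ a * L := (integral_nonneg fun ω => sq_nonneg _).trans hG2
  have hb : 0 ≤ b * L := (integral_nonneg fun ω => sq_nonneg _).trans hD2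
  have ha' : 0 ≤ a := nonneg_of_mul_nonneg_left ha hL0
  have hb' : 0 ≤ b := nonneg_of_mul_nonneg_left hb hL0
  have hπ : 0 ≤ π / L := measureReal_nonneg.trans hbad
  have hπ' : 0 ≤ π := by have := mul_nonneg hπ hL0.le; rwa [div_mul_cancel₀ _ hL0.ne'] at this
  have hπs : π / L ≤ π / √L := by
    refine div_le_div_of_nonneg_left hπ' hs0 ?_
    have h1 : 1 ≤ √L := Real.one_le_sqrt.2 hL
    nlinarith
  have t1 : (1 / (2 * c₁ * d)) * ((1 / √L * (∫ ω, (G ω - e) ^ 2 ∂P) + √L)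
      + β * (1 / √L * (∫ ω, (D ω - d) ^ 2 ∂P) + √L))
      ≤ ((a + 1) + β * (b + 1)) / (2 * c₁ * c) / √L := by
    calc _ ≤ (1 / (2 * c₁ * (c * L))) * ((1 / √L * (a * L) + √L)
          + β * (1 / √L * (b * L) + √L)) := by gcongr
      _ = (1 / (2 * c₁ * (c * (√L * √L)))) * ((1 / √L * (a * (√L * √L)) + √L)
          + β * (1 / √L * (b * (√L * √L)) + √L)) := by rw [hs2]
      _ = _ := by field_simp
  have t2 : 2 * β * P.real bad ≤ 2 * β * π / √L := by
    rw [mul_div_assoc]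
    exact mul_le_mul_of_nonneg_left (hbad.trans hπs) (by positivity)
  rw [add_div]
  linarith

end Ratio

/-! ### Small values of the denominator -/

section SmallDenominator

variable {Ω : Type*} [MeasurableSpace Ω] {P : Measure Ω} [IsProbabilityMeasure P]
  {E : Type*} [MeasurableSpace E] {V : ℕ → Ω → E} {C κ : ℝ}

/-- Mixing is used twice across a gap m: between the first two events, then between their
intersection and the third. -/
lemma StationaryMixing.measureReal_inter_three_le (hV : StationaryMixing P V C κ) {m : ℕ}
    (hm : 1 ≤ m) {s₀ s₁ s₂ : Set Ω} (h₀ : MeasurableSet[sigmaOf V (Set.Iic m)] s₀)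
    (h₁ : MeasurableSet[sigmaOf V (Set.Icc (2 * m) (3 * m))] s₁)
    (h₂ : MeasurableSet[sigmaOf V (Set.Ici (4 * m))] s₂) {ε : ℝ} (hε : 0 ≤ ε)
    (e₀ : P.real s₀ ≤ ε) (e₁ : P.real s₁ ≤ ε) (e₂ : P.real s₂ ≤ ε) :
    P.real (s₀ ∩ s₁ ∩ s₂) ≤ ε ^ 3 + 2 * (C * (m : ℝ) ^ (-κ)) := by
  have mono : ∀ {S T : Set ℕ}, S ⊆ T → sigmaOf V S ≤ sigmaOf V T := fun hST =>
    biSup_mono hST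
  have a1 := (abs_le.1 (hV.mixing m m hm s₀ s₁ h₀ (mono (fun i hi => by
    simp only [Set.mem_Icc, Set.mem_Ici] at hi ⊢; omega) _ h₁))).2
  have a2 := (abs_le.1 (hV.mixing (3 * m) m hm (s₀ ∩ s₁) s₂
    ((mono (fun i hi => by simp only [Set.mem_Iic] at hi ⊢; omega) _ h₀).inter
      (mono (fun i hi => by simp only [Set.mem_Icc, Set.mem_Iic] at hi ⊢; omega) _ h₁))
    (mono (fun i hi => by simp only [Set.mem_Ici] at hi ⊢; omega) _ h₂))).2
  have hα : 0 ≤ C * (m : ℝ) ^ (-κ) := mul_nonneg hV.nonneg (by positivity)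
  have b1 : P.real s₀ * P.real s₁ ≤ ε * ε :=
    mul_le_mul e₀ e₁ measureReal_nonneg hε
  have b2 : P.real (s₀ ∩ s₁) * P.real s₂ ≤ (ε * ε) * ε + C * (m : ℝ) ^ (-κ) := by
    have c1 : P.real (s₀ ∩ s₁) ≤ ε * ε + C * (m : ℝ) ^ (-κ) := by linarith
    have c2 : P.real s₂ ≤ 1 := measureReal_le_one
    have c3 : 0 ≤ P.real s₂ := measureReal_nonneg
    calc _ ≤ (ε * ε + C * (m : ℝ) ^ (-κ)) * P.real s₂ := by gcongr
      _ = ε * ε * P.real s₂ + C * (m : ℝ) ^ (-κ) * P.real s₂ := by ring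
      _ ≤ _ := add_le_add (mul_le_mul_of_nonneg_left e₂ (by positivity))
          (mul_le_of_le_one_right hα c2)
  nlinarith

/-- A sum of non-negative localized functions is much smaller than its expectation only with a
small probability. -/
lemma exists_measureReal_sum_lt_le {ζ : ℝ} (P : Measure Ω) [IsProbabilityMeasure P]
    (V : ℕ → Ω → E) (M B c : ℝ) (hB : 0 ≤ B) (hc : 0 < c) (hζ : 0 < ζ) (hκ : 2 + 4 / ζ < κ)
    (hV : StationaryMixing P V C κ) :
    ∃ D : ℝ, 0 < D ∧ ∀ (A : Set E) (g : E → ℝ), Localized P V ζ M B A g → (∀ v, 0 ≤ g v) →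
      0 < P.real {ω | V 0 ω ∈ A} → c * P.real {ω | V 0 ω ∈ A} ≤ ∫ ω, g (V 0 ω) ∂P →
      ∀ n : ℕ, 6 ≤ n →
        P.real {ω | ∑ i ∈ Finset.range n, g (V i ω) < 1 / 24 * (n * ∫ ω, g (V 0 ω) ∂P)}
          ≤ D * ((((n : ℝ) * P.real {ω | V 0 ω ∈ A}) ^ 3)⁻¹ + (n : ℝ) ^ (-κ)) := by
  obtain ⟨D₀, hD₀, hbd⟩ := exists_integral_sq_sum_le P V M B hB hζ hκ hV
  have hκ0 : 0 < κ := by have : 0 < 4 / ζ := by positivity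
                         linarith
  refine ⟨(48 * D₀ / c ^ 2) ^ 3 + 2 * C * 12 ^ κ, ?_, ?_⟩
  · have := hV.nonneg; positivity
  intro A g hg hg0 hp hmean n hn
  set p := P.real {ω | V 0 ω ∈ A} with hpdef
  set μ := ∫ ω, g (V 0 ω) ∂P with hμ
  have hμ0 : 0 < μ := lt_of_lt_of_le (by positivity) hmean
  -- Three blocks of length m separated by gaps m fit into n. As n ≥ 6 gives n ≤ 12m, the threshold
  -- nμ/24 is at most half the mean mμ of a single block.
  set m := n / 6 with hm
  have hm1 : 1 ≤ m := by omega
  have hm6 : 6 * m ≤ n := Nat.mul_div_le n 6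
  have hm12 : n ≤ 12 * m := by omega
  have hm12' : (n : ℝ) ≤ 12 * m := by exact_mod_cast hm12
  have hm0 : (0 : ℝ) < m := by exact_mod_cast hm1
  have hn0 : (0 : ℝ) < n := by exact_mod_cast (by omega : 0 < n)
  set s : Finset ℕ → Set Ω := fun S => {ω | ∑ i ∈ S, g (V i ω) < m * μ / 2} with hs
  have hcheb : ∀ S : Finset ℕ, S.card = m → P.real (s S) ≤ 48 * D₀ / c ^ 2 / (n * p) := by
    intro S hS
    obtain ⟨h1, h2⟩ := hbd A g hg S
    have hsub : s S ⊆ {ω | (m * μ / 2) ^ 2 ≤ (∑ i ∈ S, (g (V i ω) - μ)) ^ 2} := by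
      intro ω hω
      simp only [hs, Set.mem_ofPred_eq] at hω ⊢
      rw [Finset.sum_sub_distrib, Finset.sum_const, hS, nsmul_eq_mul]
      have : m * μ / 2 ≤ m * μ - ∑ i ∈ S, g (V i ω) := by linarith
      nlinarith [mul_pos hm0 hμ0]
    have h3 := mul_meas_ge_le_integral_of_nonneg
      (ae_of_all P fun ω => sq_nonneg (∑ i ∈ S, (g (V i ω) - μ))) h1 ((m * μ / 2) ^ 2)
    have h4 := measureReal_mono (μ := P) hsub
    rw [hS] at h2
    have h5 : (m * μ / 2) ^ 2 * P.real (s S) ≤ D₀ * m * p :=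
      (mul_le_mul_of_nonneg_left h4 (sq_nonneg _)).trans (h3.trans h2)
    have h6 : (m * (c * p) / 2) ^ 2 * P.real (s S) ≤ D₀ * m * p :=
      le_trans (mul_le_mul_of_nonneg_right (by gcongr) measureReal_nonneg) h5
    rw [div_div, le_div_iff₀ (by positivity)]
    have h7 : (m : ℝ) * p * (c ^ 2 * (m * p) * P.real (s S)) ≤ m * p * (4 * D₀) := by
      have e : (m * (c * p) / 2) ^ 2 * P.real (s S)
        = m * p * (c ^ 2 * (m * p) * P.real (s S)) / 4 := by ring
      rw [e] at h6; linarith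
    have h8 := le_of_mul_le_mul_left h7 (by positivity)
    have hq : 0 ≤ P.real (s S) := measureReal_nonneg
    have h9 : P.real (s S) * (c ^ 2 * (n * p)) ≤ P.real (s S) * (c ^ 2 * (12 * m * p)) := by
      gcongr
    linarith
  -- Since the summands are non-negative, a small total forces each of the three block sums below
  -- half its mean. Chebyshev bounds each of these events by a multiple of 1/(np), and
  -- near-independence cubes the bound.
  have hsub : {ω | ∑ i ∈ Finset.range n, g (V i ω) < 1 / 24 * (n * μ)}
      ⊆ s (Finset.Ico 0 m) ∩ s (Finset.Ico (2 * m) (3 * m)) ∩ s (Finset.Ico (4 * m) (5 * m)) := by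
    intro ω hω
    have h1 : ∑ i ∈ Finset.range n, g (V i ω) < m * μ / 2 := by
      refine lt_of_lt_of_le hω ?_
      nlinarith
    have h2 : ∀ x y : ℕ, y ≤ n → ω ∈ s (Finset.Ico x y) := fun x y hy => by
      refine lt_of_le_of_lt (Finset.sum_le_sum_of_subset_of_nonneg ?_ fun i _ _ => hg0 _) h1
      intro i hi; rw [Finset.mem_Ico] at hi; rw [Finset.mem_range]; omega
    exact ⟨⟨h2 _ _ (by omega), h2 _ _ (by omega)⟩, h2 _ _ (by omega)⟩
  have hmeas : ∀ (S : Finset ℕ) (T : Set ℕ), (∀ i ∈ S, i ∈ T) → MeasurableSet[sigmaOf V T] (s S) := by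
    intro S T hST
    have : Measurable[sigmaOf V T] fun ω => ∑ i ∈ S, g (V i ω) :=
      Finset.measurable_sum _ fun i hi => hg.measurable.comp (measurable_sigmaOf (hST i hi))
    exact this measurableSet_Iio
  refine (measureReal_mono hsub).trans ?_
  refine (hV.measureReal_inter_three_le hm1 (ε := 48 * D₀ / c ^ 2 / (n * p))
    (hmeas _ _ fun i hi => ?_) (hmeas _ _ fun i hi => ?_) (hmeas _ _ fun i hi => ?_)
    (by positivity) (hcheb _ (by simp)) (hcheb _ (by simp; omega))
    (hcheb _ (by simp; omega))).trans ?_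
  · rw [Finset.mem_Ico] at hi; simp only [Set.mem_Iic]; omega
  · rw [Finset.mem_Ico] at hi; simp only [Set.mem_Icc]; omega
  · rw [Finset.mem_Ico] at hi; simp only [Set.mem_Ici]; omega
  have hmκ : (m : ℝ) ^ (-κ) ≤ 12 ^ κ * (n : ℝ) ^ (-κ) := by
    have h1 : (n : ℝ) / 12 ≤ m := by linarith
    have h2 := Real.rpow_le_rpow_of_nonpos (by positivity) h1 (show -κ ≤ 0 by linarith)
    refine h2.trans (le_of_eq ?_)
    rw [Real.div_rpow hn0.le (by norm_num), Real.rpow_neg (by norm_num : (0 : ℝ) ≤ 12), div_inv_eq_mul,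
      mul_comm]
  have hC := hV.nonneg
  have x1 : 0 ≤ ((n * p) ^ 3)⁻¹ := by positivity
  have x2 : 0 ≤ (n : ℝ) ^ (-κ) := by positivity
  have e1 : (48 * D₀ / c ^ 2 / (n * p)) ^ 3 = (48 * D₀ / c ^ 2) ^ 3 * ((n * p) ^ 3)⁻¹ := by
    rw [div_pow, div_eq_mul_inv]
  rw [e1]
  have h5 : 2 * (C * (m : ℝ) ^ (-κ)) ≤ 2 * C * 12 ^ κ * (n : ℝ) ^ (-κ) := by
    have := mul_le_mul_of_nonneg_left hmκ hC
    linarith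
  have y1 : 0 ≤ (48 * D₀ / c ^ 2) ^ 3 * (n : ℝ) ^ (-κ) := by positivity
  have y2 : 0 ≤ 2 * C * 12 ^ κ * ((n * p) ^ 3)⁻¹ := by positivity
  nlinarith

end SmallDenominator

/-! ### Kernels and cuboids -/

section Kernel

variable {q : ℕ} {K : (Fin q → ℝ) → ℝ}

lemma IsKernel.le_apply_zero (hK : IsKernel K) {w : Fin q → ℝ} (hw : ∀ j, 0 ≤ w j) :
    K w ≤ K 0 :=
  hK.antitoneOn (by simp) hw hw

lemma IsKernel.apply_le_one (hK : IsKernel K) {w : Fin q → ℝ} (hKw : K w ≠ 0) (j : Fin q) :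
    w j ≤ 1 := by
  rcases hK.support with h | h
  · exact (h.2 hKw).2 j
  · exact (h hKw).2 j

/-- If the kernel vanished at all positive points of the diagonal, monotonicity would make it vanish
on the open orthant. Evenness or the support condition would extend this off the coordinate
hyperplanes, a null set, contradicting total mass one. -/
lemma IsKernel.exists_pos (hK : IsKernel K) :
    ∃ t₀ : ℝ, 0 < t₀ ∧ ∀ t, 0 ≤ t → t ≤ t₀ → 0 < K fun _ => t := by
  obtain ⟨t₀, ht₀, hpos⟩ : ∃ t₀ : ℝ, 0 < t₀ ∧ 0 < K fun _ => t₀ := by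
    by_contra! hne
    have key : ∀ w : Fin q → ℝ, (∀ j, 0 < w j) → K w = 0 := by
      intro w hw
      obtain ⟨t, ht, ht0⟩ : ∃ t : ℝ, (∀ j, t ≤ w j) ∧ 0 < t := by
        have h1 : ∀ᶠ t in 𝓝[>] (0 : ℝ), ∀ j, t ≤ w j := by
          refine eventually_all.2 fun j => ?_
          exact nhdsWithin_le_nhds (eventually_le_nhds (hw j))
        exact (h1.and self_mem_nhdsWithin).exists
      refine le_antisymm ?_ (hK.nonneg w)
      exact (hK.antitoneOn (fun _ => ht0.le) (fun j => (hw j).le) ht).trans (hne t ht0)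
    have hae : K =ᵐ[volume] 0 := by
      have h0 : ∀ᵐ w : Fin q → ℝ, ∀ j, w j ≠ 0 := by
        refine ae_all_iff.2 fun j => ?_
        have := Measure.pi_hyperplane (fun _ : Fin q => (volume : Measure ℝ)) j 0
        rw [ae_iff]
        simpa [volume_pi] using this
      filter_upwards [h0] with w hw
      rcases hK.support with h | h
      · rw [← h.1 w]
        exact key _ fun j => abs_pos.2 (hw j)
      · by_contra hne0
        exact hne0 (key w fun j => lt_of_le_of_ne ((h hne0).1 j) (hw j).symm)
    have h1 := hK.integral_eq_one
    rw [integral_congr_ae hae] at h1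
    simp at h1
  exact ⟨t₀, ht₀, fun t h0 h1 => hpos.trans_le
    (hK.antitoneOn (fun _ => h0) (fun _ => ht₀.le) fun _ => h1)⟩

variable {Ξ : Fin q → Type*} [∀ l, PseudoMetricSpace (Ξ l)] {x : ∀ l, Ξ l} {h : Fin q → ℝ}

lemma scaledDist_nonneg (hh : ∀ l, 0 < h l) (z : ∀ l, Ξ l) (l : Fin q) :
    0 ≤ scaledDist x h z l :=
  mul_nonneg (inv_nonneg.2 (hh l).le) dist_nonneg

lemma IsKernel.mem_cuboid (hK : IsKernel K) (hh : ∀ l, 0 < h l) {z : ∀ l, Ξ l}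
    (hz : K (scaledDist x h z) ≠ 0) : z ∈ cuboid x h := by
  intro l
  have := hK.apply_le_one hz l
  rw [scaledDist, inv_mul_le_iff₀ (hh l), mul_one] at this
  rwa [dist_comm]

lemma IsKernel.le_apply_scaledDist (hK : IsKernel K) (hh : ∀ l, 0 < h l) {t : ℝ} (ht : 0 ≤ t)
    {z : ∀ l, Ξ l} (hz : z ∈ cuboid x (t • h)) : K (fun _ => t) ≤ K (scaledDist x h z) := by
  refine hK.antitoneOn (fun l => scaledDist_nonneg hh z l) (fun _ => ht) fun l => ?_
  change (h l)⁻¹ * dist (x l) (z l) ≤ t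
  rw [inv_mul_le_iff₀ (hh l), dist_comm, mul_comm]
  exact hz l

lemma cuboid_mono {h' : Fin q → ℝ} (hh : h ≤ h') : cuboid x h ⊆ cuboid x h' :=
  fun _ hz l => (hz l).trans (hh l)

lemma eventually_cuboid_subset {h : ℕ → Fin q → ℝ}
    (hzero : ∀ l, Tendsto (fun n => h n l) atTop (𝓝 0)) {U : Set (∀ l, Ξ l)} (hU : U ∈ 𝓝 x) :
    ∀ᶠ n in atTop, cuboid x (h n) ⊆ U := by
  obtain ⟨ε, hε, hball⟩ := Metric.mem_nhds_iff.1 hU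
  have : ∀ᶠ n in atTop, ∀ l, h n l < ε :=
    eventually_all.2 fun l => (hzero l).eventually_lt_const hε
  filter_upwards [this] with n hn z hz
  exact hball ((dist_pi_lt_iff hε).2 fun l => (hz l).trans_lt (hn l))

lemma eventually_bandwidth_le {h : ℕ → Fin q → ℝ} (hpos : ∀ n l, 0 < h n l)
    (hzero : ∀ l, Tendsto (fun n => h n l) atTop (𝓝 0)) {H : ℝ} (hH : 0 < H) :
    ∀ᶠ n in atTop, ∀ l, 0 < h n l ∧ h n l ≤ H :=
  eventually_all.2 fun l => ((hzero l).eventually_le_const hH).mono fun n hn => ⟨hpos n l, hn⟩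

variable [∀ l, MeasurableSpace (Ξ l)]

/-- Under either alternative assumption a fixed proportion of the mass of a small cuboid lies where
the kernel is bounded away from zero. -/
lemma IsKernel.exists_le_cuboid_smul (hK : IsKernel K) (μ : Measure (∀ l, Ξ l))
    (halt : IsTypeI K ∨ SmallCubeDoubling μ x) :
    ∃ t c H : ℝ, 0 < t ∧ 0 < K (fun _ => t) ∧ 0 < c ∧ 0 < H ∧
      ∀ h : Fin q → ℝ, (∀ l, 0 < h l ∧ h l ≤ H) →
        c * μ.real (cuboid x h) ≤ μ.real (cuboid x (t • h)) := by
  rcases halt with h1 | ⟨ε, C, H, hε, hε1, hC, hH, hdbl⟩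
  · exact ⟨1, 1, 1, one_pos, h1, one_pos, one_pos, fun h _ => by simp⟩
  · obtain ⟨t₀, ht₀, hpos⟩ := hK.exists_pos
    -- The doubling condition is iterated j times, until the shrunken cuboid lies where the kernel
    -- is known to be positive.
    obtain ⟨j, hj⟩ := exists_pow_lt_of_lt_one ht₀ hε1
    have hC0 : 0 < C := one_pos.trans hC
    refine ⟨ε ^ j, C⁻¹ ^ j, H, pow_pos hε j, hpos _ (pow_nonneg hε.le j) hj.le, by positivity, hH,
      fun h hh => ?_⟩
    have key : ∀ i : ℕ, C⁻¹ ^ i * μ.real (cuboid x h) ≤ μ.real (cuboid x (ε ^ i • h)) := by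
      intro i
      induction i with
      | zero => simp
      | succ i ih =>
        have hsmall : ∀ l, 0 < (ε ^ i • h) l ∧ (ε ^ i • h) l ≤ H := fun l => by
          have h1 : ε ^ i ≤ 1 := pow_le_one₀ hε.le hε1.le
          simp only [Pi.smul_apply, smul_eq_mul]
          refine ⟨mul_pos (pow_pos hε i) (hh l).1, le_trans ?_ (hh l).2⟩
          exact mul_le_of_le_one_left (hh l).1.le h1
        have h2 := (hdbl _ hsmall).le
        rw [smul_smul, ← pow_succ'] at h2
        have h3 := ih.trans h2
        rw [pow_succ', mul_assoc, inv_mul_le_iff₀ hC0]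
        exact h3
    exact key j

variable [∀ l, OpensMeasurableSpace (Ξ l)]

lemma measurableSet_cuboid (x : ∀ l, Ξ l) (h : Fin q → ℝ) : MeasurableSet (cuboid x h) := by
  have : cuboid x h = ⋂ l, (fun z : ∀ l, Ξ l => z l) ⁻¹' Metric.closedBall (x l) (h l) := by
    ext z; simp [cuboid]
  rw [this]
  exact MeasurableSet.iInter fun l => measurable_pi_apply l Metric.isClosed_closedBall.measurableSet

lemma measurable_scaledDist (x : ∀ l, Ξ l) (h : Fin q → ℝ) : Measurable (scaledDist x h) := by
  refine measurable_pi_lambda _ fun l => ?_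
  have : Measurable fun y : Ξ l => (h l)⁻¹ * dist (x l) y := by
    have : Continuous fun y : Ξ l => (h l)⁻¹ * dist (x l) y := by fun_prop
    exact this.measurable
  exact this.comp (measurable_pi_apply l)

lemma IsKernel.measurable_scaledDist (hK : IsKernel K) (x : ∀ l, Ξ l) (h : Fin q → ℝ) :
    Measurable fun z => K (scaledDist x h z) :=
  hK.measurable.comp (NW.measurable_scaledDist x h)

end Kernel

/-! ### Consequences of the assumptions on the data -/

section Data

variable {Ω : Type*} [MeasurableSpace Ω] {P : Measure Ω} [IsProbabilityMeasure P]

lemma integral_mul_condExp_comap {F : Type*} [MeasurableSpace F] {X : Ω → F} (hX : Measurable X)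
    {φ : F → ℝ} (hφ : Measurable φ) {c : ℝ} (hc : ∀ z, |φ z| ≤ c) {Z : Ω → ℝ}
    (hZ : Integrable Z P) :
    ∫ ω, φ (X ω) * Z ω ∂P
      = ∫ ω, φ (X ω) * (P[Z | MeasurableSpace.comap X inferInstance]) ω ∂P := by
  have hle := hX.comap_le
  have hm : StronglyMeasurable[MeasurableSpace.comap X inferInstance] fun ω => φ (X ω) :=
    (hφ.comp (comap_measurable X)).stronglyMeasurable
  have h1 := condExp_stronglyMeasurable_mul_of_bound hle hm hZ c (ae_of_all _ fun ω => hc (X ω))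
  rw [← integral_condExp hle]
  exact integral_congr_ae h1

variable {q : ℕ} {Ξ : Fin q → Type*} [∀ l, PseudoMetricSpace (Ξ l)] [∀ l, MeasurableSpace (Ξ l)]

/-- The observations `(Y_i, X_i)`. -/
def obs (Y : ℕ → Ω → ℝ) (X : ℕ → Ω → ∀ l, Ξ l) (i : ℕ) (ω : Ω) : ℝ × ∀ l, Ξ l :=
  (Y i ω, X i ω)

/-- The residual as a function of an observation. -/
def resid (m : (∀ l, Ξ l) → ℝ) (v : ℝ × ∀ l, Ξ l) : ℝ := v.1 - m v.2

/-- The kernel weight of an observation. -/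
def weight (K : (Fin q → ℝ) → ℝ) (x : ∀ l, Ξ l) (h : Fin q → ℝ) (v : ℝ × ∀ l, Ξ l) : ℝ :=
  K (scaledDist x h v.2)

/-- The observations whose regressor lies in the cuboid. -/
def slab (x : ∀ l, Ξ l) (h : Fin q → ℝ) : Set (ℝ × ∀ l, Ξ l) := {v | v.2 ∈ cuboid x h}

/-- The probability of the cuboid. -/
def cubeProb (P : Measure Ω) (X : ℕ → Ω → ∀ l, Ξ l) (x : ∀ l, Ξ l) (h : Fin q → ℝ) : ℝ :=
  P.real {ω | X 0 ω ∈ cuboid x h}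

variable {Y : ℕ → Ω → ℝ} {X : ℕ → Ω → ∀ l, Ξ l} {m μ₂ : (∀ l, Ξ l) → ℝ} {x : ∀ l, Ξ l} {ζ : ℝ}
  {K : (Fin q → ℝ) → ℝ} {h : Fin q → ℝ}

lemma measurable_resid (hm : Measurable m) : Measurable (resid m) :=
  measurable_fst.sub (hm.comp measurable_snd)

lemma DataAssumptions.exists_stationaryMixing (hd : DataAssumptions P Y X m μ₂ x ζ) :
    ∃ C κ : ℝ, 2 + 4 / ζ < κ ∧ StationaryMixing P (obs Y X) C κ := by
  obtain ⟨C, κ, hκ, hα⟩ := hd.mixing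
  have hζ := hd.zeta_pos
  refine ⟨C, κ, ?_, fun i => (hd.measurable_Y i).prodMk (hd.measurable_X i), hd.stationary, ?_,
    fun t l hl A B hA hB => ?_⟩
  · convert hκ using 1
    field_simp
    ring
  -- At l = 1 the power equals 1, so the constant exceeds a mixing coefficient, which is
  -- non-negative.
  · have h1 := hα 1 le_rfl
    have h0 := alphaMixing_strongMixingCoeff P (obs Y X) 0 1 ∅ ∅
      (@MeasurableSet.empty _ (sigmaOf (obs Y X) (Set.Iic 0)))
      (@MeasurableSet.empty _ (sigmaOf (obs Y X) (Set.Ici (0 + 1))))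
    have h2 : 0 ≤ strongMixingCoeff P (obs Y X) 1 := (abs_nonneg _).trans h0
    have h3 := h2.trans_lt h1
    simp at h3
    exact h3.le
  · exact (alphaMixing_strongMixingCoeff P (obs Y X) t l A B hA hB).trans (hα l hl).le

lemma DataAssumptions.memLp_Y (hd : DataAssumptions P Y X m μ₂ x ζ) (i : ℕ) :
    MemLp (Y i) (ENNReal.ofReal (2 + ζ)) P := by
  have hζ := hd.zeta_pos
  rw [← integrable_norm_rpow_iff (hd.measurable_Y i).aestronglyMeasurable (by simp; linarith)
    (by simp), ENNReal.toReal_ofReal (by linarith)]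
  exact hd.moment_Y i

lemma DataAssumptions.integrable_Y (hd : DataAssumptions P Y X m μ₂ x ζ) (i : ℕ) :
    Integrable (Y i) P := by
  have hζ := hd.zeta_pos
  refine memLp_one_iff_integrable.1 ((hd.memLp_Y i).mono_exponent ?_)
  rw [ENNReal.one_le_ofReal]; linarith

/-- The regression function of X is a conditional expectation of Y and conditional expectation
contracts L^(2+ζ) norms, so m(X), and with it the error, inherits the moment of Y. -/
lemma DataAssumptions.memLp_err (hd : DataAssumptions P Y X m μ₂ x ζ) (i : ℕ) :
    MemLp (err Y X m i) (ENNReal.ofReal (2 + ζ)) P := by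
  have hζ := hd.zeta_pos
  refine (hd.memLp_Y i).sub (MemLp.ae_eq (hd.condExp_Y i) ?_)
  refine (hd.memLp_Y i).condExp ?_
  rw [ENNReal.one_le_ofReal]; linarith

lemma DataAssumptions.integrable_err_rpow (hd : DataAssumptions P Y X m μ₂ x ζ) (i : ℕ) :
    Integrable (fun ω => |err Y X m i ω| ^ (2 + ζ)) P := by
  have hζ := hd.zeta_pos
  have h1 := (integrable_norm_rpow_iff (hd.memLp_err i).1 (by simp; linarith) (by simp)).2
    (hd.memLp_err i)
  rwa [ENNReal.toReal_ofReal (by linarith)] at h1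

lemma DataAssumptions.integrable_err_sq (hd : DataAssumptions P Y X m μ₂ x ζ) (i : ℕ) :
    Integrable (fun ω => err Y X m i ω ^ 2) P := by
  have hζ := hd.zeta_pos
  refine ((hd.memLp_err i).mono_exponent ?_).integrable_sq
  rw [show (2 : ENNReal) = ENNReal.ofReal 2 by simp]
  exact ENNReal.ofReal_le_ofReal (by linarith)

lemma DataAssumptions.integrable_err (hd : DataAssumptions P Y X m μ₂ x ζ) (i : ℕ) :
    Integrable (err Y X m i) P := by
  have hζ := hd.zeta_pos
  refine memLp_one_iff_integrable.1 ((hd.memLp_err i).mono_exponent ?_)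
  rw [ENNReal.one_le_ofReal]; linarith

lemma DataAssumptions.integral_mul_err (hd : DataAssumptions P Y X m μ₂ x ζ)
    {φ : (∀ l, Ξ l) → ℝ} (hφ : Measurable φ) {c : ℝ} (hc : ∀ z, |φ z| ≤ c) :
    ∫ ω, φ (X 0 ω) * err Y X m 0 ω ∂P = 0 := by
  have hY := hd.integrable_Y 0
  have hmX : Integrable (fun ω => m (X 0 ω)) P :=
    (integrable_condExp (f := Y 0)).congr (hd.condExp_Y 0)
  have hφX : AEStronglyMeasurable (fun ω => φ (X 0 ω)) P :=
    (hφ.comp (hd.measurable_X 0)).aestronglyMeasurable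
  have e : ∀ ω, φ (X 0 ω) * err Y X m 0 ω = φ (X 0 ω) * Y 0 ω - φ (X 0 ω) * m (X 0 ω) :=
    fun ω => by rw [err]; ring
  simp_rw [e]
  rw [integral_sub (hY.bdd_mul hφX (ae_of_all _ fun ω => hc _))
    (hmX.bdd_mul hφX (ae_of_all _ fun ω => hc _)),
    integral_mul_condExp_comap (hd.measurable_X 0) hφ hc hY, sub_eq_zero]
  refine integral_congr_ae ?_
  filter_upwards [hd.condExp_Y 0] with ω hω
  rw [hω]

lemma DataAssumptions.integrable_μ₂ (hd : DataAssumptions P Y X m μ₂ x ζ) :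
    Integrable (fun ω => μ₂ (X 0 ω)) P :=
  integrable_condExp.congr (hd.condExp_err_sq 0)

lemma DataAssumptions.integral_mul_err_sq (hd : DataAssumptions P Y X m μ₂ x ζ)
    {φ : (∀ l, Ξ l) → ℝ} (hφ : Measurable φ) {c : ℝ} (hc : ∀ z, |φ z| ≤ c) :
    ∫ ω, φ (X 0 ω) * err Y X m 0 ω ^ 2 ∂P = ∫ ω, φ (X 0 ω) * μ₂ (X 0 ω) ∂P := by
  rw [integral_mul_condExp_comap (hd.measurable_X 0) hφ hc (hd.integrable_err_sq 0)]
  refine integral_congr_ae ?_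
  filter_upwards [hd.condExp_err_sq 0] with ω hω
  rw [hω]

/-- A local moment bound for the errors. -/
lemma DataAssumptions.exists_setIntegral_err_rpow_le (hd : DataAssumptions P Y X m μ₂ x ζ) :
    ∃ Mu : ℝ, 0 ≤ Mu ∧ ∃ U ∈ 𝓝 x, ∀ S ⊆ U, MeasurableSet S →
      ∫ ω in {ω | X 0 ω ∈ S}, |err Y X m 0 ω| ^ (2 + ζ) ∂P ≤ Mu * P.real {ω | X 0 ω ∈ S} := by
  obtain ⟨M, U, hU, hM⟩ := hd.moment_err
  refine ⟨|M|, abs_nonneg _, U, hU, fun S hSU hS => ?_⟩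
  have hXm := hd.measurable_X 0
  have hset : MeasurableSet[MeasurableSpace.comap (X 0) inferInstance] {ω | X 0 ω ∈ S} :=
    ⟨S, hS, rfl⟩
  have hi := hd.integrable_err_rpow 0
  rw [← setIntegral_condExp hXm.comap_le hi hset]
  calc _ ≤ ∫ ω in {ω | X 0 ω ∈ S}, |M| ∂P := by
        refine setIntegral_mono_on_ae integrable_condExp.integrableOn (by simp) (hXm hS) ?_
        filter_upwards [hM 0] with ω hω hωS
        exact (hω (hSU hωS)).trans (le_abs_self M)
    _ = _ := by simp [mul_comm]

variable [∀ l, OpensMeasurableSpace (Ξ l)]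

lemma measurableSet_slab (x : ∀ l, Ξ l) (h : Fin q → ℝ) : MeasurableSet (slab x h) :=
  measurable_snd (measurableSet_cuboid x h)

lemma IsKernel.measurable_weight (hK : IsKernel K) (x : ∀ l, Ξ l) (h : Fin q → ℝ) :
    Measurable (weight K x h) :=
  (hK.measurable_scaledDist x h).comp measurable_snd

lemma IsKernel.weight_eq_zero (hK : IsKernel K) (hh : ∀ l, 0 < h l) {v : ℝ × ∀ l, Ξ l}
    (hv : v ∉ slab x h) : weight K x h v = 0 := by
  by_contra hne
  exact hv (hK.mem_cuboid hh hne)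

lemma IsKernel.weight_le (hK : IsKernel K) (hh : ∀ l, 0 < h l) (v : ℝ × ∀ l, Ξ l) :
    weight K x h v ≤ K 0 :=
  hK.le_apply_zero fun l => scaledDist_nonneg hh _ l

lemma measureReal_map_cuboid (hX : Measurable (X 0)) (x : ∀ l, Ξ l) (h : Fin q → ℝ) :
    (P.map (X 0)).real (cuboid x h) = cubeProb P X x h :=
  map_measureReal_apply hX (measurableSet_cuboid x h)

lemma IsKernel.integrable_weight_pow (hK : IsKernel K) (hX : Measurable (X 0))
    (hpos : ∀ l, 0 < h l) (s : ℕ) :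
    Integrable (fun ω => K (scaledDist x h (X 0 ω)) ^ s) P := by
  refine Integrable.of_bound (C := K 0 ^ s)
    (((hK.measurable_scaledDist x h).comp hX).pow_const s).aestronglyMeasurable
    (ae_of_all _ fun ω => ?_)
  rw [Real.norm_eq_abs, abs_of_nonneg (pow_nonneg (hK.nonneg _) s)]
  exact pow_le_pow_left₀ (hK.nonneg _)
    (hK.le_apply_zero fun l => scaledDist_nonneg hpos _ l) s

/-- Bounds for the moments of the kernel weights. -/
lemma IsKernel.exists_le_integral_pow (hK : IsKernel K) (hX : Measurable (X 0))
    (halt : IsTypeI K ∨ SmallCubeDoubling (P.map (X 0)) x) (s : ℕ) :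
    ∃ c H : ℝ, 0 < c ∧ 0 < H ∧ ∀ h : Fin q → ℝ, (∀ l, 0 < h l ∧ h l ≤ H) →
      c * cubeProb P X x h ≤ ∫ ω, K (scaledDist x h (X 0 ω)) ^ s ∂P := by
  obtain ⟨t, c, H, ht, hKt, hc, hH, hle⟩ := hK.exists_le_cuboid_smul _ halt
  refine ⟨K (fun _ => t) ^ s * c, H, by positivity, hH, fun h hh => ?_⟩
  have h1 := hle h hh
  rw [measureReal_map_cuboid hX, measureReal_map_cuboid hX] at h1
  have hpos : ∀ l, 0 < h l := fun l => (hh l).1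
  have hset : MeasurableSet {ω | X 0 ω ∈ cuboid x (t • h)} := hX (measurableSet_cuboid _ _)
  have hInt : Integrable (fun ω => K (scaledDist x h (X 0 ω)) ^ s) P :=
    hK.integrable_weight_pow hX hpos s
  calc K (fun _ => t) ^ s * c * cubeProb P X x h
      = K (fun _ => t) ^ s * (c * cubeProb P X x h) := by ring
    _ ≤ K (fun _ => t) ^ s * cubeProb P X x (t • h) := by gcongr
    _ = ∫ ω in {ω | X 0 ω ∈ cuboid x (t • h)}, K (fun _ => t) ^ s ∂P := by
        simp [cubeProb, mul_comm]
    _ ≤ ∫ ω in {ω | X 0 ω ∈ cuboid x (t • h)}, K (scaledDist x h (X 0 ω)) ^ s ∂P := by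
        refine setIntegral_mono_on (by simp) hInt.integrableOn hset fun ω hω => ?_
        exact pow_le_pow_left₀ hKt.le (hK.le_apply_scaledDist hpos ht.le hω) s
    _ ≤ _ := setIntegral_le_integral hInt (ae_of_all _ fun ω => pow_nonneg (hK.nonneg _) s)

lemma IsKernel.integral_pow_le (hK : IsKernel K) (hX : Measurable (X 0)) (hpos : ∀ l, 0 < h l)
    {s : ℕ} (hs : s ≠ 0) :
    ∫ ω, K (scaledDist x h (X 0 ω)) ^ s ∂P ≤ K 0 ^ s * cubeProb P X x h := by
  have hset : MeasurableSet {ω | X 0 ω ∈ cuboid x h} := hX (measurableSet_cuboid _ _)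
  have e : ∫ ω in {ω | X 0 ω ∈ cuboid x h}, K (scaledDist x h (X 0 ω)) ^ s ∂P
      = ∫ ω, K (scaledDist x h (X 0 ω)) ^ s ∂P := by
    refine setIntegral_eq_integral_of_forall_compl_eq_zero fun ω hω => ?_
    have : K (scaledDist x h (X 0 ω)) = 0 := by
      by_contra hne
      exact hω (hK.mem_cuboid hpos hne)
    rw [this, zero_pow hs]
  rw [← e]
  calc _ ≤ ∫ ω in {ω | X 0 ω ∈ cuboid x h}, K 0 ^ s ∂P := by
        refine setIntegral_mono_on (hK.integrable_weight_pow hX hpos s).integrableOn (by simp)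
          hset fun ω _ => ?_
        exact pow_le_pow_left₀ (hK.nonneg _)
          (hK.le_apply_zero fun l => scaledDist_nonneg hpos _ l) s
    _ = _ := by simp [cubeProb, mul_comm]

/-! ### Localized functions of the observations -/

lemma JointMeasureBound.exists_joint_le (hj : JointMeasureBound P X x) (hX : Measurable (X 0))
    (Y : ℕ → Ω → ℝ) :
    ∃ M H : ℝ, 0 < M ∧ 0 < H ∧ ∀ h : Fin q → ℝ, (∀ l, 0 < h l ∧ h l ≤ H) → ∀ s t : ℕ, s ≠ t →
      P.real {ω | obs Y X s ω ∈ slab x h ∧ obs Y X t ω ∈ slab x h}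
        ≤ M * P.real {ω | obs Y X 0 ω ∈ slab x h} ^ 2 := by
  obtain ⟨M, H, hM, hH, hle⟩ := hj
  refine ⟨M, H, hM, hH, fun h hh s t hst => ?_⟩
  have := hle h hh s t hst
  rwa [measureReal_map_cuboid hX] at this

lemma localized_of_abs_le {E : Type*} [MeasurableSpace E] {V : ℕ → Ω → E}
    (hV : Measurable (V 0)) {M b : ℝ} {A : Set E} {f : E → ℝ} (hA : MeasurableSet A)
    (hf : Measurable f) (hζ : 0 < ζ) (hM : 0 ≤ M) (hb : 0 ≤ b) (h0 : ∀ v, v ∉ A → f v = 0)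
    (hfb : ∀ v, |f v| ≤ b)
    (hj : ∀ s t : ℕ, s ≠ t →
      P.real {ω | V s ω ∈ A ∧ V t ω ∈ A} ≤ M * P.real {ω | V 0 ω ∈ A} ^ 2) :
    Localized P V ζ M (b ^ (2 + ζ)) A f := by
  have hle : ∀ ω, |f (V 0 ω)| ^ (2 + ζ) ≤ b ^ (2 + ζ) := fun ω =>
    Real.rpow_le_rpow (abs_nonneg _) (hfb _) (by linarith)
  have hi : Integrable (fun ω => |f (V 0 ω)| ^ (2 + ζ)) P := by
    refine Integrable.of_bound (C := b ^ (2 + ζ))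
      (((hf.comp hV).abs).pow_const _).aestronglyMeasurable (ae_of_all _ fun ω => ?_)
    rw [Real.norm_eq_abs, abs_of_nonneg (Real.rpow_nonneg (abs_nonneg _) _)]
    exact hle ω
  refine ⟨hA, hf, hζ, hM, by positivity, h0, hj, hi, ?_⟩
  have e : ∫ ω in {ω | V 0 ω ∈ A}, |f (V 0 ω)| ^ (2 + ζ) ∂P
      = ∫ ω, |f (V 0 ω)| ^ (2 + ζ) ∂P := by
    refine setIntegral_eq_integral_of_forall_compl_eq_zero fun ω hω => ?_
    rw [h0 _ hω, abs_zero, Real.zero_rpow (by linarith)]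
  rw [← e]
  calc _ ≤ ∫ ω in {ω | V 0 ω ∈ A}, b ^ (2 + ζ) ∂P :=
        setIntegral_mono_on hi.integrableOn (by simp) (hV hA) fun ω _ => hle ω
    _ = _ := by simp [mul_comm]

lemma IsKernel.localized_weight_mul_resid (hK : IsKernel K)
    (hd : DataAssumptions P Y X m μ₂ x ζ) (hh : ∀ l, 0 < h l) {M Mu : ℝ} (hM : 0 ≤ M)
    (hMu0 : 0 ≤ Mu)
    (hMu : ∫ ω in {ω | X 0 ω ∈ cuboid x h}, |err Y X m 0 ω| ^ (2 + ζ) ∂P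
      ≤ Mu * P.real {ω | X 0 ω ∈ cuboid x h})
    (hj : ∀ s t : ℕ, s ≠ t → P.real {ω | obs Y X s ω ∈ slab x h ∧ obs Y X t ω ∈ slab x h}
        ≤ M * P.real {ω | obs Y X 0 ω ∈ slab x h} ^ 2) :
    Localized P (obs Y X) ζ M (K 0 ^ (2 + ζ) * Mu) (slab x h)
      (fun v => weight K x h v * resid m v) := by
  have hζ := hd.zeta_pos
  have hmeas : Measurable fun v : ℝ × ∀ l, Ξ l => weight K x h v * resid m v :=
    (hK.measurable_weight x h).mul (measurable_resid hd.measurable_m)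
  have hV : Measurable (obs Y X 0) := (hd.measurable_Y 0).prodMk (hd.measurable_X 0)
  have h0 : ∀ v, v ∉ slab x h → weight K x h v * resid m v = 0 := fun v hv => by
    rw [hK.weight_eq_zero hh hv, zero_mul]
  have hle : ∀ ω, |weight K x h (obs Y X 0 ω) * resid m (obs Y X 0 ω)| ^ (2 + ζ)
      ≤ K 0 ^ (2 + ζ) * |err Y X m 0 ω| ^ (2 + ζ) := fun ω => by
    rw [← Real.mul_rpow (hK.nonneg _) (abs_nonneg _), abs_mul]
    refine Real.rpow_le_rpow (by positivity) ?_ (by linarith)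
    refine mul_le_mul_of_nonneg_right ?_ (abs_nonneg _)
    rw [abs_of_nonneg (show 0 ≤ weight K x h (obs Y X 0 ω) from hK.nonneg _)]
    exact hK.weight_le hh _
  have hi : Integrable (fun ω => |weight K x h (obs Y X 0 ω) * resid m (obs Y X 0 ω)| ^ (2 + ζ))
      P := by
    refine ((hd.integrable_err_rpow 0).const_mul (K 0 ^ (2 + ζ))).mono'
      (((hmeas.comp hV).abs).pow_const _).aestronglyMeasurable (ae_of_all _ fun ω => ?_)
    rw [Real.norm_eq_abs, abs_of_nonneg (Real.rpow_nonneg (abs_nonneg _) _)]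
    exact hle ω
  have hK0 := hK.nonneg 0
  refine ⟨measurableSet_slab x h, hmeas, hζ, hM, by positivity, h0, hj, hi, ?_⟩
  have e : ∫ ω in {ω | X 0 ω ∈ cuboid x h},
        |weight K x h (obs Y X 0 ω) * resid m (obs Y X 0 ω)| ^ (2 + ζ) ∂P
      = ∫ ω, |weight K x h (obs Y X 0 ω) * resid m (obs Y X 0 ω)| ^ (2 + ζ) ∂P := by
    refine setIntegral_eq_integral_of_forall_compl_eq_zero fun ω hω => ?_
    rw [h0 _ hω, abs_zero, Real.zero_rpow (by linarith)]
  rw [← e]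
  calc _ ≤ ∫ ω in {ω | X 0 ω ∈ cuboid x h}, K 0 ^ (2 + ζ) * |err Y X m 0 ω| ^ (2 + ζ) ∂P :=
        setIntegral_mono_on hi.integrableOn
          ((hd.integrable_err_rpow 0).const_mul _).integrableOn
          (hd.measurable_X 0 (measurableSet_cuboid x h)) fun ω _ => hle ω
    _ = K 0 ^ (2 + ζ) * ∫ ω in {ω | X 0 ω ∈ cuboid x h}, |err Y X m 0 ω| ^ (2 + ζ) ∂P :=
        integral_const_mul _ _
    _ ≤ K 0 ^ (2 + ζ) * (Mu * P.real {ω | X 0 ω ∈ cuboid x h}) := by gcongr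
    _ = _ := by rw [mul_assoc]; rfl

end Data

/-! ### Asymptotic variance and covariances of the weighted errors -/

section Variance

variable {Ω : Type*} [MeasurableSpace Ω] {P : Measure Ω} [IsProbabilityMeasure P]

/-- Unlike the geometric-mean bound, this keeps the full p² for the truncated part. With T fixed,
the right-hand side divided by p tends to 2B T^(-ζ) as p → 0, and T is arbitrary. -/
lemma Localized.abs_integral_mul_le {E : Type*} [MeasurableSpace E] {V : ℕ → Ω → E}
    {C κ ζ M B : ℝ} {A : Set E} {f : E → ℝ} (hV : StationaryMixing P V C κ)
    (hf : Localized P V ζ M B A f) {T : ℝ} (hT : 0 < T) {l : ℕ} (hl : 1 ≤ l) :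
    |∫ ω, f (V 0 ω) * f (V l ω) ∂P| ≤ T ^ 2 * (M * P.real {ω | V 0 ω ∈ A} ^ 2)
      + 2 * B * T ^ (-ζ) * P.real {ω | V 0 ω ∈ A} := by
  have h1 := hf.abs_integral_mul_sub_trunc_le hV hT l
  have h2 : |∫ ω, NW.trunc T f (V 0 ω) * NW.trunc T f (V l ω) ∂P|
      ≤ T ^ 2 * P.real {ω | V 0 ω ∈ A ∧ V l ω ∈ A} := by
    have hset : MeasurableSet {ω | V 0 ω ∈ A ∧ V l ω ∈ A} :=
      (hV.measurable 0 hf.measurableSet).inter (hV.measurable l hf.measurableSet)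
    have e : ∫ ω in {ω | V 0 ω ∈ A ∧ V l ω ∈ A}, NW.trunc T f (V 0 ω) * NW.trunc T f (V l ω) ∂P
        = ∫ ω, NW.trunc T f (V 0 ω) * NW.trunc T f (V l ω) ∂P := by
      refine setIntegral_eq_integral_of_forall_compl_eq_zero fun ω hω => ?_
      have hz := (hf.trunc hV.measurable T).eq_zero
      by_cases h0 : V 0 ω ∈ A
      · rw [hz (V l ω) fun hl => hω ⟨h0, hl⟩, mul_zero]
      · rw [hz _ h0, zero_mul]
    rw [← e, ← Real.norm_eq_abs]
    refine norm_setIntegral_le_of_norm_le_const (by simp) fun ω _ => ?_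
    rw [norm_mul, sq]
    exact mul_le_mul (abs_trunc_le hT.le f _) (abs_trunc_le hT.le f _) (norm_nonneg _) hT.le
  have h3 := hf.joint 0 l (by omega)
  have h4 : T ^ 2 * P.real {ω | V 0 ω ∈ A ∧ V l ω ∈ A}
      ≤ T ^ 2 * (M * P.real {ω | V 0 ω ∈ A} ^ 2) := by gcongr
  have h5 := abs_sub_abs_le_abs_sub (∫ ω, f (V 0 ω) * f (V l ω) ∂P)
    (∫ ω, NW.trunc T f (V 0 ω) * NW.trunc T f (V l ω) ∂P)
  linarith

variable {q : ℕ} {Ξ : Fin q → Type*} [∀ l, PseudoMetricSpace (Ξ l)] [∀ l, MeasurableSpace (Ξ l)]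
  [∀ l, OpensMeasurableSpace (Ξ l)]
  {Y : ℕ → Ω → ℝ} {X : ℕ → Ω → ∀ l, Ξ l} {m μ₂ : (∀ l, Ξ l) → ℝ} {x : ∀ l, Ξ l} {ζ : ℝ}
  {K : (Fin q → ℝ) → ℝ} {h : ℕ → Fin q → ℝ}

/-- For semi-metrics the shrinking cuboids converge pointwise to the set of points at distance zero
from x, which may be larger than {x}. -/
lemma eventually_mem_cuboid_iff (hpos : ∀ n l, 0 < h n l)
    (hzero : ∀ l, Tendsto (fun n => h n l) atTop (𝓝 0)) (z : ∀ l, Ξ l) :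
    ∀ᶠ n in atTop, z ∈ cuboid x (h n) ↔ z ∈ cuboid x 0 := by
  by_cases hz : z ∈ cuboid x 0
  · exact Eventually.of_forall fun n =>
      ⟨fun _ => hz, fun _ => cuboid_mono (fun l => (hpos n l).le) hz⟩
  · have : ∃ l, 0 < dist (z l) (x l) := by
      by_contra! hc
      exact hz hc
    obtain ⟨l, hl⟩ := this
    filter_upwards [(hzero l).eventually_lt_const hl] with n hn
    exact ⟨fun h' => absurd (h' l) (not_le.2 hn), fun h' => absurd h' hz⟩

lemma tendsto_cubeProb (hX : Measurable (X 0)) (hpos : ∀ n l, 0 < h n l)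
    (hzero : ∀ l, Tendsto (fun n => h n l) atTop (𝓝 0)) :
    Tendsto (fun n => cubeProb P X x (h n)) atTop (𝓝 (cubeProb P X x 0)) := by
  have := tendsto_measure_of_ae_tendsto_indicator_of_isFiniteMeasure (μ := P) atTop
    (A := {ω | X 0 ω ∈ cuboid x 0}) (As := fun n => {ω | X 0 ω ∈ cuboid x (h n)})
    (hX (measurableSet_cuboid _ _)) (fun n => hX (measurableSet_cuboid _ _))
    (ae_of_all _ fun ω => eventually_mem_cuboid_iff hpos hzero (X 0 ω))
  exact (ENNReal.tendsto_toReal (measure_ne_top _ _)).comp this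

lemma IsKernel.abs_le (hK : IsKernel K) {h : Fin q → ℝ} (hh : ∀ l, 0 < h l) (z : ∀ l, Ξ l) :
    |K (scaledDist x h z)| ≤ K 0 := by
  rw [abs_of_nonneg (hK.nonneg _)]
  exact hK.le_apply_zero fun l => scaledDist_nonneg hh _ l

lemma IsKernel.integral_weight_mul_resid (hK : IsKernel K)
    (hd : DataAssumptions P Y X m μ₂ x ζ) {h : Fin q → ℝ} (hh : ∀ l, 0 < h l) :
    ∫ ω, weight K x h (obs Y X 0 ω) * resid m (obs Y X 0 ω) ∂P = 0 :=
  hd.integral_mul_err (hK.measurable_scaledDist x h) (hK.abs_le hh)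

/-- The variance of the weighted errors is asymptotically `μ₂(x) E K²`. -/
lemma IsKernel.tendsto_integral_sq_ratio (hK : IsKernel K)
    (hd : DataAssumptions P Y X m μ₂ x ζ) (hpos : ∀ n l, 0 < h n l)
    (hzero : ∀ l, Tendsto (fun n => h n l) atTop (𝓝 0))
    (hK2 : ∀ᶠ n in atTop, 0 < ∫ ω, K (scaledDist x (h n) (X 0 ω)) ^ 2 ∂P) :
    Tendsto (fun n => (∫ ω, (weight K x (h n) (obs Y X 0 ω) * resid m (obs Y X 0 ω)) ^ 2 ∂P) /
      (μ₂ x * ∫ ω, K (scaledDist x (h n) (X 0 ω)) ^ 2 ∂P)) atTop (𝓝 1) := by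
  have hμ := hd.μ₂_pos
  obtain ⟨U, hU, hcont⟩ := hd.μ₂_continuous
  have hcx : ContinuousAt μ₂ x := hcont.continuousAt hU
  rw [Metric.tendsto_atTop']
  intro ε hε
  have hN : {z | |μ₂ z - μ₂ x| ≤ ε * μ₂ x / 2} ∈ 𝓝 x := by
    have := hcx (Metric.closedBall_mem_nhds (μ₂ x) (ε := ε * μ₂ x / 2) (by positivity))
    simpa [Metric.closedBall, Real.dist_eq] using this
  obtain ⟨N, hN⟩ := eventually_atTop.1 ((eventually_cuboid_subset hzero hN).and hK2)
  refine ⟨N, fun n hn => ?_⟩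
  obtain ⟨hsub, hb⟩ := hN n hn.le
  have hh := hpos n
  set b := ∫ ω, K (scaledDist x (h n) (X 0 ω)) ^ 2 ∂P with hbdef
  have hKm := hK.measurable_scaledDist x (h n)
  have hbd : ∀ z, |K (scaledDist x (h n) z) ^ 2| ≤ K 0 ^ 2 := fun z => by
    rw [abs_pow]
    exact pow_le_pow_left₀ (abs_nonneg _) (hK.abs_le hh z) 2
  have e1 : ∫ ω, (weight K x (h n) (obs Y X 0 ω) * resid m (obs Y X 0 ω)) ^ 2 ∂P
      = ∫ ω, K (scaledDist x (h n) (X 0 ω)) ^ 2 * μ₂ (X 0 ω) ∂P := by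
    rw [← hd.integral_mul_err_sq (hKm.pow_const 2) hbd]
    refine integral_congr_ae (ae_of_all _ fun ω => ?_)
    exact mul_pow _ _ 2
  have hi2 := hK.integrable_weight_pow (P := P) (x := x) (hd.measurable_X 0) hh 2
  have hi1 : Integrable (fun ω => K (scaledDist x (h n) (X 0 ω)) ^ 2 * μ₂ (X 0 ω)) P :=
    hd.integrable_μ₂.bdd_mul ((hKm.pow_const 2).comp (hd.measurable_X 0)).aestronglyMeasurable
      (ae_of_all _ fun ω => hbd _)
  -- The weight vanishes off the cuboid, so only values of μ₂ near x enter, and continuity at x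
  -- makes the relative error small.
  have e2 : |∫ ω, K (scaledDist x (h n) (X 0 ω)) ^ 2 * μ₂ (X 0 ω) ∂P - μ₂ x * b|
      ≤ ε * μ₂ x / 2 * b := by
    rw [hbdef, ← integral_const_mul, ← integral_sub hi1 (hi2.const_mul _), ← integral_const_mul]
    refine abs_integral_le_integral_abs.trans (integral_mono (hi1.sub (hi2.const_mul _)).abs
      (hi2.const_mul _) fun ω => ?_)
    simp only
    by_cases hz : K (scaledDist x (h n) (X 0 ω)) = 0
    · simp [hz]
    · have h1 : |μ₂ (X 0 ω) - μ₂ x| ≤ ε * μ₂ x / 2 := hsub (hK.mem_cuboid hh hz)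
      rw [show K (scaledDist x (h n) (X 0 ω)) ^ 2 * μ₂ (X 0 ω)
        - μ₂ x * K (scaledDist x (h n) (X 0 ω)) ^ 2
        = (μ₂ (X 0 ω) - μ₂ x) * K (scaledDist x (h n) (X 0 ω)) ^ 2 by ring, abs_mul,
        abs_of_nonneg (sq_nonneg (K _))]
      gcongr
  rw [e1, Real.dist_eq, div_sub_one (by positivity), abs_div, abs_of_pos (mul_pos hμ hb),
    div_lt_iff₀ (mul_pos hμ hb)]
  have : 0 < ε * μ₂ x * b := by positivity
  linarith

/-- The scaled autocovariances of the weighted errors vanish asymptotically. -/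
lemma IsKernel.tendsto_acov_div (hK : IsKernel K)
    (hd : DataAssumptions P Y X m μ₂ x ζ) (hpos : ∀ n l, 0 < h n l)
    (hzero : ∀ l, Tendsto (fun n => h n l) atTop (𝓝 0))
    (huc : UncorrelatedAtMassPoint P Y X m x) {C κ M B : ℝ}
    (hV : StationaryMixing P (obs Y X) C κ)
    (hloc : ∀ᶠ n in atTop, Localized P (obs Y X) ζ M B (slab x (h n))
      (fun v => weight K x (h n) v * resid m v))
    (hp : ∀ᶠ n in atTop, 0 < cubeProb P X x (h n)) {l : ℕ} (hl : 1 ≤ l) :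
    Tendsto (fun n => acov P (obs Y X) (fun v => weight K x (h n) v * resid m v) l /
      cubeProb P X x (h n)) atTop (𝓝 0) := by
  have hζ := hd.zeta_pos
  have hac : ∀ n, acov P (obs Y X) (fun v => weight K x (h n) v * resid m v) l
      = ∫ ω, weight K x (h n) (obs Y X 0 ω) * resid m (obs Y X 0 ω) *
        (weight K x (h n) (obs Y X l ω) * resid m (obs Y X l ω)) ∂P := fun n => by
    rw [acov, hK.integral_weight_mul_resid hd (hpos n)]
    simp
  have hpt := tendsto_cubeProb (P := P) (x := x) (hd.measurable_X 0) hpos hzero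
  have hp0 : 0 ≤ cubeProb P X x 0 := measureReal_nonneg
  -- Either p tends to zero and the bound on joint visits beats division by p, or x is a mass point
  -- and p has a positive limit.
  rcases hp0.eq_or_lt with h0 | h0
  · rw [← h0] at hpt
    rw [Metric.tendsto_nhds]
    intro ε hε
    have hT : Tendsto (fun T : ℝ => 2 * B * T ^ (-ζ)) atTop (𝓝 0) := by
      simpa using (tendsto_rpow_neg_atTop hζ).const_mul (2 * B)
    obtain ⟨T, hTε, hT0⟩ := ((hT.eventually_lt_const (half_pos hε)).and
      (eventually_gt_atTop 0)).exists
    have h1 : Tendsto (fun n => T ^ 2 * M * cubeProb P X x (h n)) atTop (𝓝 0) := by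
      simpa using hpt.const_mul (T ^ 2 * M)
    filter_upwards [hloc, hp, h1.eventually_lt_const (half_pos hε)] with n hn hpn hn1
    have h2 := hn.abs_integral_mul_le hV hT0 hl
    rw [← hac, show P.real {ω | obs Y X 0 ω ∈ slab x (h n)} = cubeProb P X x (h n) from rfl] at h2
    rw [dist_zero_right, Real.norm_eq_abs, abs_div, abs_of_pos hpn, div_lt_iff₀ hpn]
    nlinarith
  -- At a mass point each weight converges pointwise to K(0) times the indicator of zero distance
  -- from x, so the covariance tends to K(0)² times the error product integrated over joint visits
  -- to the mass point, which vanishes by assumption.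
  · have hlim : Tendsto (fun n => ∫ ω, weight K x (h n) (obs Y X 0 ω) * resid m (obs Y X 0 ω) *
        (weight K x (h n) (obs Y X l ω) * resid m (obs Y X l ω)) ∂P) atTop
        (𝓝 (∫ ω, {ω | X 0 ω ∈ cuboid x 0 ∧ X l ω ∈ cuboid x 0}.indicator
          (fun ω => K 0 ^ 2 * (err Y X m 0 ω * err Y X m l ω)) ω ∂P)) := by
      have hsq : ∀ i, AEStronglyMeasurable (err Y X m i) P := fun i => (hd.memLp_err i).1
      have hInt := integrable_mul_of_sq (hsq 0) (hsq l) (hd.integrable_err_sq 0)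
        (hd.integrable_err_sq l)
      refine tendsto_integral_of_dominated_convergence
        (fun ω => K 0 ^ 2 * |err Y X m 0 ω * err Y X m l ω|) (fun n => ?_)
        (hInt.abs.const_mul _) (fun n => ae_of_all _ fun ω => ?_) (ae_of_all _ fun ω => ?_)
      · have hf : Measurable fun v : ℝ × ∀ l, Ξ l => weight K x (h n) v * resid m v :=
          (hK.measurable_weight x _).mul (measurable_resid hd.measurable_m)
        exact ((hf.comp (hV.measurable 0)).mul (hf.comp (hV.measurable l))).aestronglyMeasurable
      · have h1 := hK.abs_le (x := x) (hpos n) (X 0 ω)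
        have h2 := hK.abs_le (x := x) (hpos n) (X l ω)
        change |K (scaledDist x (h n) (X 0 ω)) * err Y X m 0 ω *
          (K (scaledDist x (h n) (X l ω)) * err Y X m l ω)| ≤ _
        rw [show K (scaledDist x (h n) (X 0 ω)) * err Y X m 0 ω *
          (K (scaledDist x (h n) (X l ω)) * err Y X m l ω)
          = K (scaledDist x (h n) (X 0 ω)) * K (scaledDist x (h n) (X l ω)) *
            (err Y X m 0 ω * err Y X m l ω) by ring, abs_mul, abs_mul (K _), sq]
        gcongr
        exact hK.nonneg 0
      · refine tendsto_const_nhds.congr' ?_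
        filter_upwards [eventually_mem_cuboid_iff (x := x) hpos hzero (X 0 ω),
          eventually_mem_cuboid_iff (x := x) hpos hzero (X l ω)] with n h1 h2
        have hin : ∀ i, X i ω ∈ cuboid x 0 → weight K x (h n) (obs Y X i ω) = K 0 := by
          intro i hi
          have : scaledDist x (h n) (X i ω) = 0 := by
            funext j
            have h3 : dist (X i ω j) (x j) = 0 := le_antisymm (hi j) dist_nonneg
            simp [scaledDist, dist_comm (x j), h3]
          exact congrArg K this
        have hout : ∀ i, X i ω ∉ cuboid x (h n) → weight K x (h n) (obs Y X i ω) = 0 :=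
          fun i hi => hK.weight_eq_zero (hpos n) hi
        by_cases hb : X 0 ω ∈ cuboid x 0 ∧ X l ω ∈ cuboid x 0
        · rw [Set.indicator_of_mem (show ω ∈ {ω | X 0 ω ∈ cuboid x 0 ∧ X l ω ∈ cuboid x 0} from hb),
            hin 0 hb.1, hin l hb.2]
          change _ = K 0 * err Y X m 0 ω * (K 0 * err Y X m l ω)
          ring
        · rw [Set.indicator_of_notMem
            (show ω ∉ {ω | X 0 ω ∈ cuboid x 0 ∧ X l ω ∈ cuboid x 0} from hb)]
          by_cases hb0 : X 0 ω ∈ cuboid x 0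
          · rw [hout l fun h3 => hb ⟨hb0, h2.1 h3⟩]; ring
          · rw [hout 0 fun h3 => hb0 (h1.1 h3)]; ring
    have hset : MeasurableSet {ω | X 0 ω ∈ cuboid x 0 ∧ X l ω ∈ cuboid x 0} :=
      (hd.measurable_X 0 (measurableSet_cuboid x 0)).inter
        (hd.measurable_X l (measurableSet_cuboid x 0))
    rw [integral_indicator hset, integral_const_mul, huc 0 l (by omega), mul_zero] at hlim
    simp_rw [hac]
    have := hlim.div hpt h0.ne'
    rw [zero_div] at this
    exact this

end Variance

/-! ### Weighted averages -/

lemma abs_sum_mul_le {ι : Type*} {s : Finset ι} {k y : ι → ℝ} {r : ℝ} (hk : ∀ i, 0 ≤ k i)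
    (hy : ∀ i ∈ s, k i ≠ 0 → |y i| ≤ r) : |∑ i ∈ s, k i * y i| ≤ r * ∑ i ∈ s, k i := by
  refine (Finset.abs_sum_le_sum_abs _ _).trans ?_
  rw [Finset.mul_sum]
  refine Finset.sum_le_sum fun i hi => ?_
  rw [abs_mul, abs_of_nonneg (hk i), mul_comm]
  by_cases h0 : k i = 0
  · simp [h0]
  · exact mul_le_mul_of_nonneg_right (hy i hi h0) (hk i)

lemma abs_sum_mul_div_sum_le {ι : Type*} {s : Finset ι} {k y : ι → ℝ} {r : ℝ}
    (hk : ∀ i, 0 ≤ k i) (hr : 0 ≤ r) (hy : ∀ i ∈ s, k i ≠ 0 → |y i| ≤ r) :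
    |(∑ i ∈ s, k i * y i) / ∑ i ∈ s, k i| ≤ r := by
  rw [abs_div, abs_of_nonneg (Finset.sum_nonneg fun i _ => hk i)]
  exact div_le_of_le_mul₀ (Finset.sum_nonneg fun i _ => hk i) hr (abs_sum_mul_le hk hy)

/-- A weighted average is at most the largest term of non-zero weight, whose p-th power is at most
the whole sum. No lower bound on the denominator is needed, and a zero denominator gives the value
0. -/
lemma abs_sum_mul_div_sum_rpow_le {ι : Type*} {s : Finset ι} {k y w : ι → ℝ} {p : ℝ} (hp : 0 < p)
    (hk : ∀ i, 0 ≤ k i) (hw : ∀ i, 0 ≤ w i) (hy : ∀ i ∈ s, k i ≠ 0 → |y i| ^ p ≤ w i) :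
    |(∑ i ∈ s, k i * y i) / ∑ i ∈ s, k i| ^ p ≤ ∑ i ∈ s, w i := by
  have hs : 0 ≤ ∑ i ∈ s, w i := Finset.sum_nonneg fun i _ => hw i
  rw [← Real.le_rpow_inv_iff_of_pos (abs_nonneg _) hs hp]
  refine abs_sum_mul_div_sum_le hk (Real.rpow_nonneg hs _) fun i hi h0 => ?_
  rw [Real.le_rpow_inv_iff_of_pos (abs_nonneg _) hs hp]
  exact (hy i hi h0).trans (Finset.single_le_sum (fun j _ => hw j) hi)

/-! ### Means over rare events -/

section Rest

variable {Ω : Type*} [MeasurableSpace Ω] {P : Measure Ω} [IsProbabilityMeasure P]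

lemma abs_le_add_rpow {ζ t : ℝ} (hζ : 0 < ζ) (ht : 0 < t) (r : ℝ) :
    |r| ≤ t + t ^ (-(1 + ζ)) * |r| ^ (2 + ζ) := by
  rcases le_or_gt |r| t with h | h
  · have : 0 ≤ t ^ (-(1 + ζ)) * |r| ^ (2 + ζ) := by positivity
    linarith
  · have hr : 0 < |r| := ht.trans h
    have e : |r| = |r| ^ (-(1 + ζ)) * |r| ^ (2 + ζ) := by
      rw [← Real.rpow_add hr, show -(1 + ζ) + (2 + ζ) = 1 by ring, Real.rpow_one]
    have h2 : |r| ^ (-(1 + ζ)) ≤ t ^ (-(1 + ζ)) :=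
      Real.rpow_le_rpow_of_nonpos ht h.le (by linarith)
    calc |r| = |r| ^ (-(1 + ζ)) * |r| ^ (2 + ζ) := e
      _ ≤ t ^ (-(1 + ζ)) * |r| ^ (2 + ζ) := by gcongr
      _ ≤ _ := by linarith

/-- The contribution of a rare event to the mean of a variable with a moment bound. -/
lemma setIntegral_abs_le_div {R S : Ω → ℝ} {bad : Set Ω} {ζ κ L D Mu n : ℝ} (hζ : 0 < ζ)
    (hκ : 2 + 4 / ζ < κ) (hR : Integrable R P) (hS : Integrable S P)
    (hRS : ∀ ω, |R ω| ^ (2 + ζ) ≤ S ω) (hSL : ∫ ω, S ω ∂P ≤ Mu * L)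
    (hD : 0 ≤ D) (hL : 1 ≤ L) (hLn : L ≤ n)
    (hbad : P.real bad ≤ D * ((L ^ 3)⁻¹ + n ^ (-κ))) :
    ∫ ω in bad, |R ω| ∂P ≤ (2 * D + Mu) / L := by
  have hL0 : 0 < L := by linarith
  -- With this level t^(-(1+ζ)) = L^(-2), so a moment of size Mu·L contributes Mu/L. Since t can be
  -- nearly L², the rare event must have probability of order L^(-3).
  set t := L ^ (2 / (1 + ζ)) with ht
  have ht0 : 0 < t := Real.rpow_pos_of_pos hL0 _
  have h4 : 0 < 4 / ζ := by positivity
  have e1 : t ^ (-(1 + ζ)) = L⁻¹ * L⁻¹ := by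
    rw [ht, ← Real.rpow_mul hL0.le, show 2 / (1 + ζ) * -(1 + ζ) = -2 by field_simp,
      Real.rpow_neg hL0.le, ← mul_inv, ← sq]
    norm_cast
  have hS0 : ∀ ω, 0 ≤ S ω := fun ω => (Real.rpow_nonneg (abs_nonneg _) _).trans (hRS ω)
  have h1 : ∫ ω in bad, |R ω| ∂P ≤ t * P.real bad + L⁻¹ * L⁻¹ * (Mu * L) := by
    calc ∫ ω in bad, |R ω| ∂P ≤ ∫ ω in bad, (t + L⁻¹ * L⁻¹ * S ω) ∂P := by
          refine setIntegral_mono hR.abs.integrableOn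
            ((integrable_const _).add (hS.const_mul _)).integrableOn fun ω => ?_
          have := abs_le_add_rpow hζ ht0 (R ω)
          rw [e1] at this
          refine this.trans ?_
          have h2 := hRS ω
          gcongr
      _ = t * P.real bad + L⁻¹ * L⁻¹ * ∫ ω in bad, S ω ∂P := by
          rw [integral_add (by simp) (hS.const_mul _).integrableOn, integral_const_mul]
          simp [mul_comm]
      _ ≤ t * P.real bad + L⁻¹ * L⁻¹ * (Mu * L) := by
          have h3 : ∫ ω in bad, S ω ∂P ≤ Mu * L :=
            (setIntegral_le_integral hS (ae_of_all _ hS0)).trans hSL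
          gcongr
  have hfrac : 2 / (1 + ζ) ≤ 2 := by
    rw [div_le_iff₀ (by linarith)]; nlinarith
  -- For the term n^(-κ), this and κ > 2 + 4/ζ leave an exponent of L below -1, using L ≤ n.
  have hfrac2 : 2 / (1 + ζ) ≤ 4 / ζ := by
    rw [div_le_div_iff₀ (by linarith) hζ]; nlinarith
  have a1 : t * (L ^ 3)⁻¹ ≤ L⁻¹ := by
    have : t ≤ L ^ 2 := by
      rw [ht, ← Real.rpow_natCast L 2]
      exact Real.rpow_le_rpow_of_exponent_le hL (by push_cast; exact hfrac)
    calc t * (L ^ 3)⁻¹ ≤ L ^ 2 * (L ^ 3)⁻¹ := by gcongr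
      _ = L⁻¹ := by field_simp
  have a2 : t * n ^ (-κ) ≤ L⁻¹ := by
    have b1 : n ^ (-κ) ≤ L ^ (-κ) := Real.rpow_le_rpow_of_nonpos hL0 hLn (by linarith)
    calc t * n ^ (-κ) ≤ t * L ^ (-κ) := by gcongr
      _ = L ^ (2 / (1 + ζ) + -κ) := by rw [ht, ← Real.rpow_add hL0]
      _ ≤ L ^ (-1 : ℝ) := Real.rpow_le_rpow_of_exponent_le hL (by linarith)
      _ = L⁻¹ := Real.rpow_neg_one L
  have a3 : t * P.real bad ≤ D * (2 * L⁻¹) := by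
    calc t * P.real bad ≤ t * (D * ((L ^ 3)⁻¹ + n ^ (-κ))) := by gcongr
      _ = D * (t * (L ^ 3)⁻¹ + t * n ^ (-κ)) := by ring
      _ ≤ D * (2 * L⁻¹) := by gcongr; linarith
  have a4 : L⁻¹ * L⁻¹ * (Mu * L) = Mu * L⁻¹ := by field_simp
  rw [a4] at h1
  rw [div_eq_mul_inv]
  linarith

lemma rare_le_div {D L n κ : ℝ} (hD : 0 ≤ D) (hL : 1 ≤ L) (hLn : L ≤ n) (hκ : 1 ≤ κ) :
    D * ((L ^ 3)⁻¹ + n ^ (-κ)) ≤ 2 * D / L := by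
  have hL0 : 0 < L := by linarith
  have a1 : (L ^ 3)⁻¹ ≤ L⁻¹ := inv_anti₀ hL0 (le_self_pow₀ hL (by norm_num))
  have a2 : n ^ (-κ) ≤ L⁻¹ := by
    rw [← Real.rpow_neg_one L]
    exact (Real.rpow_le_rpow_of_nonpos hL0 hLn (by linarith)).trans
      (Real.rpow_le_rpow_of_exponent_le hL (by linarith))
  calc D * ((L ^ 3)⁻¹ + n ^ (-κ)) ≤ D * (L⁻¹ + L⁻¹) := by gcongr
    _ = 2 * D / L := by rw [div_eq_mul_inv]; ring

end Rest

/-! ### The estimator as a perturbed linear statistic -/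

section Estimator

variable {Ω : Type*} [MeasurableSpace Ω] {P : Measure Ω} [IsProbabilityMeasure P]
  {q : ℕ} {Ξ : Fin q → Type*} [∀ l, PseudoMetricSpace (Ξ l)] [∀ l, MeasurableSpace (Ξ l)]
  [∀ l, OpensMeasurableSpace (Ξ l)]
  {Y : ℕ → Ω → ℝ} {X : ℕ → Ω → ∀ l, Ξ l} {m μ₂ : (∀ l, Ξ l) → ℝ} {x : ∀ l, Ξ l} {ζ δ : ℝ}
  {K : (Fin q → ℝ) → ℝ} {h : ℕ → Fin q → ℝ}

/-- The sum of the kernel weights. -/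
def weightSum (K : (Fin q → ℝ) → ℝ) (Y : ℕ → Ω → ℝ) (X : ℕ → Ω → ∀ l, Ξ l) (x : ∀ l, Ξ l)
    (h : Fin q → ℝ) (n : ℕ) (ω : Ω) : ℝ :=
  ∑ i ∈ Finset.range n, weight K x h (obs Y X i ω)

/-- The weighted sum of the errors. -/
def errSum (K : (Fin q → ℝ) → ℝ) (Y : ℕ → Ω → ℝ) (X : ℕ → Ω → ∀ l, Ξ l)
    (m : (∀ l, Ξ l) → ℝ) (x : ∀ l, Ξ l) (h : Fin q → ℝ) (n : ℕ) (ω : Ω) : ℝ :=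
  ∑ i ∈ Finset.range n, weight K x h (obs Y X i ω) * resid m (obs Y X i ω)

/-- The mean of the kernel weight. -/
def weightMean (P : Measure Ω) (K : (Fin q → ℝ) → ℝ) (X : ℕ → Ω → ∀ l, Ξ l) (x : ∀ l, Ξ l)
    (h : Fin q → ℝ) : ℝ :=
  ∫ ω, K (scaledDist x h (X 0 ω)) ∂P

lemma measurable_obs (hd : DataAssumptions P Y X m μ₂ x ζ) (i : ℕ) : Measurable (obs Y X i) :=
  (hd.measurable_Y i).prodMk (hd.measurable_X i)

lemma IsKernel.measurable_weightSum (hK : IsKernel K) (hd : DataAssumptions P Y X m μ₂ x ζ)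
    (h : Fin q → ℝ) (n : ℕ) : Measurable (weightSum K Y X x h n) :=
  Finset.measurable_sum _ fun i _ => (hK.measurable_weight x h).comp (measurable_obs hd i)

lemma IsKernel.measurable_errSum (hK : IsKernel K) (hd : DataAssumptions P Y X m μ₂ x ζ)
    (h : Fin q → ℝ) (n : ℕ) : Measurable (errSum K Y X m x h n) :=
  Finset.measurable_sum _ fun i _ =>
    ((hK.measurable_weight x h).mul (measurable_resid hd.measurable_m)).comp (measurable_obs hd i)

lemma IsKernel.exists_localized (hK : IsKernel K) (hd : DataAssumptions P Y X m μ₂ x ζ)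
    (hj : JointMeasureBound P X x) (hpos : ∀ n l, 0 < h n l)
    (hzero : ∀ l, Tendsto (fun n => h n l) atTop (𝓝 0)) :
    ∃ M B : ℝ, 0 ≤ M ∧ 0 ≤ B ∧ ∀ᶠ n in atTop,
      Localized P (obs Y X) ζ M B (slab x (h n)) (fun v => weight K x (h n) v * resid m v) := by
  obtain ⟨M, H, hM, hH, hle⟩ := hj.exists_joint_le (hd.measurable_X 0) Y
  obtain ⟨Mu, hMu0, U, hU, hMu⟩ := hd.exists_setIntegral_err_rpow_le
  have hK0 := hK.nonneg 0
  refine ⟨M, K 0 ^ (2 + ζ) * Mu, hM.le, by positivity, ?_⟩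
  filter_upwards [eventually_bandwidth_le hpos hzero hH, eventually_cuboid_subset hzero hU]
    with n hn hsub
  exact hK.localized_weight_mul_resid hd (hpos n) hM.le hMu0
    (hMu _ hsub (measurableSet_cuboid _ _)) (hle _ hn)

/-- Used with the constant 1 for the denominator and with the rescaled increments of the regression
function for the bias. -/
lemma IsKernel.exists_localized_of_abs_le (hK : IsKernel K) (hd : DataAssumptions P Y X m μ₂ x ζ)
    (hj : JointMeasureBound P X x) (hpos : ∀ n l, 0 < h n l)
    (hzero : ∀ l, Tendsto (fun n => h n l) atTop (𝓝 0)) {b : ℝ} (hb : 0 ≤ b)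
    {ψ : ℕ → ℝ × (∀ l, Ξ l) → ℝ} (hψ : ∀ n, Measurable (ψ n))
    (hψb : ∀ n v, |weight K x (h n) v * ψ n v| ≤ b) :
    ∃ M B : ℝ, 0 ≤ M ∧ 0 ≤ B ∧ ∀ᶠ n in atTop,
      Localized P (obs Y X) ζ M B (slab x (h n)) (fun v => weight K x (h n) v * ψ n v) := by
  obtain ⟨M, H, hM, hH, hle⟩ := hj.exists_joint_le (hd.measurable_X 0) Y
  refine ⟨M, b ^ (2 + ζ), hM.le, by positivity, ?_⟩
  filter_upwards [eventually_bandwidth_le hpos hzero hH] with n hn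
  refine localized_of_abs_le (measurable_obs hd 0) (measurableSet_slab _ _)
    ((hK.measurable_weight x _).mul (hψ n)) hd.zeta_pos hM.le hb (fun v hv => ?_) (hψb n) (hle _ hn)
  rw [hK.weight_eq_zero (hpos n) hv, zero_mul]

lemma IsKernel.exists_localized_weight (hK : IsKernel K) (hd : DataAssumptions P Y X m μ₂ x ζ)
    (hj : JointMeasureBound P X x) (hpos : ∀ n l, 0 < h n l)
    (hzero : ∀ l, Tendsto (fun n => h n l) atTop (𝓝 0)) :
    ∃ M B : ℝ, 0 ≤ M ∧ 0 ≤ B ∧ ∀ᶠ n in atTop,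
      Localized P (obs Y X) ζ M B (slab x (h n)) (weight K x (h n)) := by
  obtain ⟨M, B, hM, hB, hloc⟩ := hK.exists_localized_of_abs_le hd hj hpos hzero (hK.nonneg 0)
    (ψ := fun _ _ => 1) (fun _ => measurable_const) (fun n v => by
      rw [mul_one]; exact hK.abs_le (hpos n) v.2)
  exact ⟨M, B, hM, hB, by simpa using hloc⟩

lemma eventually_cubeProb_pos
    (hrate : Tendsto (fun n : ℕ => (n : ℝ) * cubeProb P X x (h n)) atTop atTop) :
    ∀ᶠ n in atTop, 0 < cubeProb P X x (h n) := by
  filter_upwards [hrate.eventually_gt_atTop 0] with n hn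
  exact pos_of_mul_pos_right hn (Nat.cast_nonneg n)

lemma IsKernel.exists_le_weightMean (hK : IsKernel K) (hX : Measurable (X 0))
    (halt : IsTypeI K ∨ SmallCubeDoubling (P.map (X 0)) x) (hpos : ∀ n l, 0 < h n l)
    (hzero : ∀ l, Tendsto (fun n => h n l) atTop (𝓝 0)) :
    ∃ c : ℝ, 0 < c ∧ ∀ᶠ n in atTop, c * cubeProb P X x (h n) ≤ weightMean P K X x (h n) := by
  obtain ⟨c, H, hc, hH, hle⟩ := hK.exists_le_integral_pow hX halt 1
  refine ⟨c, hc, ?_⟩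
  filter_upwards [eventually_bandwidth_le hpos hzero hH] with n hn
  simpa [weightMean] using hle _ hn

/-- The denominator of the estimator: its mean, its variance and its lower tail. -/
lemma IsKernel.exists_weightSum_bounds (hK : IsKernel K) (hd : DataAssumptions P Y X m μ₂ x ζ)
    (hj : JointMeasureBound P X x) (halt : IsTypeI K ∨ SmallCubeDoubling (P.map (X 0)) x)
    (hpos : ∀ n l, 0 < h n l) (hzero : ∀ l, Tendsto (fun n => h n l) atTop (𝓝 0))
    (hrate : Tendsto (fun n : ℕ => (n : ℝ) * cubeProb P X x (h n)) atTop atTop)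
    {C κ : ℝ} (hκ : 2 + 4 / ζ < κ) (hV : StationaryMixing P (obs Y X) C κ) :
    ∃ c b D : ℝ, 0 < c ∧ 0 ≤ D ∧ ∀ᶠ n : ℕ in atTop,
      c * (n * cubeProb P X x (h n)) ≤ n * weightMean P K X x (h n) ∧
      Integrable (fun ω => (weightSum K Y X x (h n) n ω - n * weightMean P K X x (h n)) ^ 2) P ∧
      ∫ ω, (weightSum K Y X x (h n) n ω - n * weightMean P K X x (h n)) ^ 2 ∂P
        ≤ b * (n * cubeProb P X x (h n)) ∧
      P.real {ω | weightSum K Y X x (h n) n ω < 1 / 24 * (n * weightMean P K X x (h n))}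
        ≤ D * (((n * cubeProb P X x (h n)) ^ 3)⁻¹ + (n : ℝ) ^ (-κ)) := by
  obtain ⟨M, B, hM, hB, hloc⟩ := hK.exists_localized_weight hd hj hpos hzero
  obtain ⟨c, hc, hmean⟩ := hK.exists_le_weightMean (hd.measurable_X 0) halt hpos hzero
  obtain ⟨b, hb, hvar⟩ := exists_integral_sq_sum_le P (obs Y X) M B hB hd.zeta_pos hκ hV
  obtain ⟨D, hD, htail⟩ := exists_measureReal_sum_lt_le P (obs Y X) M B c hB hc hd.zeta_pos hκ hV
  refine ⟨c, b, D, hc, hD.le, ?_⟩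
  filter_upwards [hloc, hmean, eventually_cubeProb_pos hrate, eventually_ge_atTop 6]
    with n hl hm hp hn
  have e : ∀ ω, ∑ i ∈ Finset.range n, (weight K x (h n) (obs Y X i ω)
      - ∫ ω', weight K x (h n) (obs Y X 0 ω') ∂P)
      = weightSum K Y X x (h n) n ω - n * weightMean P K X x (h n) := fun ω => by
    rw [Finset.sum_sub_distrib, Finset.sum_const, Finset.card_range, nsmul_eq_mul]
    rfl
  have h1 := hvar _ _ hl (Finset.range n)
  simp only [e, Finset.card_range] at h1
  refine ⟨?_, h1.1, ?_, htail _ _ hl (fun v => hK.nonneg _) hp hm n hn⟩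
  · have : (0 : ℝ) ≤ n := Nat.cast_nonneg n
    nlinarith
  · rw [← mul_assoc]; exact h1.2

/-- Linearisation of the stochastic part of the estimator. -/
lemma IsKernel.exists_integral_errSum_div_le (hK : IsKernel K)
    (hd : DataAssumptions P Y X m μ₂ x ζ)
    (hj : JointMeasureBound P X x) (halt : IsTypeI K ∨ SmallCubeDoubling (P.map (X 0)) x)
    (hpos : ∀ n l, 0 < h n l) (hzero : ∀ l, Tendsto (fun n => h n l) atTop (𝓝 0))
    (hrate : Tendsto (fun n : ℕ => (n : ℝ) * cubeProb P X x (h n)) atTop atTop) :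
    ∃ a : ℝ, ∀ᶠ n : ℕ in atTop,
      Integrable (fun ω => errSum K Y X m x (h n) n ω / weightSum K Y X x (h n) n ω
        - errSum K Y X m x (h n) n ω / (n * weightMean P K X x (h n))) P ∧
      ∫ ω, |errSum K Y X m x (h n) n ω / weightSum K Y X x (h n) n ω
        - errSum K Y X m x (h n) n ω / (n * weightMean P K X x (h n))| ∂P
        ≤ a / (n * cubeProb P X x (h n)) := by
  have hζ := hd.zeta_pos
  obtain ⟨C, κ, hκ, hV⟩ := hd.exists_stationaryMixing
  obtain ⟨c, b, D, hc, hD, hbounds⟩ :=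
    hK.exists_weightSum_bounds hd hj halt hpos hzero hrate hκ hV
  obtain ⟨M, B, hM, hB, hloc⟩ := hK.exists_localized hd hj hpos hzero
  obtain ⟨a, ha, hvar⟩ := exists_integral_sq_sum_le P (obs Y X) M B hB hζ hκ hV
  obtain ⟨Mu, hMu0, U, hU, hMu⟩ := hd.exists_setIntegral_err_rpow_le
  have hκ1 : 1 ≤ κ := by
    have : 0 < 4 / ζ := by positivity
    linarith
  refine ⟨(a + b) / (2 * (1 / 24) * c ^ 2) + (2 * D + Mu) + (a + 2 * D) / (2 * c), ?_⟩
  filter_upwards [hbounds, hloc, hrate.eventually_ge_atTop 1, eventually_cuboid_subset hzero hU]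
    with n ⟨hb1, hb2, hb3, hb4⟩ hl hL hsub
  have hLn : n * cubeProb P X x (h n) ≤ n :=
    mul_le_of_le_one_right (Nat.cast_nonneg n) measureReal_le_one
  have hNm := hK.measurable_errSum hd (h n) n
  have hDm := hK.measurable_weightSum hd (h n) n
  have hv := hvar _ _ hl (Finset.range n)
  simp only [hK.integral_weight_mul_resid hd (hpos n), sub_zero, Finset.card_range] at hv
  have hw0 : ∀ v : ℝ × ∀ l, Ξ l, 0 ≤ weight K x (h n) v := fun v => hK.nonneg _
  have hR : Integrable (fun ω => errSum K Y X m x (h n) n ω / weightSum K Y X x (h n) n ω) P := by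
    refine (integrable_finsetSum (Finset.range n)
      fun i _ => (hd.integrable_err i).abs).mono' (hNm.div hDm).aestronglyMeasurable
      (ae_of_all _ fun ω => ?_)
    refine abs_sum_mul_div_sum_le (fun i => hw0 _) (Finset.sum_nonneg fun i _ => abs_nonneg _)
      fun i hi _ => ?_
    exact Finset.single_le_sum (f := fun i => |err Y X m i ω|) (fun j _ => abs_nonneg _) hi
  have hrm : Measurable fun v : ℝ × ∀ l, Ξ l => |resid m v| ^ (2 + ζ) :=
    ((measurable_resid hd.measurable_m).abs).pow_const _
  have hSi0 : Integrable (fun ω => (slab x (h n)).indicator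
      (fun v => |resid m v| ^ (2 + ζ)) (obs Y X 0 ω)) P := by
    have := (hd.integrable_err_rpow 0).indicator
      (hd.measurable_X 0 (measurableSet_cuboid x (h n)))
    exact this
  have hSe0 : ∫ ω, (slab x (h n)).indicator (fun v => |resid m v| ^ (2 + ζ)) (obs Y X 0 ω) ∂P
      ≤ Mu * cubeProb P X x (h n) := by
    have h1 := integral_indicator (μ := P) (f := fun ω => |err Y X m 0 ω| ^ (2 + ζ))
      (hd.measurable_X 0 (measurableSet_cuboid x (h n)))
    exact h1.le.trans (hMu _ hsub (measurableSet_cuboid _ _))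
  have hSm : Measurable ((slab x (h n)).indicator fun v => |resid m v| ^ (2 + ζ)) :=
    hrm.indicator (measurableSet_slab x (h n))
  have hSi := hV.integrable_comp hSm hSi0
  refine integral_abs_div_sub_div_le hDm (by linarith) hc hb1 (show (0 : ℝ) < 1 / 24 by norm_num)
    hNm hR hv.1 (by rw [← mul_assoc]; exact hv.2) hb2 hb3
    (hb4.trans (rare_le_div hD hL hLn hκ1))
    -- Summing the error moments only over observations in the cuboid gives a majorant of mean Mu·L
    -- instead of order n.
    (setIntegral_abs_le_div (S := fun ω => ∑ i ∈ Finset.range n,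
      (slab x (h n)).indicator (fun v => |resid m v| ^ (2 + ζ)) (obs Y X i ω)) (Mu := Mu)
      hζ hκ hR (integrable_finsetSum _ fun i _ => hSi i) (fun ω => ?_) ?_ hD hL hLn hb4)
  · refine abs_sum_mul_div_sum_rpow_le (by linarith) (fun i => hw0 _)
      (fun i => Set.indicator_nonneg (fun v _ => by positivity) _) fun i _ h0 => ?_
    rw [Set.indicator_of_mem (show obs Y X i ω ∈ slab x (h n) by
      by_contra hne
      exact h0 (hK.weight_eq_zero (hpos n) hne))]
  · rw [integral_finsetSum _ fun i _ => hSi i]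
    simp only [hV.integral_comp hSm, Finset.sum_const, Finset.card_range, nsmul_eq_mul]
    calc (n : ℝ) * _ ≤ n * (Mu * cubeProb P X x (h n)) := by gcongr
      _ = _ := by ring

end Estimator

/-! ### Bias and standardisation of the estimator -/

section Bias

variable {Ω : Type*} [MeasurableSpace Ω] {P : Measure Ω} [IsProbabilityMeasure P]
  {q : ℕ} {Ξ : Fin q → Type*} [∀ l, PseudoMetricSpace (Ξ l)] [∀ l, MeasurableSpace (Ξ l)]
  {Y : ℕ → Ω → ℝ} {X : ℕ → Ω → ∀ l, Ξ l} {m μ₂ : (∀ l, Ξ l) → ℝ} {x : ∀ l, Ξ l} {ζ δ : ℝ}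
  {K : (Fin q → ℝ) → ℝ} {h : ℕ → Fin q → ℝ}

lemma le_bandwidth (h : Fin q → ℝ) (l : Fin q) : h l ≤ ⨆ l, h l :=
  le_ciSup (Set.finite_range h).bddAbove l

lemma bandwidth_pos (hq : 0 < q) {h : Fin q → ℝ} (hh : ∀ l, 0 < h l) : 0 < ⨆ l, h l :=
  (hh ⟨0, hq⟩).trans_le (le_bandwidth h _)

lemma HolderAt.exists_le (hm : HolderAt m x δ) (hq : 0 < q) (hδ : 0 < δ) :
    ∃ β : ℝ, 0 ≤ β ∧ ∀ h : Fin q → ℝ, ∀ z ∈ cuboid x h, |m z - m x| ≤ β * (⨆ l, h l) ^ δ := by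
  obtain ⟨M, hM⟩ := hm
  have : Nonempty (Fin q) := ⟨⟨0, hq⟩⟩
  refine ⟨|M|, abs_nonneg M, fun h z hz => ?_⟩
  rw [abs_sub_comm]
  have h0 : 0 ≤ ⨆ l, dist (x l) (z l) ^ δ :=
    Real.iSup_nonneg fun l => Real.rpow_nonneg dist_nonneg _
  have h1 : ⨆ l, dist (x l) (z l) ^ δ ≤ (⨆ l, h l) ^ δ := by
    refine ciSup_le fun l => Real.rpow_le_rpow dist_nonneg ?_ hδ.le
    rw [dist_comm]
    exact (hz l).trans (le_bandwidth h l)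
  calc |m x - m z| ≤ M * ⨆ l, dist (x l) (z l) ^ δ := hM z
    _ ≤ |M| * ⨆ l, dist (x l) (z l) ^ δ := mul_le_mul_of_nonneg_right (le_abs_self M) h0
    _ ≤ |M| * (⨆ l, h l) ^ δ := mul_le_mul_of_nonneg_left h1 (abs_nonneg M)

/-- The weighted sum of the increments of the regression function. -/
def biasSum (K : (Fin q → ℝ) → ℝ) (Y : ℕ → Ω → ℝ) (X : ℕ → Ω → ∀ l, Ξ l)
    (m : (∀ l, Ξ l) → ℝ) (x : ∀ l, Ξ l) (h : Fin q → ℝ) (n : ℕ) (ω : Ω) : ℝ :=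
  ∑ i ∈ Finset.range n, weight K x h (obs Y X i ω) * (m (X i ω) - m x)

lemma mhat_eq_div (Y : ℕ → Ω → ℝ) (X : ℕ → Ω → ∀ l, Ξ l) (x : ∀ l, Ξ l) (h : Fin q → ℝ) (n : ℕ)
    (ω : Ω) :
    mhat K Y X x h n ω = (∑ i ∈ Finset.range n, weight K x h (obs Y X i ω) * Y i ω) /
      weightSum K Y X x h n ω := by
  rcases Nat.eq_zero_or_pos n with rfl | hn
  · simp [mhat, An]
  · have hn' : (n : ℝ) ≠ 0 := by exact_mod_cast hn.ne'
    rw [mhat, An, Bn, mul_inv, inv_inv, div_eq_inv_mul,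
      show ∀ a b : ℝ, n * a * ((n : ℝ)⁻¹ * b) = a * b by intro a b; field_simp]
    rfl

/-- The indicator records the convention for vanishing weights: there the estimator and both
quotients are 0, which leaves -m(x). -/
lemma mhat_sub_eq (Y : ℕ → Ω → ℝ) (X : ℕ → Ω → ∀ l, Ξ l) (m : (∀ l, Ξ l) → ℝ) (x : ∀ l, Ξ l)
    (h : Fin q → ℝ) (n : ℕ) (ω : Ω) :
    mhat K Y X x h n ω - m x = errSum K Y X m x h n ω / weightSum K Y X x h n ω
      + biasSum K Y X m x h n ω / weightSum K Y X x h n ω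
      - {ω | weightSum K Y X x h n ω = 0}.indicator (fun _ => m x) ω := by
  have e : ∑ i ∈ Finset.range n, weight K x h (obs Y X i ω) * Y i ω
      = errSum K Y X m x h n ω + biasSum K Y X m x h n ω + m x * weightSum K Y X x h n ω := by
    rw [errSum, biasSum, weightSum, Finset.mul_sum, ← Finset.sum_add_distrib,
      ← Finset.sum_add_distrib]
    refine Finset.sum_congr rfl fun i _ => ?_
    simp only [resid, obs]
    ring
  rw [mhat_eq_div, e]
  by_cases h0 : weightSum K Y X x h n ω = 0
  · rw [Set.indicator_of_mem (show ω ∈ {ω | weightSum K Y X x h n ω = 0} from h0)]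
    simp [h0]
  · rw [Set.indicator_of_notMem (show ω ∉ {ω | weightSum K Y X x h n ω = 0} from h0)]
    field_simp
    ring

variable [∀ l, OpensMeasurableSpace (Ξ l)]

lemma IsKernel.measurable_mhat (hK : IsKernel K) (hd : DataAssumptions P Y X m μ₂ x ζ)
    (h : Fin q → ℝ) (n : ℕ) : Measurable (mhat K Y X x h n) := by
  have hw : ∀ i, Measurable fun ω => K (scaledDist x h (X i ω)) := fun i =>
    (hK.measurable_scaledDist x h).comp (hd.measurable_X i)
  have hA : Measurable (An K Y X x h n) :=
    (Finset.measurable_sum _ fun i _ => (hw i).mul (hd.measurable_Y i)).const_mul _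
  have hB : Measurable (Bn K X x h n) := (Finset.measurable_sum _ fun i _ => hw i).const_mul _
  exact hB.inv.mul hA

lemma IsKernel.integrable_mhat (hK : IsKernel K) (hd : DataAssumptions P Y X m μ₂ x ζ)
    (h : Fin q → ℝ) (n : ℕ) : Integrable (mhat K Y X x h n) P := by
  refine (integrable_finsetSum (Finset.range n) fun i _ => (hd.integrable_Y i).abs).mono'
    (hK.measurable_mhat hd h n).aestronglyMeasurable (ae_of_all _ fun ω => ?_)
  rw [mhat_eq_div]
  refine abs_sum_mul_div_sum_le (fun i => hK.nonneg _) (Finset.sum_nonneg fun i _ => abs_nonneg _)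
    fun i hi _ => ?_
  exact Finset.single_le_sum (f := fun i => |Y i ω|) (fun j _ => abs_nonneg _) hi

/-- Linearisation of the systematic part of the estimator. -/
lemma IsKernel.exists_integral_biasSum_div_le (hK : IsKernel K)
    (hd : DataAssumptions P Y X m μ₂ x ζ) (hm : HolderAt m x δ) (hq : 0 < q) (hδ : 0 < δ)
    (hj : JointMeasureBound P X x) (halt : IsTypeI K ∨ SmallCubeDoubling (P.map (X 0)) x)
    (hpos : ∀ n l, 0 < h n l) (hzero : ∀ l, Tendsto (fun n => h n l) atTop (𝓝 0))
    (hrate : Tendsto (fun n : ℕ => (n : ℝ) * cubeProb P X x (h n)) atTop atTop) :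
    ∃ (a β : ℝ) (b : ℕ → ℝ), ∀ᶠ n : ℕ in atTop, |b n| ≤ β * (⨆ l, h n l) ^ δ ∧
      Integrable (fun ω => biasSum K Y X m x (h n) n ω / weightSum K Y X x (h n) n ω - b n) P ∧
      ∫ ω, |biasSum K Y X m x (h n) n ω / weightSum K Y X x (h n) n ω - b n| ∂P
        ≤ a * ((⨆ l, h n l) ^ δ / √(n * cubeProb P X x (h n))) := by
  have hζ := hd.zeta_pos
  obtain ⟨C, κ, hκ, hV⟩ := hd.exists_stationaryMixing
  obtain ⟨c, b, D, hc, hD, hbounds⟩ :=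
    hK.exists_weightSum_bounds hd hj halt hpos hzero hrate hκ hV
  obtain ⟨β, hβ, hhol⟩ := hm.exists_le hq hδ
  set η : ℕ → ℝ := fun n => (⨆ l, h n l) ^ δ with hη
  have hη0 : ∀ n, 0 < η n := fun n => Real.rpow_pos_of_pos (bandwidth_pos hq (hpos n)) _
  -- Dividing the increments by η makes the weighted function bounded uniformly in n, so the
  -- variance constants do not depend on n; the factor η is restored at the end and yields η/√L.
  set ψ : ℕ → ℝ × (∀ l, Ξ l) → ℝ := fun n v => (η n)⁻¹ * (m v.2 - m x) with hψ
  have hψm : ∀ n, Measurable (ψ n) := fun n =>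
    ((hd.measurable_m.comp measurable_snd).sub_const _).const_mul _
  have hw0 : ∀ n (v : ℝ × ∀ l, Ξ l), 0 ≤ weight K x (h n) v := fun n v => hK.nonneg _
  have hψβ : ∀ n v, weight K x (h n) v ≠ 0 → |ψ n v| ≤ β := by
    intro n v hv
    have hmem : v.2 ∈ cuboid x (h n) := hK.mem_cuboid (hpos n) hv
    rw [hψ, abs_mul, abs_of_pos (inv_pos.2 (hη0 n)), inv_mul_le_iff₀ (hη0 n), mul_comm]
    exact hhol _ _ hmem
  have hwψ : ∀ n v, |weight K x (h n) v * ψ n v| ≤ β * weight K x (h n) v := by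
    intro n v
    rw [abs_mul, abs_of_nonneg (hw0 n v), mul_comm]
    by_cases hv : weight K x (h n) v = 0
    · simp [hv]
    · exact mul_le_mul_of_nonneg_right (hψβ n v hv) (hw0 n v)
  obtain ⟨M, B, hM, hB, hloc⟩ := hK.exists_localized_of_abs_le hd hj hpos hzero
    (mul_nonneg hβ (hK.nonneg 0)) hψm fun n v => (hwψ n v).trans
      (mul_le_mul_of_nonneg_left (hK.weight_le (hpos n) v) hβ)
  obtain ⟨a, ha, hvar⟩ := exists_integral_sq_sum_le P (obs Y X) M B hB hζ hκ hV
  have hκ1 : 1 ≤ κ := by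
    have : 0 < 4 / ζ := by positivity
    linarith
  set e : ℕ → ℝ := fun n => n * ∫ ω, weight K x (h n) (obs Y X 0 ω) * ψ n (obs Y X 0 ω) ∂P with he
  refine ⟨((a + 1) + β * (b + 1)) / (2 * (1 / 24) * c) + 2 * β * (2 * D), β,
    fun n => η n * (e n / (n * weightMean P K X x (h n))), ?_⟩
  filter_upwards [hbounds, hloc, hrate.eventually_ge_atTop 1] with n ⟨hb1, hb2, hb3, hb4⟩ hl hL
  have hLn : n * cubeProb P X x (h n) ≤ n :=
    mul_le_of_le_one_right (Nat.cast_nonneg n) measureReal_le_one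
  have hd0 : 0 < n * weightMean P K X x (h n) :=
    lt_of_lt_of_le (mul_pos hc (by linarith)) hb1
  have hDm := hK.measurable_weightSum hd (h n) n
  set G : Ω → ℝ := fun ω => ∑ i ∈ Finset.range n,
    weight K x (h n) (obs Y X i ω) * ψ n (obs Y X i ω) with hG
  have hGm : Measurable G := Finset.measurable_sum _ fun i _ =>
    ((hK.measurable_weight x (h n)).mul (hψm n)).comp (measurable_obs hd i)
  have hGb : ∀ ω, biasSum K Y X m x (h n) n ω = η n * G ω := fun ω => by
    rw [biasSum, hG, Finset.mul_sum]
    refine Finset.sum_congr rfl fun i _ => ?_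
    have := (hη0 n).ne'
    simp only [hψ, obs]
    field_simp
  have hGD : ∀ ω, |G ω| ≤ β * weightSum K Y X x (h n) n ω := fun ω =>
    abs_sum_mul_le (fun i => hw0 n _) fun i _ hi => hψβ n _ hi
  have hwi : Integrable (fun ω => weight K x (h n) (obs Y X 0 ω)) P := by
    have := hK.integrable_weight_pow (P := P) (x := x) (hd.measurable_X 0) (hpos n) 1
    simp only [pow_one] at this
    exact this
  have hed : |e n| ≤ β * (n * weightMean P K X x (h n)) := by
    rw [he, abs_mul, Nat.abs_cast, mul_left_comm]
    refine mul_le_mul_of_nonneg_left ?_ (Nat.cast_nonneg n)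
    refine abs_integral_le_integral_abs.trans ?_
    rw [show β * weightMean P K X x (h n)
      = ∫ ω, β * weight K x (h n) (obs Y X 0 ω) ∂P from (integral_const_mul _ _).symm]
    exact integral_mono_of_nonneg (ae_of_all _ fun ω => abs_nonneg _) (hwi.const_mul β)
      (ae_of_all _ fun ω => hwψ n _)
  have hv := hvar _ _ hl (Finset.range n)
  have ev : ∀ ω, ∑ i ∈ Finset.range n, (weight K x (h n) (obs Y X i ω) * ψ n (obs Y X i ω)
      - ∫ ω', weight K x (h n) (obs Y X 0 ω') * ψ n (obs Y X 0 ω') ∂P) = G ω - e n := fun ω => by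
    rw [Finset.sum_sub_distrib, Finset.sum_const, Finset.card_range, nsmul_eq_mul]
  simp only [ev, Finset.card_range] at hv
  obtain ⟨r1, r2⟩ := integral_abs_div_sub_ratio_le (fun ω => Finset.sum_nonneg fun i _ => hw0 n _)
    hDm hL hc hb1 (show (0 : ℝ) < 1 / 24 by norm_num) hβ hGm hGD hed hv.1
    (by rw [← mul_assoc]; exact hv.2) hb2 hb3 (hb4.trans (rare_le_div hD hL hLn hκ1))
  have er : ∀ ω, biasSum K Y X m x (h n) n ω / weightSum K Y X x (h n) n ω
      - η n * (e n / (n * weightMean P K X x (h n)))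
      = η n * (G ω / weightSum K Y X x (h n) n ω - e n / (n * weightMean P K X x (h n))) :=
    fun ω => by rw [hGb]; ring
  refine ⟨?_, ?_, ?_⟩
  · rw [abs_mul, abs_of_pos (hη0 n), mul_comm, abs_div, abs_of_pos hd0]
    exact mul_le_mul_of_nonneg_right ((div_le_iff₀ hd0).2 hed) (hη0 n).le
  · simp only [er]
    exact r1.const_mul _
  · simp only [er, abs_mul, abs_of_pos (hη0 n)]
    rw [integral_const_mul]
    calc _ ≤ η n * _ := mul_le_mul_of_nonneg_left r2 (hη0 n).le
      _ = _ := by rw [hη]; ring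

/-- The estimator is, up to a small remainder, the sum of a linear statistic and a deterministic
bias. -/
lemma IsKernel.exists_linearisation (hK : IsKernel K)
    (hd : DataAssumptions P Y X m μ₂ x ζ) (hm : HolderAt m x δ) (hq : 0 < q) (hδ : 0 < δ)
    (hj : JointMeasureBound P X x) (halt : IsTypeI K ∨ SmallCubeDoubling (P.map (X 0)) x)
    (hpos : ∀ n l, 0 < h n l) (hzero : ∀ l, Tendsto (fun n => h n l) atTop (𝓝 0))
    (hrate : Tendsto (fun n : ℕ => (n : ℝ) * cubeProb P X x (h n)) atTop atTop) :
    ∃ (a β : ℝ) (b : ℕ → ℝ), ∀ᶠ n : ℕ in atTop, |b n| ≤ β * (⨆ l, h n l) ^ δ ∧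
      Integrable (fun ω => mhat K Y X x (h n) n ω - m x
        - errSum K Y X m x (h n) n ω / (n * weightMean P K X x (h n)) - b n) P ∧
      ∫ ω, |mhat K Y X x (h n) n ω - m x
        - errSum K Y X m x (h n) n ω / (n * weightMean P K X x (h n)) - b n| ∂P
        ≤ a * ((n * cubeProb P X x (h n))⁻¹
          + (⨆ l, h n l) ^ δ / √(n * cubeProb P X x (h n))) ∧
      |bias P K Y X m x (h n) n - b n|
        ≤ a * ((n * cubeProb P X x (h n))⁻¹
          + (⨆ l, h n l) ^ δ / √(n * cubeProb P X x (h n))) := by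
  obtain ⟨C, κ, hκ, hV⟩ := hd.exists_stationaryMixing
  obtain ⟨c, b', D, hc, hD, hbounds⟩ :=
    hK.exists_weightSum_bounds hd hj halt hpos hzero hrate hκ hV
  obtain ⟨a₁, h1⟩ := hK.exists_integral_errSum_div_le hd hj halt hpos hzero hrate
  obtain ⟨a₂, β, b, h2⟩ :=
    hK.exists_integral_biasSum_div_le hd hm hq hδ hj halt hpos hzero hrate
  have hκ1 : 1 ≤ κ := by
    have := hd.zeta_pos
    have : 0 < 4 / ζ := by positivity
    linarith
  refine ⟨|a₁| + |a₂| + 2 * D * |m x|, β, b, ?_⟩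
  filter_upwards [hbounds, h1, h2, hrate.eventually_ge_atTop 1] with n ⟨hb1, _, _, hb4⟩
    ⟨i1, e1⟩ ⟨hb, i2, e2⟩ hL
  have hLn : n * cubeProb P X x (h n) ≤ n :=
    mul_le_of_le_one_right (Nat.cast_nonneg n) measureReal_le_one
  have hd0 : 0 < n * weightMean P K X x (h n) := lt_of_lt_of_le (mul_pos hc (by linarith)) hb1
  set L := n * cubeProb P X x (h n) with hLdef
  have hzm : MeasurableSet {ω | weightSum K Y X x (h n) n ω = 0} :=
    hK.measurable_weightSum hd (h n) n (measurableSet_singleton 0)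
  have i3 : Integrable ({ω | weightSum K Y X x (h n) n ω = 0}.indicator fun _ => m x) P :=
    (integrable_const _).indicator hzm
  have e3 : ∫ ω, |{ω | weightSum K Y X x (h n) n ω = 0}.indicator (fun _ => m x) ω| ∂P
      ≤ 2 * D * |m x| * L⁻¹ := by
    -- The event that all weights vanish lies in the lower tail of the denominator, so its
    -- probability is O(1/L).
    have h3 : P.real {ω | weightSum K Y X x (h n) n ω = 0} ≤ 2 * D / L := by
      refine le_trans (measureReal_mono fun ω hω => ?_)
        (hb4.trans (rare_le_div hD hL hLn hκ1))
      have hω' : weightSum K Y X x (h n) n ω = 0 := hω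
      change weightSum K Y X x (h n) n ω < _
      rw [hω']
      positivity
    have h4 : ∀ ω, |{ω | weightSum K Y X x (h n) n ω = 0}.indicator (fun _ => m x) ω|
        = {ω | weightSum K Y X x (h n) n ω = 0}.indicator (fun _ => |m x|) ω := fun ω => by
      by_cases hω : ω ∈ {ω | weightSum K Y X x (h n) n ω = 0} <;> simp [hω]
    simp only [h4]
    rw [integral_indicator_const _ hzm, smul_eq_mul]
    calc _ ≤ 2 * D / L * |m x| := mul_le_mul_of_nonneg_right h3 (abs_nonneg _)
      _ = _ := by rw [div_eq_mul_inv]; ring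
  set R₁ : Ω → ℝ := fun ω => errSum K Y X m x (h n) n ω / weightSum K Y X x (h n) n ω
        - errSum K Y X m x (h n) n ω / (n * weightMean P K X x (h n)) with hR₁
  set R₂ : Ω → ℝ := fun ω => biasSum K Y X m x (h n) n ω / weightSum K Y X x (h n) n ω - b n
    with hR₂
  set R₃ : Ω → ℝ := {ω | weightSum K Y X x (h n) n ω = 0}.indicator fun _ => m x with hR₃
  have er : ∀ ω, mhat K Y X x (h n) n ω - m x
      - errSum K Y X m x (h n) n ω / (n * weightMean P K X x (h n)) - b n
      = R₁ ω + R₂ ω - R₃ ω := fun ω => by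
    rw [mhat_sub_eq, hR₁, hR₂, hR₃]; ring
  have hi : Integrable (fun ω => R₁ ω + R₂ ω - R₃ ω) P := (i1.add i2).sub i3
  have hL0 : 0 < L := by linarith
  have hη0 : 0 ≤ (⨆ l, h n l) ^ δ := Real.rpow_nonneg (bandwidth_pos hq (hpos n)).le _
  have hbound : ∫ ω, |R₁ ω + R₂ ω - R₃ ω| ∂P
      ≤ (|a₁| + |a₂| + 2 * D * |m x|) * (L⁻¹ + (⨆ l, h n l) ^ δ / √L) := by
    calc ∫ ω, |R₁ ω + R₂ ω - R₃ ω| ∂P ≤ ∫ ω, (|R₁ ω| + |R₂ ω| + |R₃ ω|) ∂P := by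
          refine integral_mono hi.abs ((i1.abs.add i2.abs).add i3.abs) fun ω => ?_
          exact (abs_sub _ _).trans (add_le_add_left (abs_add_le _ _) _)
      _ = ∫ ω, |R₁ ω| ∂P + ∫ ω, |R₂ ω| ∂P + ∫ ω, |R₃ ω| ∂P := by
          rw [integral_add (by exact i1.abs.add i2.abs) i3.abs, integral_add i1.abs i2.abs]
      _ ≤ a₁ / L + a₂ * ((⨆ l, h n l) ^ δ / √L) + 2 * D * |m x| * L⁻¹ :=
          add_le_add (add_le_add e1 e2) e3
      _ ≤ _ := by
          have u0 : 0 ≤ L⁻¹ := by positivity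
          have w0 : 0 ≤ (⨆ l, h n l) ^ δ / √L := by positivity
          have v1 : a₁ / L ≤ |a₁| * L⁻¹ := by
            rw [div_eq_mul_inv]; exact mul_le_mul_of_nonneg_right (le_abs_self _) u0
          have v2 : a₂ * ((⨆ l, h n l) ^ δ / √L) ≤ |a₂| * ((⨆ l, h n l) ^ δ / √L) :=
            mul_le_mul_of_nonneg_right (le_abs_self _) w0
          have v3 : 0 ≤ |a₁| * ((⨆ l, h n l) ^ δ / √L) := by positivity
          have v4 : 0 ≤ |a₂| * L⁻¹ := by positivity
          have v5 : 0 ≤ 2 * D * |m x| * ((⨆ l, h n l) ^ δ / √L) := by positivity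
          linarith
  have hNi : ∀ i, Integrable (fun ω => weight K x (h n) (obs Y X i ω) * resid m (obs Y X i ω)) P :=
    fun i => (hd.integrable_err i).bdd_mul
      ((hK.measurable_weight x (h n)).comp (measurable_obs hd i)).aestronglyMeasurable
      (ae_of_all _ fun ω => hK.abs_le (hpos n) (X i ω))
  have hN0 : ∫ ω, errSum K Y X m x (h n) n ω / (n * weightMean P K X x (h n)) ∂P = 0 := by
    rw [integral_div]
    have : ∫ ω, errSum K Y X m x (h n) n ω ∂P = 0 := by
      simp only [errSum]
      rw [integral_finsetSum _ fun i _ => hNi i]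
      refine Finset.sum_eq_zero fun i _ => ?_
      rw [hV.integral_comp (φ := fun v => weight K x (h n) v * resid m v)
        ((hK.measurable_weight x (h n)).mul (measurable_resid hd.measurable_m)) i]
      exact hK.integral_weight_mul_resid hd (hpos n)
    rw [this, zero_div]
  have hNint : Integrable
      (fun ω => errSum K Y X m x (h n) n ω / (n * weightMean P K X x (h n))) P :=
    (integrable_finsetSum _ fun i _ => hNi i).div_const _
  refine ⟨hb, ?_, ?_, ?_⟩
  · simp only [er]; exact hi
  · simp only [er]; exact hbound
  -- The linear term has mean zero, so bias minus b_n is the mean of the remainder and inherits its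
  -- bound.
  · have ebias : bias P K Y X m x (h n) n - b n = ∫ ω, (R₁ ω + R₂ ω - R₃ ω) ∂P := by
      simp only [← er]
      have j1 := hK.integrable_mhat hd (h n) n
      rw [integral_sub (by exact (j1.sub (integrable_const _)).sub hNint) (integrable_const _),
        integral_sub (by exact j1.sub (integrable_const _)) hNint, hN0,
        integral_sub j1 (integrable_const _)]
      simp [bias]
    rw [ebias]
    exact abs_integral_le_integral_abs.trans hbound

/-- The standardisation is of exact order `√(n P_X(C(x,h)))`. -/
lemma IsKernel.exists_scale_bounds (hK : IsKernel K) (hd : DataAssumptions P Y X m μ₂ x ζ)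
    (halt : IsTypeI K ∨ SmallCubeDoubling (P.map (X 0)) x)
    (hpos : ∀ n l, 0 < h n l) (hzero : ∀ l, Tendsto (fun n => h n l) atTop (𝓝 0))
    (hrate : Tendsto (fun n : ℕ => (n : ℝ) * cubeProb P X x (h n)) atTop atTop) :
    ∃ c c' : ℝ, 0 < c ∧ 0 < c' ∧ ∀ᶠ n : ℕ in atTop,
      c * √(n * cubeProb P X x (h n)) ≤ scale P K X μ₂ x (h n) n ∧
      scale P K X μ₂ x (h n) n ≤ c' * √(n * cubeProb P X x (h n)) := by
  have hX := hd.measurable_X 0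
  have hμ := hd.μ₂_pos
  obtain ⟨t₀, ht₀, hK0'⟩ := hK.exists_pos
  have hK0 : 0 < K 0 := hK0' 0 le_rfl ht₀.le
  obtain ⟨c₁, hc₁, h1⟩ := hK.exists_le_weightMean hX halt hpos hzero
  obtain ⟨c₂, H, hc₂, hH, h2⟩ := hK.exists_le_integral_pow hX halt 2
  refine ⟨c₁ / √(μ₂ x * K 0 ^ 2), K 0 / √(μ₂ x * c₂), by positivity, by positivity, ?_⟩
  filter_upwards [h1, eventually_bandwidth_le hpos hzero hH, eventually_cubeProb_pos hrate]
    with n hn1 hn2 hp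
  have u1 := h2 _ hn2
  have u2 := hK.integral_pow_le (P := P) (x := x) hX (hpos n) (two_ne_zero)
  have u3 := hK.integral_pow_le (P := P) (x := x) hX (hpos n) (one_ne_zero)
  simp only [pow_one] at u3
  rw [scale]
  change c₁ * _ ≤ ∫ ω, K (scaledDist x (h n) (X 0 ω)) ∂P at hn1
  set p := cubeProb P X x (h n)
  set k₁ := ∫ ω, K (scaledDist x (h n) (X 0 ω)) ∂P
  set k₂ := ∫ ω, K (scaledDist x (h n) (X 0 ω)) ^ 2 ∂P
  have hk₂ : 0 < k₂ := lt_of_lt_of_le (by positivity) u1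
  -- The square root of np is brought into the shape of the standardisation, with EK and EK²
  -- replaced by multiples of p, so that monotonicity can be applied in each argument.
  have key : ∀ c : ℝ, 0 < c → √(n * p) = √n * p * √c / √(c * p) := fun c hc => by
    rw [Real.sqrt_mul (Nat.cast_nonneg n), Real.sqrt_mul hc.le]
    have e1 : √p * √p = p := Real.mul_self_sqrt hp.le
    have e2 : 0 < √p := Real.sqrt_pos.2 hp
    have e3 : 0 < √c := Real.sqrt_pos.2 hc
    rw [eq_div_iff (by positivity)]
    linear_combination (√n * √c) * e1
  constructor
  · rw [key (μ₂ x * K 0 ^ 2) (by positivity)]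
    have hs : 0 < √(μ₂ x * K 0 ^ 2) := by positivity
    calc c₁ / √(μ₂ x * K 0 ^ 2) * (√n * p * √(μ₂ x * K 0 ^ 2) / √(μ₂ x * K 0 ^ 2 * p))
        = √n * (c₁ * p) / √(μ₂ x * K 0 ^ 2 * p) := by field_simp
      _ ≤ √n * k₁ / √(μ₂ x * k₂) := by
          gcongr √n * ?_ / √?_
          · exact (by positivity : (0 : ℝ) ≤ c₁ * p).trans hn1 |> fun h => by positivity
          · rw [mul_assoc]; gcongr
  · rw [key (μ₂ x * c₂) (by positivity)]
    have hs : 0 < √(μ₂ x * c₂) := by positivity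
    calc √n * k₁ / √(μ₂ x * k₂) ≤ √n * (K 0 * p) / √(μ₂ x * c₂ * p) := by
          gcongr √n * ?_ / √?_
          rw [mul_assoc]; gcongr
      _ = K 0 / √(μ₂ x * c₂) * (√n * p * √(μ₂ x * c₂) / √(μ₂ x * c₂ * p)) := by field_simp

end Bias

/-! ### Asymptotic normality of the estimator -/

section Normality

variable {Ω : Type*} [MeasurableSpace Ω] {P : Measure Ω} [IsProbabilityMeasure P]
  {q : ℕ} {Ξ : Fin q → Type*} [∀ l, PseudoMetricSpace (Ξ l)] [∀ l, MeasurableSpace (Ξ l)]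
  [∀ l, OpensMeasurableSpace (Ξ l)]
  {Y : ℕ → Ω → ℝ} {X : ℕ → Ω → ∀ l, Ξ l} {m μ₂ : (∀ l, Ξ l) → ℝ} {x : ∀ l, Ξ l} {ζ δ : ℝ}
  {K : (Fin q → ℝ) → ℝ} {h : ℕ → Fin q → ℝ}

lemma tendsto_bandwidth_rpow (hq : 0 < q) (hδ : 0 < δ) (hpos : ∀ n l, 0 < h n l)
    (hzero : ∀ l, Tendsto (fun n => h n l) atTop (𝓝 0)) :
    Tendsto (fun n => (⨆ l, h n l) ^ δ) atTop (𝓝 0) := by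
  have : Nonempty (Fin q) := ⟨⟨0, hq⟩⟩
  have h1 : Tendsto (fun n => ∑ l, h n l) atTop (𝓝 0) := by
    simpa using tendsto_finsetSum Finset.univ fun l _ => hzero l
  have h2 : Tendsto (fun n => ⨆ l, h n l) atTop (𝓝 0) := by
    refine squeeze_zero (fun n => (bandwidth_pos hq (hpos n)).le) (fun n => ?_) h1
    exact ciSup_le fun l => Finset.single_le_sum (fun j _ => (hpos n j).le) (Finset.mem_univ l)
  simpa [Real.zero_rpow hδ.ne'] using h2.rpow_const (p := δ) (Or.inr hδ.le)

lemma IsKernel.eventually_integral_sq_pos (hK : IsKernel K) (hX : Measurable (X 0))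
    (halt : IsTypeI K ∨ SmallCubeDoubling (P.map (X 0)) x)
    (hpos : ∀ n l, 0 < h n l) (hzero : ∀ l, Tendsto (fun n => h n l) atTop (𝓝 0))
    (hrate : Tendsto (fun n : ℕ => (n : ℝ) * cubeProb P X x (h n)) atTop atTop) :
    ∃ c : ℝ, 0 < c ∧ ∀ᶠ n in atTop, 0 < c * cubeProb P X x (h n) ∧
      c * cubeProb P X x (h n) ≤ ∫ ω, K (scaledDist x (h n) (X 0 ω)) ^ 2 ∂P := by
  obtain ⟨c, H, hc, hH, h2⟩ := hK.exists_le_integral_pow hX halt 2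
  refine ⟨c, hc, ?_⟩
  filter_upwards [eventually_bandwidth_le hpos hzero hH, eventually_cubeProb_pos hrate]
    with n hn hp
  exact ⟨mul_pos hc hp, h2 _ hn⟩

/-- Asymptotic normality of the standardised linear statistic. -/
lemma IsKernel.exists_tendstoInDistribution_errSum (hK : IsKernel K)
    (hd : DataAssumptions P Y X m μ₂ x ζ) (huc : UncorrelatedAtMassPoint P Y X m x)
    (hj : JointMeasureBound P X x) (halt : IsTypeI K ∨ SmallCubeDoubling (P.map (X 0)) x)
    (hpos : ∀ n l, 0 < h n l) (hzero : ∀ l, Tendsto (fun n => h n l) atTop (𝓝 0))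
    (hrate : Tendsto (fun n : ℕ => (n : ℝ) * cubeProb P X x (h n)) atTop atTop) :
    ∃ Z : ℕ → Ω → ℝ, TendstoInDistribution Z atTop id (fun _ => P) (gaussianReal 0 1) ∧
      ∀ᶠ n : ℕ in atTop, ∀ ω, Z n ω = scale P K X μ₂ x (h n) n *
        (errSum K Y X m x (h n) n ω / (n * weightMean P K X x (h n))) := by
  have hζ := hd.zeta_pos
  have hμ := hd.μ₂_pos
  obtain ⟨C, κ, hκ, hV⟩ := hd.exists_stationaryMixing
  obtain ⟨M, B, hM, hB, hloc⟩ := hK.exists_localized hd hj hpos hzero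
  obtain ⟨c, hc, hsq⟩ :=
    hK.eventually_integral_sq_pos (hd.measurable_X 0) halt hpos hzero hrate
  obtain ⟨c₁, hc₁, hmean⟩ := hK.exists_le_weightMean (hd.measurable_X 0) halt hpos hzero
  have hK2 : ∀ᶠ n in atTop, 0 < ∫ ω, K (scaledDist x (h n) (X 0 ω)) ^ 2 ∂P :=
    hsq.mono fun n hn => hn.1.trans_le hn.2
  have hratio := hK.tendsto_integral_sq_ratio hd hpos hzero hK2
  set f : ℕ → ℝ × (∀ l, Ξ l) → ℝ := fun n v => weight K x (h n) v * resid m v with hf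
  set v : ℕ → ℝ := fun n => ∫ ω, f n (obs Y X 0 ω) ^ 2 ∂P with hv
  set k₂ : ℕ → ℝ := fun n => ∫ ω, K (scaledDist x (h n) (X 0 ω)) ^ 2 ∂P with hk₂
  have hvar : ∀ᶠ n in atTop, μ₂ x * c / 2 * cubeProb P X x (h n) ≤ v n := by
    filter_upwards [hsq, hratio.eventually_const_lt (show (1 / 2 : ℝ) < 1 by norm_num)]
      with n hn hr
    have hk : 0 < k₂ n := hn.1.trans_le hn.2
    rw [lt_div_iff₀ (mul_pos hμ hk)] at hr
    have := mul_le_mul_of_nonneg_left hn.2 hμ.le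
    change _ ≤ ∫ ω, (weight K x (h n) (obs Y X 0 ω) * resid m (obs Y X 0 ω)) ^ 2 ∂P
    linarith
  have hclt := tendstoInDistribution_sum_localized (A := fun n => slab x (h n)) (f := f)
    hζ hκ hM hB hV (show 0 < μ₂ x * c / 2 by positivity)
    (fun n => (hK.measurable_weight x _).mul (measurable_resid hd.measurable_m)) hloc
    (Eventually.of_forall fun n => hK.integral_weight_mul_resid hd (hpos n)) hvar hrate
    fun l hl => hK.tendsto_acov_div hd hpos hzero huc hV hloc (eventually_cubeProb_pos hrate) hl
  -- Slutsky's lemma exchanges the exact standard deviation of the weighted errors for √(μ₂(x) EK²).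
  have hr : Tendsto (fun n => √(v n / (μ₂ x * k₂ n))) atTop (𝓝 1) := by
    simpa using hratio.sqrt
  have hslut := hclt.continuous_comp_prodMk_of_tendstoInMeasure_const
    (g := fun y : ℝ × ℝ => y.2 * y.1) (by fun_prop)
    (Y := fun n _ => √(v n / (μ₂ x * k₂ n))) (c := 1)
    (tendstoInMeasure_of_tendsto_ae (fun n => aestronglyMeasurable_const)
      (ae_of_all _ fun _ => hr)) (fun n => aemeasurable_const)
  have hid : (fun ω : ℝ => (1 : ℝ) * id ω) = id := funext fun ω => one_mul ω
  simp only [hid] at hslut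
  refine ⟨_, hslut, ?_⟩
  filter_upwards [hsq, hvar, hmean, eventually_cubeProb_pos hrate, eventually_gt_atTop 0]
    with n hn hvn hmn hp hn0 ω
  have hk : 0 < k₂ n := hn.1.trans_le hn.2
  have hv0 : 0 < v n := lt_of_lt_of_le (by positivity) hvn
  have hw0 : 0 < weightMean P K X x (h n) := lt_of_lt_of_le (by positivity) hmn
  have hn' : (0 : ℝ) < n := by exact_mod_cast hn0
  have hsn : √(n : ℝ) * √(n : ℝ) = n := Real.mul_self_sqrt hn'.le
  rw [scale]
  change √(v n / (μ₂ x * k₂ n)) * ((√(n * v n))⁻¹ * errSum K Y X m x (h n) n ω)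
    = √n * weightMean P K X x (h n) / √(μ₂ x * k₂ n) *
      (errSum K Y X m x (h n) n ω / (n * weightMean P K X x (h n)))
  rw [Real.sqrt_div hv0.le, Real.sqrt_mul hn'.le]
  have s1 : 0 < √(v n) := Real.sqrt_pos.2 hv0
  have s2 : 0 < √(n : ℝ) := Real.sqrt_pos.2 hn'
  have s3 : 0 < √(μ₂ x * k₂ n) := Real.sqrt_pos.2 (mul_pos hμ hk)
  field_simp
  rw [sq, hsn, mul_comm]

/-- After scaling by √L the remainder is a(1/√L + η), which vanishes as soon as h → 0 and L → ∞;
centring at the bias thus needs no undersmoothing. -/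
lemma tendsto_inv_sqrt_add {L η : ℕ → ℝ} (hL : Tendsto L atTop atTop) (hη : Tendsto η atTop (𝓝 0))
    (a : ℝ) : Tendsto (fun n => √(L n) * (a * ((L n)⁻¹ + η n / √(L n)))) atTop (𝓝 0) := by
  have h1 : Tendsto (fun n => a * ((√(L n))⁻¹ + η n)) atTop (𝓝 0) := by
    simpa using ((tendsto_inv_atTop_zero.comp (Real.tendsto_sqrt_atTop.comp hL)).add hη).const_mul a
  refine h1.congr' ?_
  filter_upwards [hL.eventually_gt_atTop 0] with n hn
  have s : 0 < √(L n) := Real.sqrt_pos.2 hn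
  have e : L n = √(L n) * √(L n) := (Real.mul_self_sqrt hn.le).symm
  have e2 : √(L n) * (L n)⁻¹ = (√(L n))⁻¹ := by
    nth_rewrite 2 [e]
    field_simp
  have e3 : √(L n) * (η n / √(L n)) = η n := by field_simp
  linear_combination (-a) * e2 - a * e3

/-- Asymptotic normality of the estimator, for any centring close enough to the bias. -/
lemma IsKernel.tendstoInDistribution_mhat (hK : IsKernel K)
    (hd : DataAssumptions P Y X m μ₂ x ζ) (hq : 0 < q) (hδ : 0 < δ)
    (huc : UncorrelatedAtMassPoint P Y X m x)
    (hj : JointMeasureBound P X x) (halt : IsTypeI K ∨ SmallCubeDoubling (P.map (X 0)) x)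
    (hpos : ∀ n l, 0 < h n l) (hzero : ∀ l, Tendsto (fun n => h n l) atTop (𝓝 0))
    (hrate : Tendsto (fun n : ℕ => (n : ℝ) * cubeProb P X x (h n)) atTop atTop)
    {a : ℝ} {b : ℕ → ℝ} (hlin : ∀ᶠ n : ℕ in atTop,
      Integrable (fun ω => mhat K Y X x (h n) n ω - m x
        - errSum K Y X m x (h n) n ω / (n * weightMean P K X x (h n)) - b n) P ∧
      ∫ ω, |mhat K Y X x (h n) n ω - m x
        - errSum K Y X m x (h n) n ω / (n * weightMean P K X x (h n)) - b n| ∂P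
        ≤ a * ((n * cubeProb P X x (h n))⁻¹
          + (⨆ l, h n l) ^ δ / √(n * cubeProb P X x (h n)))) {c : ℕ → ℝ}
    (hcb : Tendsto (fun n : ℕ => √(n * cubeProb P X x (h n)) * |c n - b n|) atTop (𝓝 0)) :
    TendstoInDistribution (fun (n : ℕ) ω => scale P K X μ₂ x (h n) n *
      (mhat K Y X x (h n) n ω - m x - c n)) atTop id (fun _ => P) (gaussianReal 0 1) := by
  obtain ⟨Z, hZ, hZe⟩ :=
    hK.exists_tendstoInDistribution_errSum hd huc hj halt hpos hzero hrate
  obtain ⟨c₁, c₂, hc₁, hc₂, hscale⟩ := hK.exists_scale_bounds hd halt hpos hzero hrate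
  refine tendstoInDistribution_of_tendstoInMeasure_sub _ _ hZ ?_ fun n =>
    ((((hK.measurable_mhat hd (h n) n).sub_const _).sub_const _).const_mul _).aemeasurable
  set R : ℕ → Ω → ℝ := fun n ω => mhat K Y X x (h n) n ω - m x
    - errSum K Y X m x (h n) n ω / (n * weightMean P K X x (h n)) - b n with hR
  have hdiff : ∀ᶠ n : ℕ in atTop, (fun ω => scale P K X μ₂ x (h n) n *
      (mhat K Y X x (h n) n ω - m x - c n) - Z n ω)
      = fun ω => scale P K X μ₂ x (h n) n * (R n ω - (c n - b n)) := by
    filter_upwards [hZe] with n hn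
    funext ω
    rw [hn, hR]
    ring
  refine tendstoInMeasure_of_integral_abs ?_ ?_
  · filter_upwards [hdiff, hlin] with n hn hl
    change Integrable (fun ω => scale P K X μ₂ x (h n) n *
      (mhat K Y X x (h n) n ω - m x - c n) - Z n ω) P
    rw [hn]
    exact (hl.1.sub (integrable_const _)).const_mul _
  · have hlim := ((tendsto_inv_sqrt_add hrate (tendsto_bandwidth_rpow hq hδ hpos hzero) a).add
      hcb).const_mul c₂
    simp only [add_zero, mul_zero] at hlim
    refine squeeze_zero' (Eventually.of_forall fun n => integral_nonneg fun ω => abs_nonneg _)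
      ?_ hlim
    filter_upwards [hdiff, hlin, hscale] with n hn hl hs
    have hs0 : 0 ≤ scale P K X μ₂ x (h n) n := le_trans (by positivity) hs.1
    have e : ∀ ω, |((fun (n : ℕ) ω => scale P K X μ₂ x (h n) n *
        (mhat K Y X x (h n) n ω - m x - c n)) - Z) n ω|
        = scale P K X μ₂ x (h n) n * |R n ω - (c n - b n)| := fun ω => by
      refine (congrArg abs (congrFun hn ω)).trans ?_
      rw [abs_mul, abs_of_nonneg hs0]
    simp only [e]
    rw [integral_const_mul]
    have hi : ∫ ω, |R n ω - (c n - b n)| ∂P ≤ ∫ ω, |R n ω| ∂P + |c n - b n| := by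
      calc ∫ ω, |R n ω - (c n - b n)| ∂P ≤ ∫ ω, (|R n ω| + |c n - b n|) ∂P :=
            integral_mono (hl.1.sub (integrable_const _)).abs
              (hl.1.abs.add (integrable_const _)) fun ω => abs_sub _ _
        _ = _ := by
            rw [integral_add hl.1.abs (integrable_const _)]
            simp [hR]
    have h0 : 0 ≤ ∫ ω, |R n ω - (c n - b n)| ∂P := integral_nonneg fun ω => abs_nonneg _
    calc scale P K X μ₂ x (h n) n * ∫ ω, |R n ω - (c n - b n)| ∂P
        ≤ c₂ * √(n * cubeProb P X x (h n)) * ∫ ω, |R n ω - (c n - b n)| ∂P :=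
          mul_le_mul_of_nonneg_right hs.2 h0
      _ ≤ c₂ * √(n * cubeProb P X x (h n)) * (a * ((n * cubeProb P X x (h n))⁻¹
          + (⨆ l, h n l) ^ δ / √(n * cubeProb P X x (h n))) + |c n - b n|) := by
          gcongr
          exact hi.trans (add_le_add_left hl.2 _)
      _ = _ := by ring

end Normality

end NW

end

/-! ### Assembly of the three conclusions -/

theorem theorem1 {Ω : Type*} [MeasurableSpace Ω] (P : Measure Ω) [IsProbabilityMeasure P]
    {q : ℕ} (hq : 0 < q) {Ξ : Fin q → Type*} [∀ l, PseudoMetricSpace (Ξ l)]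
    [∀ l, MeasurableSpace (Ξ l)] [∀ l, OpensMeasurableSpace (Ξ l)]
    (Y : ℕ → Ω → ℝ) (X : ℕ → Ω → ∀ l, Ξ l) (m μ₂ : (∀ l, Ξ l) → ℝ) (x : ∀ l, Ξ l)
    (K : (Fin q → ℝ) → ℝ) (ζ δ : ℝ) (hδ : 0 < δ)
    (hK : NW.IsKernel K)
    (hdata : NW.DataAssumptions P Y X m μ₂ x ζ)
    (hm : NW.HolderAt m x δ)
    (hjoint : NW.JointMeasureBound P X x)
    (halt : NW.IsTypeI K ∨ NW.SmallCubeDoubling (P.map (X 0)) x)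
    (h : ℕ → Fin q → ℝ) (hpos : ∀ n l, 0 < h n l)
    (hzero : ∀ l, Tendsto (fun n => h n l) atTop (𝓝 0))
    (hrate : Tendsto (fun n : ℕ => (n : ℝ) * (P.map (X 0)).real (NW.cuboid x (h n)))
      atTop atTop) :
    -- (a), including the existence of the expectation in the bias
    (∀ n, Integrable (NW.mhat K Y X x (h n) n) P) ∧
    (NW.UncorrelatedAtMassPoint P Y X m x →
      TendstoInDistribution
        (fun (n : ℕ) ω => NW.scale P K X μ₂ x (h n) n *
          (NW.mhat K Y X x (h n) n ω - m x - NW.bias P K Y X m x (h n) n))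
        atTop id (fun _ => P) (gaussianReal 0 1)) ∧
    -- (b)
    ((fun n : ℕ => NW.bias P K Y X m x (h n) n) =O[atTop]
      fun n : ℕ => (⨆ l, h n l) ^ δ + ((n : ℝ) * (P.map (X 0)).real (NW.cuboid x (h n)))⁻¹) ∧
    ((fun n : ℕ => NW.scale P K X μ₂ x (h n) n) =Θ[atTop]
      fun n : ℕ => √((n : ℝ) * (P.map (X 0)).real (NW.cuboid x (h n)))) ∧
    -- (c)
    (NW.UncorrelatedAtMassPoint P Y X m x →
      Tendsto (fun n : ℕ => (⨆ l, h n l) ^ (2 * δ) *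
        ((n : ℝ) * (P.map (X 0)).real (NW.cuboid x (h n)))) atTop (𝓝 0) →
      TendstoInDistribution
        (fun (n : ℕ) ω => NW.scale P K X μ₂ x (h n) n *
          (NW.mhat K Y X x (h n) n ω - m x))
        atTop id (fun _ => P) (gaussianReal 0 1)) := by
  have hX := hdata.measurable_X 0
  simp only [NW.measureReal_map_cuboid hX] at hrate ⊢
  obtain ⟨a, β, b, hlin⟩ :=
    hK.exists_linearisation hdata hm hq hδ hjoint halt hpos hzero hrate
  obtain ⟨c₁, c₂, hc₁, hc₂, hscale⟩ := hK.exists_scale_bounds hdata halt hpos hzero hrate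
  have hη := NW.tendsto_bandwidth_rpow hq hδ hpos hzero
  have hη0 : ∀ n, 0 ≤ (⨆ l, h n l) ^ δ := fun n =>
    Real.rpow_nonneg (NW.bandwidth_pos hq (hpos n)).le _
  have hrem := hlin.mono fun n hn => And.intro hn.2.1 hn.2.2.1
  refine ⟨fun n => hK.integrable_mhat hdata (h n) n, fun huc => ?_, ?_, ⟨?_, ?_⟩,
    fun huc hsmall => ?_⟩
  -- Centring at the exact bias is allowed, because it differs from b_n by o(1/√L).
  · refine hK.tendstoInDistribution_mhat hdata hq hδ huc hjoint halt hpos hzero hrate hrem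
      (squeeze_zero' (Eventually.of_forall fun n => by positivity) ?_
        (NW.tendsto_inv_sqrt_add hrate hη a))
    filter_upwards [hlin] with n hn
    exact mul_le_mul_of_nonneg_left hn.2.2.2 (Real.sqrt_nonneg _)
  · refine IsBigO.of_bound (|β| + |a|) ?_
    filter_upwards [hlin, hrate.eventually_ge_atTop 1] with n hn hL
    set L := (n : ℝ) * NW.cubeProb P X x (h n)
    set η := (⨆ l, h n l) ^ δ with hηn
    have h0 : 0 ≤ η := hη0 n
    have hL0 : 0 < L := by linarith
    have hs : 1 ≤ √L := Real.one_le_sqrt.2 hL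
    -- In the bias bound the cross term η/√L is absorbed by η once L ≥ 1.
    have h1 : η / √L ≤ η := div_le_self h0 hs
    have hLi : 0 ≤ L⁻¹ := by positivity
    rw [Real.norm_eq_abs, Real.norm_eq_abs, abs_of_nonneg (add_nonneg h0 hLi)]
    have h2 : |NW.bias P K Y X m x (h n) n| ≤ |NW.bias P K Y X m x (h n) n - b n| + |b n| := by
      simpa using abs_add_le (NW.bias P K Y X m x (h n) n - b n) (b n)
    have h3 : a * (L⁻¹ + η / √L) ≤ |a| * (L⁻¹ + η) :=
      (mul_le_mul_of_nonneg_right (le_abs_self a) (by positivity)).trans (by gcongr)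
    have h4 : β * η ≤ |β| * η := mul_le_mul_of_nonneg_right (le_abs_self β) h0
    have h5 : 0 ≤ |β| * L⁻¹ := by positivity
    have h6 := hn.1
    have h7 := hn.2.2.2
    linarith
  · refine IsBigO.of_bound c₂ ?_
    filter_upwards [hscale] with n hn
    rw [Real.norm_of_nonneg (le_trans (by positivity) hn.1), Real.norm_of_nonneg (by positivity)]
    exact hn.2
  · refine IsBigO.of_bound c₁⁻¹ ?_
    filter_upwards [hscale] with n hn
    rw [Real.norm_of_nonneg (le_trans (by positivity) hn.1), Real.norm_of_nonneg (by positivity),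
      le_inv_mul_iff₀ hc₁]
    exact hn.1
  -- Without centring the whole of b_n must be negligible: √L |b_n| ≤ |β| √(η² L), and η² L → 0 is
  -- the undersmoothing condition.
  · have hconv := hK.tendstoInDistribution_mhat hdata hq hδ huc hjoint halt hpos hzero hrate hrem
      (c := fun _ => 0) ?_
    · simpa only [sub_zero] using hconv
    have hlim : Tendsto (fun n : ℕ => |β| * √((⨆ l, h n l) ^ (2 * δ) *
        ((n : ℝ) * NW.cubeProb P X x (h n)))) atTop (𝓝 0) := by
      simpa using hsmall.sqrt.const_mul |β|
    refine squeeze_zero' (Eventually.of_forall fun n => by positivity) ?_ hlim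
    filter_upwards [hlin] with n hn
    have hpos' := NW.bandwidth_pos hq (hpos n)
    have e : (⨆ l, h n l) ^ (2 * δ) = ((⨆ l, h n l) ^ δ) ^ 2 := by
      rw [mul_comm, Real.rpow_mul hpos'.le]
      norm_cast
    rw [e, Real.sqrt_mul (sq_nonneg _), Real.sqrt_sq (hη0 n), zero_sub, abs_neg]
    have h4 : |b n| ≤ |β| * (⨆ l, h n l) ^ δ :=
      hn.1.trans (mul_le_mul_of_nonneg_right (le_abs_self β) (hη0 n))
    calc _ ≤ √((n : ℝ) * NW.cubeProb P X x (h n)) * (|β| * (⨆ l, h n l) ^ δ) := by gcongr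
      _ = _ := by ring
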